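/- Let $k_1,k_2,\ldots$ be nonnegative integers with $k_i>0$ for infinitely many $i$. Let $\Lambda$ be the small category with objects (units) $v_1,v_2,\ldots$ generated by morphisms $\alpha_i,\beta_i,\gamma_i^{(j)}$ ($i\ge 1$, $1\le j\le k_i$), each with range $v_i$ and source $v_{i+1}$, subject to the relations $\alpha_i\beta_{i+1}=\beta_i\alpha_{i+1}$ ($i\ge1$); the product $\mu\nu$ is defined when $s(\mu)=r(\nu)$. (Thus $\Lambda$ is the amalgamation over the vertices of the $2$-graph $\Lambda_1$ with edges $\alpha_i,\beta_i$ and the $1$-graph $\Lambda_2$ with edges $\gamma_i^{(j)}$.) We write $v_i\alpha^m\beta^n$ for $\alpha_i\cdots\alpha_{i+m-1}\beta_{i+m}\cdots\beta_{i+m+n-1}$. For $\mu\in\Lambda$, its prefixes are the $\lambda$ with $\mu\in\lambda\Lambda$. Let $\Lambda^*$ be the set of nonempty subsets $x\subseteq\Lambda$ that are hereditary (closed under prefixes) and directed (any two elements of $x$ have a common extension in $x$). All elements of such an $x$ have the same range, denoted $r(x)$. Give $\Lambda^*$ the topology with base the sets $Z(\lambda)\setminus\bigcup_{i=1}^{t}Z(\mu_i)$,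 where $Z(\mu)=\{x:\mu\in x\}$. Let $\partial\Lambda$ be the closure of the set of maximal elements of $\Lambda^*$ with respect to inclusion, and let $X=\{x\in\partial\Lambda: r(x)=v_1\}$. For $r(x)=s(\mu)$ let $\mu x\in\Lambda^*$ be the set of all prefixes of the elements $\mu\nu$, $\nu\in x$. For a unit $v$ let $v\alpha^\infty\beta^\infty=\{v\alpha^m\beta^n:m,n\ge0\}\in\Lambda^*$, and write $\mu\alpha^\infty\beta^\infty=\mu\,(s(\mu)\alpha^\infty\beta^\infty)$. Let $G(\Lambda)$ be the groupoid with unit space $\Lambda^*$ of classes $[\mu,\nu,x]$ of triples with $s(\mu)=s(\nu)=r(x)$, for the equivalence relation generated by $(\mu,\nu,\eta x)\sim(\mu\eta,\nu\eta,x)$, with $r[\mu,\nu,x]=\mu x$, $s[\mu,\nu,x]=\nu x$, $[\mu,\nu,x]^{-1}=[\nu,\mu,x]$, $[\mu,\nu,x][\nu,\eta,x]=[\mu,\eta,x]$, and with the topology having as base the sets $[\mu,\nu,E]=\{[\mu,\nu,x]:x\in E\}$ for compact open $E\subseteq\Lambda^*$ all of whose elements have range $s(\mu)=s(\nu)$.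 Let $G=G(\Lambda)|_X$ be its reduction to $X$ (all arrows with range and source in $X$), and let $C^*(G)$ be its full groupoid $C^*$-algebra. Then: 1. $G$ is minimal: every orbit is dense in $G^{(0)}=X$. 2. $G$ is topologically free: the set of $x\in X$ with trivial isotropy ($xGx=\{x\}$) is dense in $X$. 3. $G$ is not principal: some point of $X$ has nontrivial isotropy. 4. A point $x\in X$ has nontrivial isotropy if and only if $x=\mu\alpha^\infty\beta^\infty$ for some $\mu\in\Lambda$ with $r(\mu)=v_1$. 5. $C^*(G)$ is a simple $C^*$-algebra: it is nonzero and has no closed two-sided ideals other than $0$ and itself. -/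

import Mathlib

open CategoryTheory
open scoped ENNReal

universe u v

/-! ## Groupoids, given by their set of arrows -/

/-- A groupoid with unit space `X` and set of arrows `G`.  The product `a b` is defined exactly when
`s(a) = r(b)`.  (Arrows form a single type so that they can carry a topology.) -/
structure ArrowGroupoid (X : Type u) (G : Type v) where
  rng : G → X
  src : G → X
  one : X → G
  inv : G → G
  mul : (a b : G) → src a = rng b → G
  rng_one : ∀ x, rng (one x) = x
  src_one : ∀ x, src (one x) = x
  rng_inv : ∀ a, rng (inv a) = src a
  src_inv : ∀ a, src (inv a) = rng a
  rng_mul : ∀ a b h, rng (mul a b h) = rng a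
  src_mul : ∀ a b h, src (mul a b h) = src b
  one_mul : ∀ a, mul (one (rng a)) a (src_one _) = a
  mul_one : ∀ a, mul a (one (src a)) (rng_one _).symm = a
  inv_mul : ∀ a, mul (inv a) a (src_inv a) = one (src a)
  mul_inv : ∀ a, mul a (inv a) (rng_inv a).symm = one (rng a)
  mul_assoc : ∀ a b c (hab : src a = rng b) (hbc : src b = rng c),
    mul (mul a b hab) c ((src_mul a b hab).trans hbc) =
      mul a (mul b c hbc) (hab.trans (rng_mul b c hbc).symm)

namespace ArrowGroupoid

variable {X : Type u} {G : Type v}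

/-- The reduction of a groupoid to a subset `Y` of its unit space: all arrows with range and source
in `Y`. -/
def reduction (Γ : ArrowGroupoid X G) (Y : Set X) :
    ArrowGroupoid Y {γ : G // Γ.rng γ ∈ Y ∧ Γ.src γ ∈ Y} where
  rng γ := ⟨Γ.rng γ.1, γ.2.1⟩
  src γ := ⟨Γ.src γ.1, γ.2.2⟩
  one x := ⟨Γ.one x.1, by rw [Γ.rng_one]; exact x.2, by rw [Γ.src_one]; exact x.2⟩
  inv γ := ⟨Γ.inv γ.1, by rw [Γ.rng_inv]; exact γ.2.2, by rw [Γ.src_inv]; exact γ.2.1⟩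
  mul a b h := ⟨Γ.mul a.1 b.1 (congrArg Subtype.val h),
    by rw [Γ.rng_mul]; exact a.2.1, by rw [Γ.src_mul]; exact b.2.2⟩
  rng_one x := Subtype.ext (Γ.rng_one _)
  src_one x := Subtype.ext (Γ.src_one _)
  rng_inv a := Subtype.ext (Γ.rng_inv _)
  src_inv a := Subtype.ext (Γ.src_inv _)
  rng_mul a b h := Subtype.ext (Γ.rng_mul _ _ _)
  src_mul a b h := Subtype.ext (Γ.src_mul _ _ _)
  one_mul a := Subtype.ext (Γ.one_mul _)
  mul_one a := Subtype.ext (Γ.mul_one _)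
  inv_mul a := Subtype.ext (Γ.inv_mul _)
  mul_inv a := Subtype.ext (Γ.mul_inv _)
  mul_assoc a b c hab hbc := Subtype.ext (Γ.mul_assoc _ _ _ _ _)

/-- `xΓx = {x}`. -/
def HasTrivialIsotropy (Γ : ArrowGroupoid X G) (x : X) : Prop :=
  ∀ γ : G, Γ.rng γ = x → Γ.src γ = x → γ = Γ.one x

/-- Every point of the unit space has trivial isotropy. -/
def IsPrincipal (Γ : ArrowGroupoid X G) : Prop :=
  ∀ x : X, Γ.HasTrivialIsotropy x

/-- The orbit `r(Γx)` of a unit `x`. -/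
def orbit (Γ : ArrowGroupoid X G) (x : X) : Set X :=
  {y | ∃ γ : G, Γ.src γ = x ∧ Γ.rng γ = y}

/-- The points with trivial isotropy are dense in the unit space. -/
def IsTopologicallyFree [TopologicalSpace X] (Γ : ArrowGroupoid X G) : Prop :=
  Dense {x : X | Γ.HasTrivialIsotropy x}

/-- Every orbit is dense in the unit space. -/
def IsMinimal [TopologicalSpace X] (Γ : ArrowGroupoid X G) : Prop :=
  ∀ x : X, Dense (Γ.orbit x)

/-! ## The (full) C*-algebra of an étale groupoid -/

/-- Every arrow has an open neighbourhood on which both range and source are injective. -/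
def LocallyInjective [TopologicalSpace G] (Γ : ArrowGroupoid X G) : Prop :=
  ∀ γ : G, ∃ U : Set G, IsOpen U ∧ γ ∈ U ∧ Set.InjOn Γ.rng U ∧ Set.InjOn Γ.src U

theorem LocallyInjective.reduction [TopologicalSpace G] {Γ : ArrowGroupoid X G}
    (h : Γ.LocallyInjective) (Y : Set X) : (Γ.reduction Y).LocallyInjective := by
  intro γ
  obtain ⟨U, hU, hγ, hr, hs⟩ := h γ.1
  refine ⟨Subtype.val ⁻¹' U, hU.preimage continuous_subtype_val, hγ, ?_, ?_⟩
  · intro a ha b hb hab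
    exact Subtype.ext (hr ha hb (congrArg Subtype.val hab))
  · intro a ha b hb hab
    exact Subtype.ext (hs ha hb (congrArg Subtype.val hab))

/-- Convolution: `(f * g)(γ) = ∑ f(η) g(η⁻¹γ)`, over all `η` with `r(η) = r(γ)`.  For an étale
groupoid and compactly supported `f` this is a finite sum. -/
noncomputable def conv (Γ : ArrowGroupoid X G) (f g : G → ℂ) (γ : G) : ℂ :=
  ∑ᶠ η : {η : G // Γ.rng η = Γ.rng γ},
    f η.1 * g (Γ.mul (Γ.inv η.1) γ ((Γ.src_inv η.1).trans η.2))

/-- Involution: `f^*(γ) = conj (f(γ⁻¹))`. -/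
noncomputable def invol (Γ : ArrowGroupoid X G) (f : G → ℂ) (γ : G) : ℂ :=
  star (f (Γ.inv γ))

/-- The `I`-norm: the larger of `sup_x ∑_{s(γ) = x} |f(γ)|` and `sup_x ∑_{r(γ) = x} |f(γ)|`. -/
noncomputable def iNorm (Γ : ArrowGroupoid X G) (f : G → ℂ) : ℝ≥0∞ :=
  max (⨆ x : X, ∑' γ : {γ : G // Γ.src γ = x}, ‖f γ.1‖ₑ)
    (⨆ x : X, ∑' γ : {γ : G // Γ.rng γ = x}, ‖f γ.1‖ₑ)

theorem fibre_sum_le (p : G → X) (f : G → ℂ) (K : Set G) (t : Finset (Set G))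
    (hK : ∀ γ, γ ∉ K → f γ = 0) (hcov : K ⊆ ⋃ U ∈ t, U)
    (hinj : ∀ U ∈ t, Set.InjOn p U) (M : ℝ≥0∞) (hM : ∀ γ, ‖f γ‖ₑ ≤ M) (x : X) :
    ∑' γ : {γ : G // p γ = x}, ‖f γ.1‖ₑ ≤ t.card * M := by
  classical
  have h1 : ∀ γ : {γ : G // p γ = x},
      ‖f γ.1‖ₑ ≤ ∑ U ∈ t, (if γ.1 ∈ U then ‖f γ.1‖ₑ else 0) := by
    intro γ
    by_cases hγ : γ.1 ∈ K
    · have h2 := hcov hγ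
      simp only [Set.mem_iUnion] at h2
      obtain ⟨U, hU, hγU⟩ := h2
      calc ‖f γ.1‖ₑ = (if γ.1 ∈ U then ‖f γ.1‖ₑ else 0) := by simp [hγU]
        _ ≤ _ := Finset.single_le_sum
          (f := fun U : Set G => if γ.1 ∈ U then ‖f γ.1‖ₑ else 0) (fun _ _ => zero_le) hU
    · simp [hK _ hγ]
  calc ∑' γ : {γ : G // p γ = x}, ‖f γ.1‖ₑ
      ≤ ∑' γ : {γ : G // p γ = x}, ∑ U ∈ t, (if γ.1 ∈ U then ‖f γ.1‖ₑ else 0) :=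
        ENNReal.tsum_le_tsum h1
    _ = ∑ U ∈ t, ∑' γ : {γ : G // p γ = x}, (if γ.1 ∈ U then ‖f γ.1‖ₑ else 0) :=
        Summable.tsum_finsetSum (fun _ _ => ENNReal.summable)
    _ ≤ ∑ U ∈ t, M := by
        refine Finset.sum_le_sum fun U hU => ?_
        by_cases hne : ∃ γ₀ : {γ : G // p γ = x}, γ₀.1 ∈ U
        · obtain ⟨γ₀, h0⟩ := hne
          rw [tsum_eq_single γ₀]
          · simp only [h0, if_true]
            exact hM _
          · intro γ hγ
            rw [if_neg]
            intro hγU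
            exact hγ (Subtype.ext (hinj U hU hγU h0 (γ.2.trans γ₀.2.symm)))
        · have : ∀ γ : {γ : G // p γ = x}, (if γ.1 ∈ U then ‖f γ.1‖ₑ else 0) = 0 := by
            intro γ
            rw [if_neg]
            exact fun h => hne ⟨γ, h⟩
          simp [this]
    _ = t.card * M := by simp

theorem iNorm_lt_top [TopologicalSpace G] {Γ : ArrowGroupoid X G} (hΓ : Γ.LocallyInjective)
    (f : CompactlySupportedContinuousMap G ℂ) : Γ.iNorm f < ∞ := by
  classical
  obtain ⟨C, hC⟩ := f.hasCompactSupport.exists_bound_of_continuous f.continuous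
  have hM : ∀ γ, ‖f γ‖ₑ ≤ ENNReal.ofReal C := by
    intro γ
    rw [← ofReal_norm]
    exact ENNReal.ofReal_le_ofReal (hC γ)
  choose U hU hmem hr hs using hΓ
  obtain ⟨t, ht⟩ := f.hasCompactSupport.isCompact.elim_finite_subcover U hU
    (fun γ _ => Set.mem_iUnion.2 ⟨γ, hmem γ⟩)
  have hK : ∀ γ, γ ∉ tsupport f → f γ = 0 := fun γ hγ => image_eq_zero_of_notMem_tsupport hγ
  have hcov : tsupport f ⊆ ⋃ V ∈ t.image U, V := by
    intro γ hγ
    have := ht hγ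
    simp only [Set.mem_iUnion] at this ⊢
    obtain ⟨i, hi, hγi⟩ := this
    exact ⟨U i, Finset.mem_image_of_mem U hi, hγi⟩
  have hrange : ∀ V ∈ t.image U, Set.InjOn Γ.rng V ∧ Set.InjOn Γ.src V := by
    intro V hV
    obtain ⟨i, -, rfl⟩ := Finset.mem_image.1 hV
    exact ⟨hr i, hs i⟩
  have hfin : ((t.image U).card : ℝ≥0∞) * ENNReal.ofReal C < ∞ :=
    ENNReal.mul_lt_top (ENNReal.natCast_lt_top _) ENNReal.ofReal_lt_top
  refine lt_of_le_of_lt (max_le ?_ ?_) hfin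
  · exact iSup_le fun x => fibre_sum_le Γ.src f (tsupport f) _ hK hcov
      (fun V hV => (hrange V hV).2) _ hM x
  · exact iSup_le fun x => fibre_sum_le Γ.rng f (tsupport f) _ hK hcov
      (fun V hV => (hrange V hV).1) _ hM x

/-- A bounded `*`-representation on a Hilbert space of the convolution `*`-algebra `C_c(G)` of a
topological groupoid: a linear map that takes convolution products to products and involutes to
adjoints, and is bounded by the `I`-norm. -/
structure Rep [TopologicalSpace G] (Γ : ArrowGroupoid X G) where
  H : Type v
  [normed : NormedAddCommGroup H]
  [inner : InnerProductSpace ℂ H]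
  [complete : CompleteSpace H]
  map : CompactlySupportedContinuousMap G ℂ →ₗ[ℂ] (H →L[ℂ] H)
  map_conv : ∀ f g h : CompactlySupportedContinuousMap G ℂ,
    (h : G → ℂ) = Γ.conv f g → map h = map f * map g
  map_invol : ∀ f h : CompactlySupportedContinuousMap G ℂ,
    (h : G → ℂ) = Γ.invol f → map h = star (map f)
  bounded : ∀ f : CompactlySupportedContinuousMap G ℂ, ‖map f‖ₑ ≤ Γ.iNorm f

attribute [instance] Rep.normed Rep.inner Rep.complete

noncomputable instance [TopologicalSpace G] {Γ : ArrowGroupoid X G} (π : Γ.Rep) :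
    NonUnitalCStarAlgebra (π.H →L[ℂ] π.H) := inferInstance

/-- The C*-algebra of all bounded families of operators, indexed by the representations of
`C_c(G)`, with the supremum norm. -/
def RepProduct [TopologicalSpace G] (Γ : ArrowGroupoid X G) : Type _ :=
  lp (fun π : Γ.Rep => (π.H →L[ℂ] π.H)) ∞

noncomputable instance [TopologicalSpace G] (Γ : ArrowGroupoid X G) :
    NonUnitalCStarAlgebra Γ.RepProduct :=
  inferInstanceAs (NonUnitalCStarAlgebra (lp (fun π : Γ.Rep => (π.H →L[ℂ] π.H)) ∞))

/-- The map `f ↦ (π(f))_π`; thus `‖universal f‖ = sup_π ‖π(f)‖`. -/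
noncomputable def universal [TopologicalSpace G] {Γ : ArrowGroupoid X G}
    (hΓ : Γ.LocallyInjective) (f : CompactlySupportedContinuousMap G ℂ) : Γ.RepProduct :=
  (⟨fun π => π.map f, memℓp_infty (by
    refine ⟨(Γ.iNorm f).toReal, ?_⟩
    rintro _ ⟨π, rfl⟩
    have h := ENNReal.toReal_mono (iNorm_lt_top hΓ f).ne (π.bounded f)
    rwa [toReal_enorm] at h)⟩ : lp (fun π : Γ.Rep => (π.H →L[ℂ] π.H)) ∞)

/-- The full groupoid C*-algebra `C^*(Γ)`: the completion of `C_c(G)` in the norm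
`‖f‖ = sup_π ‖π(f)‖`, realized as the closed `*`-subalgebra generated by the image of `C_c(G)`
under the direct product of all its representations. -/
noncomputable def fullCStar [TopologicalSpace G] {Γ : ArrowGroupoid X G}
    (hΓ : Γ.LocallyInjective) : NonUnitalStarSubalgebra ℂ Γ.RepProduct :=
  (NonUnitalStarAlgebra.adjoin ℂ (Set.range (universal hΓ))).topologicalClosure

noncomputable instance [TopologicalSpace G] {Γ : ArrowGroupoid X G} (hΓ : Γ.LocallyInjective) :
    NonUnitalCStarAlgebra (fullCStar hΓ) :=
  haveI : IsClosed (fullCStar hΓ : Set Γ.RepProduct) :=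
    NonUnitalStarSubalgebra.isClosed_topologicalClosure _
  inferInstance

end ArrowGroupoid

/-- A C*-algebra is simple if it is nonzero and its only closed two-sided ideals are the trivial
ones. -/
def IsSimpleCStar (A : Type v) [NonUnitalCStarAlgebra A] : Prop :=
  Nontrivial A ∧ ∀ I : TwoSidedIdeal A, IsClosed (I : Set A) → I = ⊥ ∨ I = ⊤

/-! ## Categories of paths and their groupoids

A morphism `μ : a ⟶ b` stands for an element `μ` of `Λ` with range `a` and source `b`; the product
`μν` of the category of paths is `μ ≫ ν`. -/

/-- A category of paths: a cancellative category in which no nonunit has an inverse. -/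
class IsCategoryOfPaths (C : Type u) [Category.{v} C] : Prop where
  left_cancel : ∀ {a b c : C} (f : a ⟶ b) (g h : b ⟶ c), f ≫ g = f ≫ h → g = h
  right_cancel : ∀ {a b c : C} (f g : a ⟶ b) (h : b ⟶ c), f ≫ h = g ≫ h → f = g
  no_inverse : ∀ {a b : C} (f : a ⟶ b), IsIso f → ∃ h : a = b, f = eqToHom h

namespace PathCat

variable {C : Type u} [Category.{v} C]

/-- `aΛ`: the elements with range `a`. -/
abbrev Out (a : C) : Type (max u v) := Σ b : C, (a ⟶ b)

/-- `μ` is a prefix of `ν`. -/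
def IsPrefix {a : C} (μ ν : Out a) : Prop := ∃ ζ : μ.1 ⟶ ν.1, μ.2 ≫ ζ = ν.2

theorem IsPrefix.trans {a : C} {l m n : Out a} (h : IsPrefix l m) (h' : IsPrefix m n) :
    IsPrefix l n := by
  obtain ⟨x, hx⟩ := h
  obtain ⟨y, hy⟩ := h'
  exact ⟨x ≫ y, by rw [← Category.assoc, hx, hy]⟩

/-- `μν`, for `ν` with range `s(μ)`. -/
def shift {a b : C} (μ : a ⟶ b) (ν : Out b) : Out a := ⟨ν.1, μ ≫ ν.2⟩

theorem IsPrefix.shift {a b : C} (μ : a ⟶ b) {l m : Out b} (h : IsPrefix l m) :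
    IsPrefix (shift μ l) (PathCat.shift μ m) := by
  obtain ⟨x, hx⟩ := h
  exact ⟨x, by simp only [PathCat.shift, Category.assoc, hx]⟩

/-- `aΛ^*`: the (nonempty) directed hereditary subsets of `Λ` with range `a`.  The space `Λ^*` is
the disjoint union of its clopen subsets `aΛ^*`. -/
@[ext]
structure DirHered (a : C) where
  carrier : Set (Out a)
  nonempty : carrier.Nonempty
  directed : ∀ μ ∈ carrier, ∀ ν ∈ carrier, ∃ l ∈ carrier, IsPrefix μ l ∧ IsPrefix ν l
  hereditary : ∀ μ ∈ carrier, ∀ ν, IsPrefix ν μ → ν ∈ carrier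

namespace DirHered

/-- The generalized cylinder set `Z(μ)`. -/
def cylinder {a : C} (μ : Out a) : Set (DirHered a) := {x | μ ∈ x.carrier}

/-- The topology with base the sets `Z(l) \ (Z(μ₁) ∪ ... ∪ Z(μₖ))`. -/
instance {a : C} : TopologicalSpace (DirHered a) :=
  TopologicalSpace.generateFrom
    {s | ∃ (l : Out a) (F : Finset (Out a)), s = cylinder l \ ⋃ μ ∈ F, cylinder μ}

/-- `μx`: all prefixes of the elements `μν`, for `ν ∈ x`. -/
def act {a b : C} (μ : a ⟶ b) (x : DirHered b) : DirHered a where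
  carrier := {l | ∃ ν ∈ x.carrier, IsPrefix l (shift μ ν)}
  nonempty := by
    obtain ⟨ν, hν⟩ := x.nonempty
    exact ⟨shift μ ν, ν, hν, 𝟙 _, Category.comp_id _⟩
  directed := by
    rintro l ⟨ν, hν, hl⟩ l' ⟨ν', hν', hl'⟩
    obtain ⟨n, hn, h1, h2⟩ := x.directed ν hν ν' hν'
    exact ⟨shift μ n, ⟨n, hn, 𝟙 _, Category.comp_id _⟩,
      hl.trans (h1.shift μ), hl'.trans (h2.shift μ)⟩
  hereditary := by
    rintro l ⟨ν, hν, hl⟩ l' hl'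
    exact ⟨ν, hν, hl'.trans hl⟩

/-- The boundary of `aΛ^*`: the closure of the set of maximal elements. -/
def boundary (a : C) : Set (DirHered a) :=
  closure {x | ∀ y : DirHered a, x.carrier ⊆ y.carrier → y = x}

theorem id_mem {a : C} (x : DirHered a) : (⟨a, 𝟙 a⟩ : Out a) ∈ x.carrier := by
  obtain ⟨ν, hν⟩ := x.nonempty
  exact x.hereditary ν hν _ ⟨ν.2, Category.id_comp _⟩

theorem act_id {a : C} (x : DirHered a) : act (𝟙 a) x = x := by
  ext l
  constructor
  · rintro ⟨ν, hν, hl⟩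
    refine x.hereditary ν hν l ?_
    simpa [shift] using hl
  · intro hl
    exact ⟨l, hl, 𝟙 _, by simp [shift]⟩

theorem act_comp {a b c : C} (μ : a ⟶ b) (ν : b ⟶ c) (x : DirHered c) :
    act (μ ≫ ν) x = act μ (act ν x) := by
  ext l
  constructor
  · rintro ⟨n, hn, hl⟩
    refine ⟨shift ν n, ⟨n, hn, 𝟙 _, Category.comp_id _⟩, ?_⟩
    simpa [shift] using hl
  · rintro ⟨m, ⟨n, hn, hm⟩, hl⟩
    refine ⟨n, hn, ?_⟩
    have := hl.trans (hm.shift μ)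
    simpa [shift] using this

variable [IsCategoryOfPaths C]

theorem shift_mem_act {a b : C} (μ : a ⟶ b) (x : DirHered b) (ν : Out b) :
    shift μ ν ∈ (act μ x).carrier ↔ ν ∈ x.carrier := by
  constructor
  · rintro ⟨n, hn, ζ, hζ⟩
    refine x.hereditary n hn ν ⟨ζ, ?_⟩
    apply IsCategoryOfPaths.left_cancel μ
    exact (Category.assoc _ _ _).symm.trans hζ
  · intro h
    exact ⟨ν, h, 𝟙 _, Category.comp_id _⟩

theorem act_injective {a b : C} (μ : a ⟶ b) : Function.Injective (act μ) := by
  intro x y h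
  ext ν
  rw [← shift_mem_act μ x, h, shift_mem_act]

/-- If `η ∈ x` then `x = ηy` for some `y`. -/
theorem exists_act {a b : C} (η : a ⟶ b) (x : DirHered a) (h : (⟨b, η⟩ : Out a) ∈ x.carrier) :
    ∃ y : DirHered b, x = act η y := by
  refine ⟨⟨{ν | shift η ν ∈ x.carrier}, ⟨⟨b, 𝟙 b⟩, ?_⟩, ?_, ?_⟩, ?_⟩
  · simpa [shift] using h
  · intro μ hμ ν hν
    obtain ⟨⟨c, l⟩, hl, ⟨p, hp⟩, ⟨q, hq⟩⟩ := x.directed _ hμ _ hν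
    have hpq : μ.2 ≫ p = ν.2 ≫ q := by
      apply IsCategoryOfPaths.left_cancel η
      exact (Category.assoc _ _ _).symm.trans ((hp.trans hq.symm).trans (Category.assoc _ _ _))
    refine ⟨⟨c, μ.2 ≫ p⟩, ?_, ⟨p, rfl⟩, ⟨q, hpq.symm⟩⟩
    have hs : shift η (⟨c, μ.2 ≫ p⟩ : Out b) = ⟨c, l⟩ :=
      Sigma.ext rfl (heq_of_eq ((Category.assoc _ _ _).symm.trans hp))
    change shift η (⟨c, μ.2 ≫ p⟩ : Out b) ∈ x.carrier
    rw [hs]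
    exact hl
  · intro μ hμ ν hν
    exact x.hereditary _ hμ _ (hν.shift η)
  · ext l
    constructor
    · intro hl
      obtain ⟨⟨c, n⟩, hn, ⟨p, hp⟩, ⟨q, hq⟩⟩ := x.directed _ h _ hl
      refine ⟨⟨c, p⟩, ?_, q, ?_⟩
      · simpa [shift, hp] using hn
      · simpa [shift, hp] using hq
    · rintro ⟨ν, hν, hl⟩
      exact x.hereditary _ hν _ hl

/-- If `μx = νy` then `x = δz`, `y = εz` and `μδ = νε` for some `δ`, `ε`, `z`. -/
theorem exists_common {a b c : C} (μ : a ⟶ b) (ν : a ⟶ c) (x : DirHered b) (y : DirHered c)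
    (h : act μ x = act ν y) :
    ∃ (d : C) (δ : b ⟶ d) (ε : c ⟶ d) (z : DirHered d),
      x = act δ z ∧ y = act ε z ∧ μ ≫ δ = ν ≫ ε := by
  have h1 : (⟨b, μ⟩ : Out a) ∈ (act μ x).carrier := by
    simpa [shift] using (shift_mem_act μ x ⟨b, 𝟙 b⟩).2 x.id_mem
  have h2 : (⟨c, ν⟩ : Out a) ∈ (act μ x).carrier := by
    rw [h]
    simpa [shift] using (shift_mem_act ν y ⟨c, 𝟙 c⟩).2 y.id_mem
  obtain ⟨⟨d, l⟩, hl, ⟨δ, hδ⟩, ⟨ε, hε⟩⟩ := (act μ x).directed _ h1 _ h2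
  simp only at hδ hε
  have h3 : (⟨d, δ⟩ : Out b) ∈ x.carrier := by
    rw [← shift_mem_act μ]
    simpa [shift, hδ] using hl
  obtain ⟨z, hz⟩ := exists_act δ x h3
  refine ⟨d, δ, ε, z, hz, ?_, by rw [hδ, hε]⟩
  apply act_injective ν
  rw [← h, hz, ← act_comp, ← act_comp, hδ, hε]

end DirHered

open DirHered

/-- The triples `(μ, ν, x)` with `s(μ) = s(ν) = r(x)` and `r(μ) = r(ν) = a`. -/
structure Triple (a : C) where
  vertex : C
  left : a ⟶ vertex
  right : a ⟶ vertex
  point : DirHered vertex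

/-- The relation `(μ, ν, ηx) ∼ (μη, νη, x)`. -/
inductive Step {a : C} : Triple a → Triple a → Prop
  | mk {b c : C} (μ ν : a ⟶ b) (η : b ⟶ c) (x : DirHered c) :
      Step ⟨b, μ, ν, act η x⟩ ⟨c, μ ≫ η, ν ≫ η, x⟩

/-- The arrows of the reduction of `G(Λ)` to `aΛ^*`: the triples modulo the equivalence relation
generated by `(μ, ν, ηx) ∼ (μη, νη, x)`. -/
def Arrow (a : C) : Type (max u v) := Quot (Step (a := a))

namespace Arrow

/-- The class `[μ, ν, x]`. -/
def mk {a b : C} (μ ν : a ⟶ b) (x : DirHered b) : Arrow a := Quot.mk _ ⟨b, μ, ν, x⟩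

/-- The topology generated by the sets `[μ, ν, E]`, for `E` open. -/
instance {a : C} : TopologicalSpace (Arrow a) :=
  TopologicalSpace.generateFrom
    {s | ∃ (b : C) (μ ν : a ⟶ b) (E : Set (DirHered b)), IsOpen E ∧ s = mk μ ν '' E}

/-- `r[μ, ν, x] = μx`. -/
def rng {a : C} : Arrow a → DirHered a :=
  Quot.lift (fun t => act t.left t.point) (by
    rintro _ _ ⟨μ, ν, η, x⟩
    exact (act_comp _ _ _).symm)

/-- `s[μ, ν, x] = νx`. -/
def src {a : C} : Arrow a → DirHered a :=
  Quot.lift (fun t => act t.right t.point) (by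
    rintro _ _ ⟨μ, ν, η, x⟩
    exact (act_comp _ _ _).symm)

/-- `[μ, ν, x]⁻¹ = [ν, μ, x]`. -/
def inv {a : C} : Arrow a → Arrow a :=
  Quot.lift (fun t => mk t.right t.left t.point) (by
    rintro _ _ ⟨μ, ν, η, x⟩
    exact Quot.sound (Step.mk ν μ η x))

/-- The unit `[a, a, x]` at `x`. -/
def one {a : C} (x : DirHered a) : Arrow a := mk (𝟙 a) (𝟙 a) x

theorem mk_act {a b c : C} (μ ν : a ⟶ b) (η : b ⟶ c) (x : DirHered c) :
    mk μ ν (act η x) = mk (μ ≫ η) (ν ≫ η) x := Quot.sound (Step.mk μ ν η x)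

theorem mk_self {a b : C} (μ : a ⟶ b) (x : DirHered b) : mk μ μ x = one (act μ x) := by
  rw [one, mk_act, Category.id_comp]

variable [IsCategoryOfPaths C]

theorem mk_eq_mk {a b c : C} {μ ν : a ⟶ b} {μ' ν' : a ⟶ c} {x : DirHered b} {y : DirHered c} :
    mk μ ν x = mk μ' ν' y ↔ ∃ (d : C) (δ : b ⟶ d) (ε : c ⟶ d) (z : DirHered d),
      x = act δ z ∧ y = act ε z ∧ μ ≫ δ = μ' ≫ ε ∧ ν ≫ δ = ν' ≫ ε := by
  constructor
  · intro h
    have key : ∀ s t : Triple a, Relation.EqvGen Step s t →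
        ∃ (d : C) (δ : s.vertex ⟶ d) (ε : t.vertex ⟶ d) (z : DirHered d),
          s.point = act δ z ∧ t.point = act ε z ∧ s.left ≫ δ = t.left ≫ ε ∧
            s.right ≫ δ = t.right ≫ ε := by
      intro s t hst
      induction hst with
      | rel s t h =>
        obtain ⟨μ, ν, η, x⟩ := h
        exact ⟨_, η, 𝟙 _, x, rfl, (act_id x).symm, by simp, by simp⟩
      | refl s => exact ⟨_, 𝟙 _, 𝟙 _, s.point, (act_id _).symm, (act_id _).symm, rfl, rfl⟩
      | symm s t _ ih =>
        obtain ⟨d, δ, ε, z, h1, h2, h3, h4⟩ := ih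
        exact ⟨d, ε, δ, z, h2, h1, h3.symm, h4.symm⟩
      | trans s t r _ _ ih ih' =>
        obtain ⟨d, δ, ε, z, h1, h2, h3, h4⟩ := ih
        obtain ⟨d', δ', ε', z', h1', h2', h3', h4'⟩ := ih'
        obtain ⟨e, p, q, w, hz, hz', hpq⟩ := exists_common ε δ' z z' (h2.symm.trans h1')
        refine ⟨e, δ ≫ p, ε' ≫ q, w, ?_, ?_, ?_, ?_⟩
        · rw [h1, hz, act_comp]
        · rw [h2', hz', act_comp]
        · rw [← Category.assoc, h3, Category.assoc, hpq, ← Category.assoc, h3', Category.assoc]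
        · rw [← Category.assoc, h4, Category.assoc, hpq, ← Category.assoc, h4', Category.assoc]
    exact key _ _ (Quot.eqvGen_exact h)
  · rintro ⟨d, δ, ε, z, rfl, rfl, h3, h4⟩
    rw [mk_act, mk_act, h3, h4]

/-- `c` is a product of `p` and `q`: `p = [μ, ν, x]`, `q = [ν, η, x]` and `c = [μ, η, x]`. -/
def IsMul {a : C} (p q c : Arrow a) : Prop :=
  ∃ (b : C) (μ ν η : a ⟶ b) (x : DirHered b), p = mk μ ν x ∧ q = mk ν η x ∧ c = mk μ η x

theorem exists_isMul {a : C} (p q : Arrow a) (h : src p = rng q) : ∃ c, IsMul p q c := by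
  obtain ⟨⟨b, μ, ν, x⟩, rfl⟩ := Quot.exists_rep p
  obtain ⟨⟨b', ν', η, y⟩, rfl⟩ := Quot.exists_rep q
  obtain ⟨d, δ, ε, z, rfl, rfl, hd⟩ := exists_common ν ν' x y h
  refine ⟨mk (μ ≫ δ) (η ≫ ε) z, d, μ ≫ δ, ν ≫ δ, η ≫ ε, z, ?_, ?_, rfl⟩
  · exact mk_act μ ν δ z
  · rw [hd]
    exact mk_act ν' η ε z

theorem IsMul.unique {a : C} {p q c c' : Arrow a} (h : IsMul p q c) (h' : IsMul p q c') :
    c = c' := by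
  obtain ⟨b, μ, ν, η, x, rfl, rfl, rfl⟩ := h
  obtain ⟨b', μ', ν', η', x', hp, hq, rfl⟩ := h'
  obtain ⟨d, δ, ε, z, h1, h2, h3, h4⟩ := mk_eq_mk.1 hp
  obtain ⟨e, δ', ε', w, k1, k2, k3, k4⟩ := mk_eq_mk.1 hq
  obtain ⟨f, s, t, y, rfl, rfl, hst⟩ := exists_common δ δ' z w (h1.symm.trans k1)
  have hst' : ε ≫ s = ε' ≫ t := by
    apply IsCategoryOfPaths.left_cancel ν'
    rw [← Category.assoc, ← h4, Category.assoc, hst, ← Category.assoc, k3, Category.assoc]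
  refine mk_eq_mk.2 ⟨f, δ ≫ s, ε ≫ s, y, ?_, ?_, ?_, ?_⟩
  · rw [h1, act_comp]
  · rw [h2, act_comp]
  · rw [← Category.assoc, h3, Category.assoc]
  · rw [hst, hst', ← Category.assoc, k4, Category.assoc]

/-- The product of two composable arrows. -/
noncomputable def mul {a : C} (p q : Arrow a) (h : src p = rng q) : Arrow a :=
  Classical.choose (exists_isMul p q h)

theorem mul_eq {a : C} {p q c : Arrow a} (h : src p = rng q) (hc : IsMul p q c) :
    mul p q h = c :=
  (Classical.choose_spec (exists_isMul p q h)).unique hc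

/-- `[μ, ν, x] [ν, η, x] = [μ, η, x]`. -/
theorem mul_mk {a b : C} (μ ν η : a ⟶ b) (x : DirHered b)
    (h : src (mk μ ν x) = rng (mk ν η x)) : mul (mk μ ν x) (mk ν η x) h = mk μ η x :=
  mul_eq h ⟨b, μ, ν, η, x, rfl, rfl, rfl⟩

end Arrow

/-- The reduction of the groupoid `G(Λ)` to `aΛ^*`. -/
noncomputable def groupoid [IsCategoryOfPaths C] (a : C) :
    ArrowGroupoid (DirHered a) (Arrow a) where
  rng := Arrow.rng
  src := Arrow.src
  one := Arrow.one
  inv := Arrow.inv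
  mul := Arrow.mul
  rng_one := act_id
  src_one := act_id
  rng_inv := by
    intro p
    obtain ⟨t, rfl⟩ := Quot.exists_rep p
    rfl
  src_inv := by
    intro p
    obtain ⟨t, rfl⟩ := Quot.exists_rep p
    rfl
  rng_mul := by
    intro p q h
    obtain ⟨b, μ, ν, η, x, h1, h2, h3⟩ := Classical.choose_spec (Arrow.exists_isMul p q h)
    exact (congrArg Arrow.rng h3).trans (congrArg Arrow.rng h1).symm
  src_mul := by
    intro p q h
    obtain ⟨b, μ, ν, η, x, h1, h2, h3⟩ := Classical.choose_spec (Arrow.exists_isMul p q h)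
    exact (congrArg Arrow.src h3).trans (congrArg Arrow.src h2).symm
  one_mul := by
    intro p
    obtain ⟨⟨b, μ, ν, x⟩, rfl⟩ := Quot.exists_rep p
    exact Arrow.mul_eq _ ⟨b, μ, μ, ν, x, (Arrow.mk_self μ x).symm, rfl, rfl⟩
  mul_one := by
    intro p
    obtain ⟨⟨b, μ, ν, x⟩, rfl⟩ := Quot.exists_rep p
    exact Arrow.mul_eq _ ⟨b, μ, ν, ν, x, rfl, (Arrow.mk_self ν x).symm, rfl⟩
  inv_mul := by
    intro p
    obtain ⟨⟨b, μ, ν, x⟩, rfl⟩ := Quot.exists_rep p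
    exact Arrow.mul_eq _ ⟨b, ν, μ, ν, x, rfl, rfl, (Arrow.mk_self ν x).symm⟩
  mul_inv := by
    intro p
    obtain ⟨⟨b, μ, ν, x⟩, rfl⟩ := Quot.exists_rep p
    exact Arrow.mul_eq _ ⟨b, μ, ν, μ, x, rfl, rfl, (Arrow.mk_self μ x).symm⟩
  mul_assoc := by
    intro p q r hpq hqr
    obtain ⟨⟨b, μ, ν, x⟩, rfl⟩ := Quot.exists_rep p
    obtain ⟨c, hc⟩ := Arrow.exists_isMul q r hqr
    have hc' := hc
    obtain ⟨b', ν', η', ξ', x', rfl, rfl, rfl⟩ := hc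
    obtain ⟨d, δ, ε, z, rfl, rfl, hd⟩ := exists_common ν ν' x x' hpq
    have e1 : (Quot.mk _ ⟨b, μ, ν, act δ z⟩ : Arrow a) = Arrow.mk (μ ≫ δ) (ν ≫ δ) z :=
      Arrow.mk_act μ ν δ z
    have e2 : Arrow.mk ν' η' (act ε z) = Arrow.mk (ν ≫ δ) (η' ≫ ε) z := by
      rw [hd, Arrow.mk_act]
    have e3 : Arrow.mk η' ξ' (act ε z) = Arrow.mk (η' ≫ ε) (ξ' ≫ ε) z := Arrow.mk_act _ _ _ _
    have e4 : Arrow.mk ν' ξ' (act ε z) = Arrow.mk (ν ≫ δ) (ξ' ≫ ε) z := by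
      rw [hd, Arrow.mk_act]
    refine (Arrow.mul_eq _ (c := Arrow.mk (μ ≫ δ) (ξ' ≫ ε) z) ?_).trans
      (Arrow.mul_eq _ ?_).symm
    · exact ⟨d, _, _, _, z, Arrow.mul_eq _ ⟨d, _, _, _, z, e1, e2, rfl⟩, e3, rfl⟩
    · exact ⟨d, _, _, _, z, e1, (Arrow.mul_eq _ hc').trans e4, rfl⟩

theorem groupoid_locallyInjective [IsCategoryOfPaths C] (a : C) :
    (groupoid a).LocallyInjective := by
  intro γ
  obtain ⟨⟨b, μ, ν, x⟩, rfl⟩ := Quot.exists_rep γ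
  refine ⟨Arrow.mk μ ν '' Set.univ,
    TopologicalSpace.isOpen_generateFrom_of_mem ⟨b, μ, ν, _, isOpen_univ, rfl⟩,
    ⟨x, trivial, rfl⟩, ?_, ?_⟩
  · rintro _ ⟨y, -, rfl⟩ _ ⟨z, -, rfl⟩ h
    exact congrArg (Arrow.mk μ ν) (act_injective μ h)
  · rintro _ ⟨y, -, rfl⟩ _ ⟨z, -, rfl⟩ h
    exact congrArg (Arrow.mk μ ν) (act_injective ν h)

/-- The reduction of `G(Λ)` to the boundary `a∂Λ` of `aΛ^*`. -/
noncomputable def boundaryGroupoid [IsCategoryOfPaths C] (a : C) :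
    ArrowGroupoid (boundary a)
      {γ : Arrow a // (groupoid a).rng γ ∈ boundary a ∧ (groupoid a).src γ ∈ boundary a} :=
  (groupoid a).reduction (boundary a)

theorem boundaryGroupoid_locallyInjective [IsCategoryOfPaths C] (a : C) :
    (boundaryGroupoid a).LocallyInjective :=
  (groupoid_locallyInjective a).reduction _

end PathCat

/-! ## The category of paths `Λ` of a sequence `(kᵢ)`

The vertices and the sequence are indexed from `0`.  The edges with range `v_i` and source `v_{i+1}`
are `α_i`, `β_i` and `γ_i^{(j)}` for `0 ≤ j < k_i`; the relations are `α_i β_{i+1} = β_i α_{i+1}`. -/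

/-- The normal forms of the elements of `Λ`, with the (determined) levels of the edges omitted:
`block m n` is `α^m β^n`, and `cons m n j t` is `α^m β^n γ^{(j)} t`. -/
inductive NormalForm : Type
  | block (m n : ℕ) : NormalForm
  | cons (m n j : ℕ) (t : NormalForm) : NormalForm

namespace NormalForm

/-- The number of edges. -/
def length : NormalForm → ℕ
  | block m n => m + n
  | cons m n _ t => m + n + 1 + t.length

/-- All the edges `γ_i^{(j)}` that occur, when the range is `v_i`, have `j < k_i`. -/
def Valid (k : ℕ → ℕ) : ℕ → NormalForm → Prop
  | _, block _ _ => True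
  | i, cons m n j t => j < k (i + (m + n)) ∧ t.Valid k (i + (m + n + 1))

/-- Concatenation: the last `Λ₁`-block of the first factor is multiplied with the first `Λ₁`-block
of the second one, `(α^m β^n)(α^p β^q) = α^{m+p} β^{n+q}`. -/
def mul : NormalForm → NormalForm → NormalForm
  | block m n, block p q => block (m + p) (n + q)
  | block m n, cons p q j t => cons (m + p) (n + q) j t
  | cons m n j t, w => cons m n j (t.mul w)

theorem length_mul (a b : NormalForm) : (a.mul b).length = a.length + b.length := by
  induction a with
  | block m n => cases b <;> simp only [mul, length] <;> omega
  | cons m n j t ih => simp only [mul, length, ih]; omega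

theorem valid_mul (k : ℕ → ℕ) (a b : NormalForm) (i : ℕ) :
    (a.mul b).Valid k i ↔ a.Valid k i ∧ b.Valid k (i + a.length) := by
  induction a generalizing i with
  | block m n =>
    cases b with
    | block p q => simp [mul, Valid]
    | cons p q j t =>
      have h1 : i + (m + p + (n + q)) = i + (m + n) + (p + q) := by omega
      have h2 : i + (m + p + (n + q) + 1) = i + (m + n) + (p + q + 1) := by omega
      simp only [mul, Valid, length, true_and, h1, h2]
  | cons m n j t ih =>
    simp only [mul, Valid, length, ih, and_assoc, Nat.add_assoc]

theorem one_mul (a : NormalForm) : (block 0 0).mul a = a := by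
  cases a <;> simp [mul]

theorem mul_one (a : NormalForm) : a.mul (block 0 0) = a := by
  induction a with
  | block m n => simp [mul]
  | cons m n j t ih => simp [mul, ih]

theorem mul_assoc (a b c : NormalForm) : (a.mul b).mul c = a.mul (b.mul c) := by
  induction a with
  | block m n => cases b <;> cases c <;> simp [mul, Nat.add_assoc]
  | cons m n j t ih => simp [mul, ih]

theorem left_cancel (a b c : NormalForm) (h : a.mul b = a.mul c) : b = c := by
  induction a with
  | block m n => cases b <;> cases c <;> simp_all [mul]
  | cons m n j t ih => simp only [mul, cons.injEq, true_and] at h; exact ih h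

theorem right_cancel (a b c : NormalForm) (h : a.mul c = b.mul c) : a = b := by
  induction a generalizing b with
  | block m n =>
    cases b with
    | block p q => cases c <;> simp_all [mul]
    | cons p q j t =>
      have h2 := congrArg length h
      cases c with
      | block _ _ => simp [mul] at h
      | cons p' q' j' t' =>
        simp only [mul, cons.injEq] at h
        have h3 := congrArg length h.2.2.2
        simp only [length_mul, length] at h3
        omega
  | cons m n j t ih =>
    cases b with
    | block p q =>
      cases c with
      | block _ _ => simp [mul] at h
      | cons p' q' j' t' =>
        simp only [mul, cons.injEq] at h
        have h3 := congrArg length h.2.2.2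
        simp only [length_mul, length] at h3
        omega
    | cons p q j' t' =>
      simp only [mul, cons.injEq] at h ⊢
      exact ⟨h.1, h.2.1, h.2.2.1, ih _ h.2.2.2⟩

theorem eq_one_of_length (a : NormalForm) (h : a.length = 0) : a = block 0 0 := by
  cases a with
  | block m n => simp only [length] at h; simp only [block.injEq]; omega
  | cons m n j t => simp only [length] at h; omega

end NormalForm

/-- The vertices `v_0, v_1, ...` of `Λ`. -/
@[ext]
structure Vertex (k : ℕ → ℕ) where
  level : ℕ

/-- The category of paths `Λ` of the sequence `k`: the amalgamation, over the common vertices, of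
the 2-graph `Λ₁` (with edges `α_i`, `β_i`, and elements `α^m β^n`) and the 1-graph `Λ₂` (with edges
`γ_i^{(j)}`).  The morphisms `a ⟶ b` are the elements with range `a` and source `b`. -/
instance (k : ℕ → ℕ) : Category (Vertex k) where
  Hom a b := {w : NormalForm // w.Valid k a.level ∧ a.level + w.length = b.level}
  id a := ⟨NormalForm.block 0 0, trivial, rfl⟩
  comp {a b c} f g := ⟨f.1.mul g.1,
    (NormalForm.valid_mul k f.1 g.1 a.level).2 ⟨f.2.1, by rw [f.2.2]; exact g.2.1⟩,
    by rw [NormalForm.length_mul, ← Nat.add_assoc, f.2.2, g.2.2]⟩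
  id_comp f := Subtype.ext (NormalForm.one_mul f.1)
  comp_id f := Subtype.ext (NormalForm.mul_one f.1)
  assoc f g h := Subtype.ext (NormalForm.mul_assoc f.1 g.1 h.1)

namespace Vertex

variable {k : ℕ → ℕ}

/-- The normal form of an element of `Λ`. -/
def nf {a b : Vertex k} (f : a ⟶ b) : NormalForm := f.1

theorem nf_comp {a b c : Vertex k} (f : a ⟶ b) (g : b ⟶ c) : nf (f ≫ g) = (nf f).mul (nf g) := rfl

theorem hom_ext {a b : Vertex k} {f g : a ⟶ b} (h : nf f = nf g) : f = g := Subtype.ext h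

theorem nf_valid {a b : Vertex k} (f : a ⟶ b) : (nf f).Valid k a.level := f.2.1

theorem level_add {a b : Vertex k} (f : a ⟶ b) : a.level + (nf f).length = b.level := f.2.2

instance : IsCategoryOfPaths (Vertex k) where
  left_cancel f g h e := hom_ext (NormalForm.left_cancel _ _ _ (congrArg nf e))
  right_cancel f g h e := hom_ext (NormalForm.right_cancel _ _ _ (congrArg nf e))
  no_inverse := by
    intro a b f hf
    have h1 := level_add f
    have h2 := level_add (CategoryTheory.inv f)
    have hab : a = b := Vertex.ext (by omega)
    subst hab
    refine ⟨rfl, hom_ext ?_⟩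
    rw [NormalForm.eq_one_of_length (nf f) (by omega)]
    rfl

/-- The element `α^m β^n` with range `a`. -/
def alphaBeta (a : Vertex k) (m n : ℕ) : a ⟶ (⟨a.level + (m + n)⟩ : Vertex k) :=
  ⟨NormalForm.block m n, trivial, rfl⟩

/-- The directed hereditary set `α^∞ β^∞` with range `a`: all elements `α^m β^n` with range `a`. -/
def alphaBetaInfty (a : Vertex k) : PathCat.DirHered a where
  carrier := {μ | ∃ m n : ℕ, μ = ⟨_, alphaBeta a m n⟩}
  nonempty := ⟨_, 0, 0, rfl⟩
  directed := by
    rintro _ ⟨m, n, rfl⟩ _ ⟨p, q, rfl⟩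
    refine ⟨_, ⟨m + p, n + q, rfl⟩, ⟨⟨NormalForm.block p q, trivial, ?_⟩, hom_ext rfl⟩,
      ⟨⟨NormalForm.block m n, trivial, ?_⟩, hom_ext ?_⟩⟩
    · simp only [NormalForm.length]; omega
    · simp only [NormalForm.length]; omega
    · simp only [nf, alphaBeta, CategoryStruct.comp, NormalForm.mul, Nat.add_comm]
  hereditary := by
    rintro _ ⟨m, n, rfl⟩ ⟨⟨b⟩, ν⟩ ⟨ζ, hζ⟩
    have h := congrArg nf hζ
    have hl := level_add ν
    rw [nf_comp] at h
    rcases hν : nf ν with ⟨p, q⟩ | ⟨p, q, j, t⟩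
    · rw [hν] at hl
      simp only [NormalForm.length] at hl
      subst hl
      exact ⟨p, q, Sigma.ext rfl (heq_of_eq (hom_ext hν))⟩
    · rw [hν] at h
      simp [NormalForm.mul, nf, alphaBeta] at h

end Vertex

/-- The first vertex of `Λ`. -/
abbrev baseVertex (k : ℕ → ℕ) : Vertex k := ⟨0⟩

/-- The groupoid `G`: the reduction of `G(Λ)` to the boundary `X = v∂Λ`, where `v` is the first
vertex. -/
noncomputable abbrev groupoidG (k : ℕ → ℕ) := PathCat.boundaryGroupoid (baseVertex k)

/-- The C*-algebra `C^*(G)`. -/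
noncomputable abbrev cstarG (k : ℕ → ℕ) :=
  ArrowGroupoid.fullCStar (PathCat.boundaryGroupoid_locallyInjective (baseVertex k))

/-! The groupoid `G` is ample over the compact space `X`. The main tool is the continuous cocycle
`c` to the integers that sends `[μ, ν, x]` to the number of edges `α` in `μ` minus the number in
`ν`.

Degrees. Count the edges `α` in one coordinate and the edges `β` and `γ` together in the other. An
element need not have a prefix of every smaller degree, but two prefixes of one element have a join,
whose degree is the coordinatewise maximum (`NormalForm.exists_join`); so a prefix is determined by
its degree. Consequently `Λ^*` has compact pieces `aΛ^*`, an arrow is determined by its range, its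
source and its value under `c` (hence `G` is Hausdorff), and the arrows `[μ, ν, x]` with `μ`, `ν` of
degrees with equal `α`-count inside a box form compact open subgroupoids that exhaust the kernel of
`c`.

Boundary and orbits. The boundary consists of the infinite directed hereditary sets: a finite one
has a greatest element `μ` and is properly contained in `μα^∞β^∞`, while edges `γ` at arbitrarily
high levels put a cylinder into every neighbourhood of an infinite set. Exchanging initial segments
of equal length moves any point into any cylinder, which is minimality.

Isotropy. If `μx = νx` and the numbers of edges `α` differ, cancellation leads to `α^d w = s w`,
where `s` consists of `d` edges `β` and `γ`. Then `s = β^d`, and `w` satisfies an equation of the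
same kind; by induction `α^d w` contains every `α^m β^n`, so it is `α^∞β^∞`. Conversely `[μα, μβ,
α^∞β^∞]` is a nontrivial isotropy arrow. The points `lβ^∞` have boundedly many edges `α`, so their
isotropy is trivial, and they are dense.

Simplicity. If a closed ideal contains the indicator function of a nonempty compact open set of
units, minimality and compactness spread it to the identity. Otherwise topological freeness bounds
the values of a function at units by its norm modulo the ideal (`norm_apply_one_le`), and the ideal
vanishes in every twist by `z^c` of the regular representation (`evTwist_regRep_eq_zero`). Such an
ideal is zero: averaging over the circle is faithful and lands in the kernel of `c`
(`eq_zero_of_evTwist_regRep`), where compact subgroupoids make the regular representation dominate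
all others (`IsAmple.norm_map_le_regRep`). -/

open scoped CompactlySupported

/-! ## The Schur test -/

namespace SchurTest

variable {ι : Type v}

/-- The Hilbert space of square summable functions. -/
abbrev L2 (ι : Type v) : Type v := lp (fun _ : ι => ℂ) 2

/-- Hölder's inequality for `a^(1/2)` and `a^(1/2) b` with respect to counting measure. The weight
`a` will be a row of a kernel. -/
theorem ennreal_cauchy_schwarz (a b : ι → ℝ≥0∞) :
    (∑' j, a j * b j) ^ 2 ≤ (∑' j, a j) * ∑' j, a j * b j ^ 2 := by
  let _ : MeasurableSpace ι := ⊤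
  have hpq : Real.HolderConjugate 2 2 := by rw [Real.holderConjugate_iff]; norm_num
  have h := ENNReal.lintegral_mul_le_Lp_mul_Lq (MeasureTheory.Measure.count (α := ι)) hpq
    (f := fun j => a j ^ (1 / 2 : ℝ)) (g := fun j => a j ^ (1 / 2 : ℝ) * b j)
    (Measurable.aemeasurable (fun _ _ => trivial)) (Measurable.aemeasurable (fun _ _ => trivial))
  have e : ∀ x : ℝ≥0∞, x ^ (1 / 2 : ℝ) * x ^ (1 / 2 : ℝ) = x := by
    intro x
    rw [← ENNReal.rpow_add_of_nonneg _ _ (by norm_num) (by norm_num)]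
    norm_num
  have e2 : ∀ x : ℝ≥0∞, (x ^ (1 / 2 : ℝ)) ^ 2 = x := fun x => by rw [sq, e]
  simp only [MeasureTheory.lintegral_count, Pi.mul_apply, ← mul_assoc, e, ENNReal.rpow_two,
    mul_pow, e2] at h
  calc _ ≤ _ := pow_le_pow_left' h 2
    _ = _ := by rw [mul_pow, e2, e2]

theorem enorm_sq (ξ : L2 ι) : ‖ξ‖ₑ ^ 2 = ∑' i, ‖ξ i‖ₑ ^ 2 := by
  have h := lp.hasSum_norm (p := 2) (by norm_num) ξ
  simp only [ENNReal.toReal_ofNat, Real.rpow_two] at h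
  have h2 : ∀ x : ℂ, ‖x‖ₑ ^ 2 = ENNReal.ofReal (‖x‖ ^ 2) := fun x => by
    rw [← ofReal_norm, ENNReal.ofReal_pow (norm_nonneg _)]
  rw [← ofReal_norm, ← ENNReal.ofReal_pow (norm_nonneg _), ← h.tsum_eq,
    ENNReal.ofReal_tsum_of_nonneg (fun _ => by positivity) h.summable]
  simp only [h2]

theorem memℓp_two {f : ι → ℂ} (h : ∑' i, ‖f i‖ₑ ^ 2 ≠ ∞) : Memℓp f 2 := by
  refine memℓp_gen ?_
  have := ENNReal.summable_toReal h
  simpa using this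

/-- The operator given by a kernel that has finite rows and satisfies the hypotheses of the Schur
test. -/
structure Kernel (ι : Type v) where
  ker : ι → ι → ℂ
  bound : ℝ≥0∞
  bound_lt : bound < ∞
  finite_row : ∀ i, {j | ker i j ≠ 0}.Finite
  row : ∀ i, ∑' j, ‖ker i j‖ₑ ≤ bound
  col : ∀ j, ∑' i, ‖ker i j‖ₑ ≤ bound

namespace Kernel

theorem summable_row (K : Kernel ι) (ξ : ι → ℂ) (i : ι) : Summable fun j => K.ker i j * ξ j :=
  summable_of_hasFiniteSupport ((K.finite_row i).subset fun j hj => by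
    intro h0; apply hj; simp [h0])

/-- Cauchy–Schwarz with the weight `|K(i, j)|` costs one row bound; after the sums are interchanged,
the column bound gives the second factor. -/
theorem tsum_sq_le (K : Kernel ι) (ξ : L2 ι) :
    ∑' i, ‖∑' j, K.ker i j * ξ j‖ₑ ^ 2 ≤ (K.bound * ‖ξ‖ₑ) ^ 2 := by
  have h1 : ∀ i, ‖∑' j, K.ker i j * ξ j‖ₑ ^ 2 ≤ K.bound * ∑' j, ‖K.ker i j‖ₑ * ‖ξ j‖ₑ ^ 2 := by
    intro i
    calc _ ≤ (∑' j, ‖K.ker i j‖ₑ * ‖ξ j‖ₑ) ^ 2 := by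
          gcongr
          refine (enorm_tsum_le_tsum_enorm).trans (le_of_eq ?_)
          simp [enorm_mul]
      _ ≤ _ := ennreal_cauchy_schwarz _ _
      _ ≤ _ := by gcongr; exact K.row i
  calc _ ≤ ∑' i, K.bound * ∑' j, ‖K.ker i j‖ₑ * ‖ξ j‖ₑ ^ 2 := ENNReal.tsum_le_tsum h1
    _ = K.bound * ∑' j, (∑' i, ‖K.ker i j‖ₑ) * ‖ξ j‖ₑ ^ 2 := by
      rw [ENNReal.tsum_mul_left, ENNReal.tsum_comm]
      simp only [ENNReal.tsum_mul_right]
    _ ≤ K.bound * ∑' j, K.bound * ‖ξ j‖ₑ ^ 2 := by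
      gcongr with j
      exact K.col j
    _ = _ := by rw [ENNReal.tsum_mul_left, ← enorm_sq]; ring

/-- The operator of a kernel. -/
noncomputable def op (K : Kernel ι) : L2 ι →L[ℂ] L2 ι :=
  LinearMap.mkContinuous
    { toFun := fun ξ => ⟨fun i => ∑' j, K.ker i j * ξ j,
        memℓp_two ((K.tsum_sq_le ξ).trans_lt
          (ENNReal.pow_lt_top (ENNReal.mul_lt_top K.bound_lt enorm_lt_top))).ne⟩
      map_add' := by
        intro ξ η
        ext i
        change ∑' j, K.ker i j * (ξ j + η j) = ∑' j, K.ker i j * ξ j + ∑' j, K.ker i j * η j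
        rw [← (K.summable_row ξ i).tsum_add (K.summable_row η i)]
        simp only [mul_add]
      map_smul' := by
        intro c ξ
        ext i
        change ∑' j, K.ker i j * (c * ξ j) = c * ∑' j, K.ker i j * ξ j
        rw [← tsum_mul_left]
        congr 1; ext j; ring }
    K.bound.toReal (by
      intro ξ
      have h := K.tsum_sq_le ξ
      rw [← enorm_sq ⟨fun i => ∑' j, K.ker i j * ξ j, _⟩] at h
      have h2 := (ENNReal.pow_le_pow_left_iff two_ne_zero).1 h
      have h3 := ENNReal.toReal_mono (ENNReal.mul_lt_top K.bound_lt enorm_lt_top).ne h2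
      rw [ENNReal.toReal_mul, toReal_enorm, toReal_enorm] at h3
      exact h3)

theorem op_apply (K : Kernel ι) (ξ : L2 ι) (i : ι) : K.op ξ i = ∑' j, K.ker i j * ξ j := rfl

theorem enorm_op_le (K : Kernel ι) : ‖K.op‖ₑ ≤ K.bound := by
  have h : ‖K.op‖ ≤ K.bound.toReal := LinearMap.mkContinuous_norm_le _ ENNReal.toReal_nonneg _
  rw [← ofReal_norm]
  exact ENNReal.ofReal_le_of_le_toReal h

open Classical in
theorem op_single (K : Kernel ι) (j : ι) (i : ι) : K.op (lp.single 2 j 1) i = K.ker i j := by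
  rw [op_apply, tsum_eq_single j]
  · simp
  · intro b hb; simp [Pi.single_eq_of_ne hb]

open Classical in
theorem ext_single {S T : L2 ι →L[ℂ] L2 ι}
    (h : ∀ i j, S (lp.single 2 j 1) i = T (lp.single 2 j 1) i) : S = T := by
  refine lp.ext_continuousLinearMap (by norm_num) fun j => ?_
  ext i
  exact h i j

end Kernel
end SchurTest

namespace SchurTest.Kernel

variable {ι : Type v}

theorem op_eq_mul {K K₁ K₂ : Kernel ι}
    (h : ∀ i j, K.ker i j = ∑' l, K₁.ker i l * K₂.ker l j) : K.op = K₁.op * K₂.op := by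
  classical
  refine ext_single fun i j => ?_
  rw [op_single, h]
  change _ = K₁.op (K₂.op _) i
  rw [op_apply]
  simp only [op_single]

theorem op_eq_star {K K' : Kernel ι} (h : ∀ i j, K'.ker i j = star (K.ker j i)) :
    K'.op = star K.op := by
  classical
  refine ext_single fun i j => ?_
  rw [op_single, h, ContinuousLinearMap.star_eq_adjoint]
  have h1 := lp.inner_single_left (𝕜 := ℂ) i (1 : ℂ)
    (ContinuousLinearMap.adjoint K.op (lp.single 2 j (1 : ℂ)) : L2 ι)
  rw [ContinuousLinearMap.adjoint_inner_right, lp.inner_single_right, op_single] at h1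
  simpa using h1

end SchurTest.Kernel

namespace ArrowGroupoid

variable {X : Type u} {G : Type v} (Γ : ArrowGroupoid X G)

/-! ## Cancellation -/

theorem mul_congr {a a' b b' : G} (ha : a = a') (hb : b = b') (h : Γ.src a = Γ.rng b)
    (h' : Γ.src a' = Γ.rng b') : Γ.mul a b h = Γ.mul a' b' h' := by
  subst ha hb; rfl

/-- `η⁻¹γ`. -/
def ldiv (η γ : G) (h : Γ.rng η = Γ.rng γ) : G := Γ.mul (Γ.inv η) γ ((Γ.src_inv η).trans h)

/-- `γζ⁻¹`. -/
def rdiv (γ ζ : G) (h : Γ.src γ = Γ.src ζ) : G := Γ.mul γ (Γ.inv ζ) (h.trans (Γ.rng_inv ζ).symm)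

theorem rng_ldiv (η γ : G) (h) : Γ.rng (Γ.ldiv η γ h) = Γ.src η := by
  rw [ldiv, rng_mul, rng_inv]

theorem src_ldiv (η γ : G) (h) : Γ.src (Γ.ldiv η γ h) = Γ.src γ := by
  rw [ldiv, src_mul]

theorem rng_rdiv (γ ζ : G) (h) : Γ.rng (Γ.rdiv γ ζ h) = Γ.rng γ := by
  rw [rdiv, rng_mul]

theorem src_rdiv (γ ζ : G) (h) : Γ.src (Γ.rdiv γ ζ h) = Γ.rng ζ := by
  rw [rdiv, src_mul, src_inv]

theorem one_mul' {x : X} {a : G} (h : x = Γ.rng a) (h') : Γ.mul (Γ.one x) a h' = a := by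
  subst h; exact Γ.one_mul a

theorem mul_one' {x : X} {a : G} (h : x = Γ.src a) (h') : Γ.mul a (Γ.one x) h' = a := by
  subst h; exact Γ.mul_one a

theorem mul_ldiv (η γ : G) (h) : Γ.mul η (Γ.ldiv η γ h) (Γ.rng_ldiv η γ h).symm = γ := by
  have h1 := Γ.mul_assoc η (Γ.inv η) γ (Γ.rng_inv η).symm ((Γ.src_inv η).trans h)
  have h2 := Γ.mul_congr (Γ.mul_inv η) (rfl : γ = γ) ((Γ.src_mul _ _ _).trans
    ((Γ.src_inv η).trans h)) ((Γ.src_one _).trans h)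
  exact h1.symm.trans (h2.trans (Γ.one_mul' h _))

theorem ldiv_mul (η ζ : G) (h : Γ.src η = Γ.rng ζ) :
    Γ.ldiv η (Γ.mul η ζ h) (Γ.rng_mul _ _ _).symm = ζ := by
  have h1 := Γ.mul_assoc (Γ.inv η) η ζ (Γ.src_inv η) h
  have h2 := Γ.mul_congr (Γ.inv_mul η) (rfl : ζ = ζ) ((Γ.src_mul _ _ _).trans h)
    ((Γ.src_one _).trans h)
  exact h1.symm.trans (h2.trans (Γ.one_mul' h _))

theorem rdiv_mul (γ ζ : G) (h) : Γ.mul (Γ.rdiv γ ζ h) ζ (Γ.src_rdiv γ ζ h) = γ := by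
  have h1 := Γ.mul_assoc γ (Γ.inv ζ) ζ (h.trans (Γ.rng_inv ζ).symm) (Γ.src_inv ζ)
  have h2 := Γ.mul_congr (rfl : γ = γ) (Γ.inv_mul ζ) ((h.trans (Γ.rng_inv ζ).symm).trans
    (Γ.rng_mul _ _ (Γ.src_inv ζ)).symm) (h.trans (Γ.rng_one _).symm)
  exact h1.trans (h2.trans (Γ.mul_one' h.symm _))

theorem mul_rdiv (η ζ : G) (h : Γ.src η = Γ.rng ζ) :
    Γ.rdiv (Γ.mul η ζ h) ζ (Γ.src_mul _ _ _) = η := by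
  have h1 := Γ.mul_assoc η ζ (Γ.inv ζ) h (Γ.rng_inv ζ).symm
  have h2 := Γ.mul_congr (rfl : η = η) (Γ.mul_inv ζ) (h.trans
    (Γ.rng_mul _ _ (Γ.rng_inv ζ).symm).symm) (h.trans (Γ.rng_one _).symm)
  exact h1.trans (h2.trans (Γ.mul_one' h.symm _))

theorem mul_left_cancel {a b c : G} (h : Γ.src a = Γ.rng b) (h' : Γ.src a = Γ.rng c)
    (e : Γ.mul a b h = Γ.mul a c h') : b = c := by
  rw [← Γ.ldiv_mul a b h, ← Γ.ldiv_mul a c h']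
  exact Γ.mul_congr rfl e _ _

theorem mul_right_cancel {a b c : G} (h : Γ.src a = Γ.rng c) (h' : Γ.src b = Γ.rng c)
    (e : Γ.mul a c h = Γ.mul b c h') : a = b := by
  rw [← Γ.mul_rdiv a c h, ← Γ.mul_rdiv b c h']
  exact Γ.mul_congr e rfl _ _

theorem rdiv_ldiv (η γ : G) (h) : Γ.rdiv γ (Γ.ldiv η γ h) (Γ.src_ldiv η γ h).symm = η :=
  Γ.mul_right_cancel (Γ.src_rdiv _ _ _) (Γ.rng_ldiv η γ h).symm
    ((Γ.rdiv_mul _ _ _).trans (Γ.mul_ldiv _ _ _).symm)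

theorem ldiv_rdiv (γ ζ : G) (h) : Γ.ldiv (Γ.rdiv γ ζ h) γ (Γ.rng_rdiv γ ζ h) = ζ :=
  Γ.mul_left_cancel (Γ.rng_ldiv _ _ _).symm (Γ.src_rdiv γ ζ h)
    ((Γ.mul_ldiv _ _ _).trans (Γ.rdiv_mul _ _ _).symm)

theorem inv_eq_of_mul_eq_one {a b : G} (h : Γ.src a = Γ.rng b)
    (e : Γ.mul a b h = Γ.one (Γ.rng a)) : b = Γ.inv a :=
  Γ.mul_left_cancel h (Γ.rng_inv a).symm (e.trans (Γ.mul_inv a).symm)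

theorem inv_inv (a : G) : Γ.inv (Γ.inv a) = a :=
  (Γ.inv_eq_of_mul_eq_one (Γ.src_inv a) ((Γ.inv_mul a).trans (by rw [Γ.rng_inv]))).symm

theorem inv_rdiv (γ ζ : G) (h) : Γ.inv (Γ.rdiv γ ζ h) = Γ.rdiv ζ γ h.symm := by
  symm
  refine Γ.inv_eq_of_mul_eq_one ((Γ.src_rdiv _ _ _).trans (Γ.rng_rdiv _ _ _).symm) ?_
  have h1 := Γ.mul_assoc (Γ.rdiv γ ζ h) ζ (Γ.inv γ) (Γ.src_rdiv _ _ _)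
    (h.symm.trans (Γ.rng_inv γ).symm)
  refine h1.symm.trans ((Γ.mul_congr (Γ.rdiv_mul γ ζ h) rfl _ (Γ.rng_inv γ).symm).trans ?_)
  rw [Γ.mul_inv, Γ.rng_rdiv]

theorem inv_one (x : X) : Γ.inv (Γ.one x) = Γ.one x := by
  symm
  refine Γ.inv_eq_of_mul_eq_one ((Γ.src_one x).trans (Γ.rng_one x).symm) ?_
  rw [Γ.one_mul' (Γ.rng_one x).symm, Γ.rng_one]

theorem rdiv_one (γ : G) (x : X) (h) : Γ.rdiv γ (Γ.one x) h = γ := by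
  have h0 : Γ.src γ = x := h.trans (Γ.src_one x)
  exact (Γ.mul_congr rfl (Γ.inv_one x) _ (h.trans ((Γ.src_one x).trans (Γ.rng_one x).symm))).trans
    (Γ.mul_one' h0.symm _)

theorem ldiv_rdiv_assoc (η γ ζ : G) (h : Γ.rng η = Γ.rng γ) (h' : Γ.src γ = Γ.src ζ) :
    Γ.ldiv η (Γ.rdiv γ ζ h') (h.trans (Γ.rng_rdiv γ ζ h').symm) =
      Γ.rdiv (Γ.ldiv η γ h) ζ ((Γ.src_ldiv η γ h).trans h') :=
  (Γ.mul_assoc (Γ.inv η) γ (Γ.inv ζ) ((Γ.src_inv η).trans h)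
    (h'.trans (Γ.rng_inv ζ).symm)).symm

/-- `η ↦ η⁻¹γ`. -/
def ldivEquiv (γ : G) : {η : G // Γ.rng η = Γ.rng γ} ≃ {ζ : G // Γ.src ζ = Γ.src γ} where
  toFun η := ⟨Γ.ldiv η.1 γ η.2, Γ.src_ldiv _ _ _⟩
  invFun ζ := ⟨Γ.rdiv γ ζ.1 ζ.2.symm, Γ.rng_rdiv _ _ _⟩
  left_inv η := Subtype.ext (Γ.rdiv_ldiv η.1 γ η.2)
  right_inv ζ := Subtype.ext (Γ.ldiv_rdiv γ ζ.1 ζ.2.symm)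

/-- `γ ↦ γζ⁻¹`. -/
def rdivEquiv (ζ : G) : {γ : G // Γ.src γ = Γ.src ζ} ≃ {η : G // Γ.src η = Γ.rng ζ} where
  toFun γ := ⟨Γ.rdiv γ.1 ζ γ.2, Γ.src_rdiv _ _ _⟩
  invFun η := ⟨Γ.mul η.1 ζ η.2, Γ.src_mul _ _ _⟩
  left_inv γ := Subtype.ext (Γ.rdiv_mul γ.1 ζ γ.2)
  right_inv η := Subtype.ext (Γ.mul_rdiv η.1 ζ η.2)

theorem conv_eq (f g : G → ℂ) (γ : G) :
    Γ.conv f g γ = ∑ᶠ η : {η : G // Γ.rng η = Γ.rng γ}, f η.1 * g (Γ.ldiv η.1 γ η.2) := rfl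

/-! ## The regular representation -/

open Classical in
/-- The matrix of the operator of convolution by `f`. -/
noncomputable def regKer (f : G → ℂ) (γ ζ : G) : ℂ :=
  if h : Γ.src γ = Γ.src ζ then f (Γ.rdiv γ ζ h) else 0

theorem regKer_of_eq (f : G → ℂ) {γ ζ : G} (h : Γ.src γ = Γ.src ζ) :
    Γ.regKer f γ ζ = f (Γ.rdiv γ ζ h) := dif_pos h

/-- The map `ζ ↦ γζ⁻¹` is a bijection from the arrows with source `s(γ)` to those with range `r(γ)`.
With its analogue for columns, this makes the `I`-norm a bound for the Schur test. -/
theorem tsum_regKer_row (f : G → ℂ) (γ : G) :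
    ∑' ζ, ‖Γ.regKer f γ ζ‖ₑ = ∑' η : {η : G // Γ.rng η = Γ.rng γ}, ‖f η.1‖ₑ := by
  rw [← (Γ.ldivEquiv γ).symm.tsum_eq]
  have h1 : Function.support (fun ζ => ‖Γ.regKer f γ ζ‖ₑ) ⊆ {ζ | Γ.src ζ = Γ.src γ} := by
    intro ζ hζ
    by_contra hne
    apply hζ
    simp [regKer, dif_neg (fun h => hne (Eq.symm h) : ¬ Γ.src γ = Γ.src ζ)]
  rw [← tsum_subtype_eq_of_support_subset h1]
  refine tsum_congr fun ζ => ?_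
  simp only [regKer]
  rw [dif_pos ζ.2.symm]
  rfl

theorem tsum_regKer_col (f : G → ℂ) (ζ : G) :
    ∑' γ, ‖Γ.regKer f γ ζ‖ₑ = ∑' η : {η : G // Γ.src η = Γ.rng ζ}, ‖f η.1‖ₑ := by
  rw [← (Γ.rdivEquiv ζ).tsum_eq]
  have h1 : Function.support (fun γ => ‖Γ.regKer f γ ζ‖ₑ) ⊆ {γ | Γ.src γ = Γ.src ζ} := by
    intro γ hγ
    by_contra hne
    apply hγ
    simp [regKer, dif_neg (show ¬ Γ.src γ = Γ.src ζ from hne)]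
  rw [← tsum_subtype_eq_of_support_subset h1]
  refine tsum_congr fun γ => ?_
  simp only [regKer]
  rw [dif_pos (show Γ.src γ.1 = Γ.src ζ from γ.2)]
  rfl

theorem regKer_invol (f : G → ℂ) (γ ζ : G) :
    Γ.regKer (Γ.invol f) γ ζ = star (Γ.regKer f ζ γ) := by
  simp only [regKer]
  by_cases h : Γ.src γ = Γ.src ζ
  · rw [dif_pos h, dif_pos h.symm, invol, inv_rdiv]
  · rw [dif_neg h, dif_neg (Ne.symm h), star_zero]

/-- The substitution `ξ = η⁻¹γ` turns `f(γξ⁻¹) g(ξζ⁻¹)` into `f(η) g(η⁻¹γζ⁻¹)`, a term of the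
convolution at `γζ⁻¹`. The finiteness hypothesis identifies the infinite sum with the finite one. -/
theorem regKer_conv (f g : G → ℂ)
    (hf : ∀ x, {η : {η : G // Γ.rng η = x} | f η.1 ≠ 0}.Finite) (γ ζ : G) :
    Γ.regKer (Γ.conv f g) γ ζ = ∑' ξ, Γ.regKer f γ ξ * Γ.regKer g ξ ζ := by
  have h1 : Function.support (fun ξ => Γ.regKer f γ ξ * Γ.regKer g ξ ζ) ⊆
      {ξ | Γ.src ξ = Γ.src γ} := by
    intro ξ hξ
    by_contra hne
    apply hξ
    simp [regKer, dif_neg (fun h => hne (Eq.symm h) : ¬ Γ.src γ = Γ.src ξ)]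
  by_cases h : Γ.src γ = Γ.src ζ
  · rw [← tsum_subtype_eq_of_support_subset h1]
    refine Eq.trans ?_ ((Γ.ldivEquiv γ).tsum_eq
      (fun ξ => Γ.regKer f γ ξ.1 * Γ.regKer g ξ.1 ζ))
    rw [Γ.regKer_of_eq _ h, conv_eq]
    have h2 : ∀ η : {η : G // Γ.rng η = Γ.rng γ}, ((Γ.ldivEquiv γ η : {ζ : G // Γ.src ζ = Γ.src γ}) : G)
        = Γ.ldiv η.1 γ η.2 := fun _ => rfl
    rw [tsum_eq_finsum]
    -- The ranges of `γζ⁻¹` and `γ` are only propositionally equal, so the index type of the sum is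
    -- changed through a variable `x`.
    · have key : ∀ (x : X) (hx : Γ.rng γ = x) ,
        ∑ᶠ η : {η : G // Γ.rng η = Γ.rng γ}, f η.1 * g (Γ.rdiv (Γ.ldiv η.1 γ η.2) ζ ((Γ.src_ldiv _ _ _).trans h)) =
        ∑ᶠ η : {η : G // Γ.rng η = x}, f η.1 * g (Γ.rdiv (Γ.ldiv η.1 γ (η.2.trans hx.symm)) ζ ((Γ.src_ldiv _ _ _).trans h)) := by
        intro x hx; subst hx; rfl
      refine Eq.trans ?_ ((key _ (Γ.rng_rdiv γ ζ h).symm).symm.trans ?_)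
      · refine finsum_congr fun η => ?_
        rw [ldiv_rdiv_assoc]
      · refine finsum_congr fun η => ?_
        rw [h2, Γ.regKer_of_eq f (Γ.src_ldiv _ _ η.2).symm,
          Γ.regKer_of_eq g ((Γ.src_ldiv _ _ η.2).trans h), rdiv_ldiv]
    · refine (hf (Γ.rng γ)).subset fun η hη h0 => hη ?_
      simp only
      rw [h2, Γ.regKer_of_eq f (Γ.src_ldiv _ _ η.2).symm, rdiv_ldiv, h0, zero_mul]
  · rw [regKer, dif_neg h]
    symm
    convert tsum_zero with ξ
    by_cases h3 : Γ.src γ = Γ.src ξ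
    · rw [regKer, regKer, dif_neg (fun h4 => h (h3.trans h4)), mul_zero]
    · rw [regKer, dif_neg h3, zero_mul]

variable {Γ}

/-- Finitely many open sets on which `p` is injective cover the support, and each of them meets a
fibre at most once. -/
theorem finite_fibre (p : G → X) [TopologicalSpace G]
    (hp : ∀ γ : G, ∃ U : Set G, IsOpen U ∧ γ ∈ U ∧ Set.InjOn p U)
    (f : CompactlySupportedContinuousMap G ℂ) (x : X) :
    {η : {η : G // p η = x} | f η.1 ≠ 0}.Finite := by
  classical
  choose U hU hmem hr using hp
  obtain ⟨t, ht⟩ := f.hasCompactSupport.isCompact.elim_finite_subcover U hU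
    (fun γ _ => Set.mem_iUnion.2 ⟨γ, hmem γ⟩)
  have : {η : {η : G // p η = x} | f η.1 ≠ 0} ⊆
      ⋃ i ∈ t, {η : {η : G // p η = x} | η.1 ∈ U i} := by
    intro η hη
    have := ht (subset_tsupport _ hη)
    simpa using this
  refine (Set.Finite.biUnion t.finite_toSet fun i _ => ?_).subset this
  refine Set.Subsingleton.finite fun a ha b hb => ?_
  exact Subtype.ext (hr i ha hb (a.2.trans b.2.symm))

theorem LocallyInjective.finite_rng [TopologicalSpace G] (h : Γ.LocallyInjective)
    (f : CompactlySupportedContinuousMap G ℂ) (x : X) :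
    {η : {η : G // Γ.rng η = x} | f η.1 ≠ 0}.Finite :=
  finite_fibre Γ.rng (fun γ => by obtain ⟨U, h1, h2, h3, _⟩ := h γ; exact ⟨U, h1, h2, h3⟩) f x

/-- Convolution by `f` as a kernel on the set of arrows. -/
noncomputable def regKernel [TopologicalSpace G] (h : Γ.LocallyInjective)
    (f : CompactlySupportedContinuousMap G ℂ) : SchurTest.Kernel G where
  ker := Γ.regKer f
  bound := Γ.iNorm f
  bound_lt := iNorm_lt_top h f
  finite_row γ := by
    have h1 := ((h.finite_rng f (Γ.rng γ)).image (Γ.ldivEquiv γ)).image Subtype.val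
    refine h1.subset fun ζ hζ => ?_
    have h2 : Γ.src γ = Γ.src ζ := by
      by_contra hne
      exact hζ (by simp [regKer, dif_neg hne])
    refine ⟨⟨ζ, h2.symm⟩, ⟨(Γ.ldivEquiv γ).symm ⟨ζ, h2.symm⟩, ?_, by simp⟩, rfl⟩
    intro h0
    apply hζ
    rw [regKer, dif_pos h2]
    exact h0
  row γ := by
    rw [Γ.tsum_regKer_row]
    exact (le_iSup (fun x => ∑' γ : {γ : G // Γ.rng γ = x}, ‖f γ.1‖ₑ) (Γ.rng γ)).trans
      (le_max_right _ _)
  col ζ := by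
    rw [Γ.tsum_regKer_col]
    exact (le_iSup (fun x => ∑' γ : {γ : G // Γ.src γ = x}, ‖f γ.1‖ₑ) (Γ.rng ζ)).trans
      (le_max_left _ _)

/-- The left regular representation on `ℓ²(G)`. -/
noncomputable def regRep [TopologicalSpace G] (h : Γ.LocallyInjective) : Γ.Rep where
  H := SchurTest.L2 G
  map :=
    { toFun := fun f => (regKernel h f).op
      map_add' := by
        classical
        intro f g
        refine SchurTest.Kernel.ext_single fun γ ζ => ?_
        have e := (regKernel h (f + g)).op_single ζ γ
        refine e.trans ?_
        change _ = (regKernel h f).op _ γ + (regKernel h g).op _ γ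
        rw [SchurTest.Kernel.op_single, SchurTest.Kernel.op_single]
        simp only [regKernel, regKer]
        split_ifs <;> simp
      map_smul' := by
        classical
        intro c f
        refine SchurTest.Kernel.ext_single fun γ ζ => ?_
        have e := (regKernel h (c • f)).op_single ζ γ
        refine e.trans ?_
        change _ = c * (regKernel h f).op _ γ
        rw [SchurTest.Kernel.op_single]
        simp only [regKernel, regKer]
        split_ifs <;> simp }
  map_conv f g k hk := SchurTest.Kernel.op_eq_mul fun γ ζ => by
    change Γ.regKer k γ ζ = _
    rw [hk, Γ.regKer_conv _ _ (h.finite_rng f)]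
    rfl
  map_invol f k hk := SchurTest.Kernel.op_eq_star fun γ ζ => by
    change Γ.regKer k γ ζ = _
    rw [hk, Γ.regKer_invol]
    rfl
  bounded f := (regKernel h f).enorm_op_le

open Classical in
/-- The basis vector of `ℓ²(G)` at `γ`. -/
noncomputable def basisVec [TopologicalSpace G] (h : Γ.LocallyInjective) (γ : G) : (regRep h).H :=
  (lp.single 2 γ 1 : SchurTest.L2 G)

/-- The coordinates of a vector of `ℓ²(G)`. -/
noncomputable def coord [TopologicalSpace G] (h : Γ.LocallyInjective) (ξ : (regRep h).H) (γ : G) :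
    ℂ :=
  -- The ascription unfolds the Hilbert space of `regRep`, so that the coercion of `ℓ²` to functions
  -- applies.
  @id (SchurTest.L2 G) ξ γ

theorem norm_coord_le [TopologicalSpace G] (h : Γ.LocallyInjective) (ξ : (regRep h).H) (γ : G) :
    ‖coord h ξ γ‖ ≤ ‖ξ‖ :=
  lp.norm_apply_le_norm (p := 2) (by norm_num) (@id (SchurTest.L2 G) ξ) γ

theorem norm_basisVec [TopologicalSpace G] (h : Γ.LocallyInjective) (γ : G) :
    ‖basisVec h γ‖ = 1 := by
  classical
  exact (lp.norm_single (p := 2) (E := fun _ : G => ℂ) (by norm_num) γ (1 : ℂ)).trans norm_one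

theorem coord_basisVec [TopologicalSpace G] (h : Γ.LocallyInjective) (γ : G) :
    coord h (basisVec h γ) γ = 1 := by
  classical
  exact lp.single_apply_self (E := fun _ : G => ℂ) 2 γ (1 : ℂ)

theorem coord_basisVec_ne [TopologicalSpace G] (h : Γ.LocallyInjective) {γ ζ : G} (hne : ζ ≠ γ) :
    coord h (basisVec h γ) ζ = 0 := by
  classical
  exact lp.single_apply_ne (E := fun _ : G => ℂ) 2 γ (1 : ℂ) hne

theorem coord_ext [TopologicalSpace G] (h : Γ.LocallyInjective) {ξ η : (regRep h).H}
    (e : ∀ γ, coord h ξ γ = coord h η γ) : ξ = η :=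
  lp.ext (funext e)

theorem ext_basisVec [TopologicalSpace G] (h : Γ.LocallyInjective)
    {S T : (regRep h).H →L[ℂ] (regRep h).H} (e : ∀ γ, S (basisVec h γ) = T (basisVec h γ)) :
    S = T :=
  SchurTest.Kernel.ext_single (S := S) (T := T) fun i j =>
    congrArg (fun ξ => coord h ξ i) (e j)

theorem coord_regRep_map [TopologicalSpace G] (h : Γ.LocallyInjective)
    (f : CompactlySupportedContinuousMap G ℂ) (γ ζ : G) :
    coord h ((regRep h).map f (basisVec h ζ)) γ = Γ.regKer f γ ζ := by
  classical
  exact (regKernel h f).op_single ζ γ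

end ArrowGroupoid

/-! ### Ample groupoids and convolution of compactly supported functions. -/

namespace ArrowGroupoid

variable {X : Type u} {G : Type v} [TopologicalSpace X] [TopologicalSpace G]

/-- An ample topological groupoid: an étale groupoid whose topology has a base of compact open
bisections. -/
structure IsAmple (Γ : ArrowGroupoid X G) : Prop where
  continuous_rng : Continuous Γ.rng
  continuous_src : Continuous Γ.src
  continuous_one : Continuous Γ.one
  continuous_inv : Continuous Γ.inv
  continuous_mul : Continuous fun p : {p : G × G // Γ.src p.1 = Γ.rng p.2} => Γ.mul p.1.1 p.1.2 p.2
  isOpenMap_rng : IsOpenMap Γ.rng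
  isOpen_units : IsOpen (Set.range Γ.one)
  exists_bisection : ∀ γ : G, ∀ W : Set G, IsOpen W → γ ∈ W → ∃ V ⊆ W, γ ∈ V ∧ IsCompact V ∧
    IsOpen V ∧ Set.InjOn Γ.rng V ∧ Set.InjOn Γ.src V

/-- Compact open bisections. -/
structure IsBisection (Γ : ArrowGroupoid X G) (V : Set G) : Prop where
  isCompact : IsCompact V
  isOpen : IsOpen V
  injOn_rng : Set.InjOn Γ.rng V
  injOn_src : Set.InjOn Γ.src V

/-- Multiplication of a compactly supported function by a continuous function. -/
noncomputable def weight (φ : C(G, ℂ)) (f : C_c(G, ℂ)) : C_c(G, ℂ) :=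
  ⟨φ * f.toContinuousMap, f.hasCompactSupport.mul_left⟩

@[simp]
theorem weight_apply (φ : C(G, ℂ)) (f : C_c(G, ℂ)) (γ : G) : weight φ f γ = φ γ * f γ := rfl

open Classical in
/-- The indicator function of a clopen set. -/
noncomputable def clopenInd (V : Set G) (hV : IsClopen V) : C(G, ℂ) :=
  ⟨fun γ => if γ ∈ V then 1 else 0,
    continuous_const.if (by simp [hV.frontier_eq]) continuous_const⟩

open Classical in
@[simp]
theorem clopenInd_apply (V : Set G) (hV : IsClopen V) (γ : G) :
    clopenInd V hV γ = if γ ∈ V then 1 else 0 := rfl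

open Classical in
/-- The indicator function of a compact open set. -/
noncomputable def ind [T2Space G] (V : Set G) (hc : IsCompact V) (ho : IsOpen V) : C_c(G, ℂ) :=
  ⟨clopenInd V ⟨hc.isClosed, ho⟩, HasCompactSupport.intro hc fun _ hγ => if_neg hγ⟩

open Classical in
@[simp]
theorem ind_apply [T2Space G] (V : Set G) (hc : IsCompact V) (ho : IsOpen V) (γ : G) :
    ind V hc ho γ = if γ ∈ V then 1 else 0 := rfl

namespace IsAmple

variable {Γ : ArrowGroupoid X G} (hΓ : Γ.IsAmple)
include hΓ

theorem locallyInjective : Γ.LocallyInjective := fun γ => by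
  obtain ⟨V, -, hγ, -, ho, hr, hs⟩ := hΓ.exists_bisection γ _ isOpen_univ trivial
  exact ⟨V, ho, hγ, hr, hs⟩

theorem isOpen_image_one {W : Set X} (hW : IsOpen W) : IsOpen (Γ.one '' W) := by
  have : Γ.one '' W = Set.range Γ.one ∩ Γ.rng ⁻¹' W := by
    ext γ
    constructor
    · rintro ⟨x, hx, rfl⟩
      exact ⟨⟨x, rfl⟩, by simpa [Γ.rng_one] using hx⟩
    · rintro ⟨⟨x, rfl⟩, hx⟩
      exact ⟨x, by simpa [Γ.rng_one] using hx, rfl⟩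
  rw [this]
  exact hΓ.isOpen_units.inter (hW.preimage hΓ.continuous_rng)

theorem isBisection_one {W : Set X} (hc : IsCompact W) (ho : IsOpen W) :
    Γ.IsBisection (Γ.one '' W) where
  isCompact := hc.image hΓ.continuous_one
  isOpen := hΓ.isOpen_image_one ho
  injOn_rng := by
    rintro _ ⟨x, -, rfl⟩ _ ⟨y, -, rfl⟩ h
    rw [Γ.rng_one, Γ.rng_one] at h
    rw [h]
  injOn_src := by
    rintro _ ⟨x, -, rfl⟩ _ ⟨y, -, rfl⟩ h
    rw [Γ.src_one, Γ.src_one] at h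
    rw [h]

variable [T2Space G]

/-- Every compactly supported function is a sum of functions supported on compact open
bisections. -/
theorem induction {P : C_c(G, ℂ) → Prop} (hadd : ∀ f g, P f → P g → P (f + g))
    (hb : ∀ f V, Γ.IsBisection V → (∀ γ, γ ∉ V → f γ = 0) → P f) (f : C_c(G, ℂ)) : P f := by
  classical
  have key : ∀ (t : Finset (Set G)), (∀ V ∈ t, Γ.IsBisection V) → ∀ f : C_c(G, ℂ),
      (∀ γ, (∀ V ∈ t, γ ∉ V) → f γ = 0) → P f := by
    intro t
    induction t using Finset.induction_on with
    | empty =>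
      intro _ f hf
      refine hb f ∅ ⟨isCompact_empty, isOpen_empty, Set.injOn_empty _, Set.injOn_empty _⟩ ?_
      exact fun γ _ => hf γ (by simp)
    | insert V t hV ih =>
      intro ht f hf
      have hVb := ht V (Finset.mem_insert_self _ _)
      have hcl : IsClopen V := ⟨hVb.isCompact.isClosed, hVb.isOpen⟩
      -- Compact open sets are clopen here, so both parts are continuous: one lives on the bisection
      -- `V`, the other on the union of the remaining ones.
      have e : f = weight (clopenInd V hcl) f + weight (clopenInd Vᶜ hcl.compl) f := by
        ext γ
        by_cases h : γ ∈ V <;> simp [h]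
      rw [e]
      refine hadd _ _ (hb _ V hVb fun γ h => by simp [h])
        (ih (fun W hW => ht W (Finset.mem_insert_of_mem hW)) _ fun γ h => ?_)
      by_cases hγ : γ ∈ V
      · simp [hγ]
      · simp only [weight_apply, mul_eq_zero]
        exact Or.inr (hf γ fun W hW => by
          rcases Finset.mem_insert.1 hW with rfl | h'
          · exact hγ
          · exact h W h')
  choose V hVs hmem hc ho hr hs using fun γ => hΓ.exists_bisection γ _ isOpen_univ trivial
  obtain ⟨t, ht⟩ := f.hasCompactSupport.isCompact.elim_finite_subcover V ho
    (fun γ _ => Set.mem_iUnion.2 ⟨γ, hmem γ⟩)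
  refine key (t.image V) ?_ f ?_
  · intro W hW
    obtain ⟨γ, -, rfl⟩ := Finset.mem_image.1 hW
    exact ⟨hc γ, ho γ, hr γ, hs γ⟩
  · intro γ hγ
    by_contra h0
    have := ht (subset_tsupport _ h0)
    simp only [Set.mem_iUnion] at this
    obtain ⟨i, hi, hmem⟩ := this
    exact hγ _ (Finset.mem_image_of_mem V hi) hmem

omit [TopologicalSpace X] [TopologicalSpace G] [T2Space G] hΓ in
theorem conv_of_mem (f g : G → ℂ) {V : Set G} (hV : Set.InjOn Γ.rng V) (hf : ∀ γ, γ ∉ V → f γ = 0)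
    {η γ : G} (hη : η ∈ V) (h : Γ.rng η = Γ.rng γ) :
    Γ.conv f g γ = f η * g (Γ.ldiv η γ h) := by
  rw [conv_eq, finsum_eq_single _ ⟨η, h⟩]
  intro ζ hζ
  rw [hf, zero_mul]
  exact fun hm => hζ (Subtype.ext (hV hm hη (ζ.2.trans h.symm)))

omit [TopologicalSpace X] [TopologicalSpace G] [T2Space G] hΓ in
theorem conv_of_notMem (f g : G → ℂ) {V : Set G} (hf : ∀ γ, γ ∉ V → f γ = 0)
    {γ : G} (h : Γ.rng γ ∉ Γ.rng '' V) : Γ.conv f g γ = 0 := by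
  rw [conv_eq]
  refine finsum_eq_zero_of_forall_eq_zero fun ζ => ?_
  rw [hf, zero_mul]
  exact fun hm => h ⟨_, hm, ζ.2⟩

omit [T2Space G] in
theorem continuous_ldiv : Continuous fun p : {p : G × G // Γ.rng p.1 = Γ.rng p.2} =>
    Γ.ldiv p.1.1 p.1.2 p.2 := by
  have h : Continuous fun p : {p : G × G // Γ.rng p.1 = Γ.rng p.2} =>
      (⟨(Γ.inv p.1.1, p.1.2), (Γ.src_inv _).trans p.2⟩ : {p : G × G // Γ.src p.1 = Γ.rng p.2}) :=
    Continuous.subtype_mk (by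
      exact (hΓ.continuous_inv.comp (continuous_fst.comp continuous_subtype_val)).prodMk
        (continuous_snd.comp continuous_subtype_val)) _
  exact hΓ.continuous_mul.comp h

omit [T2Space G] in
-- The range map is a homeomorphism from `V` to the clopen set `r(V)`; let `σ` be its inverse
-- composed with `r`. Over `r(V)` the convolution has the single term `f(σ(γ)) g(σ(γ)⁻¹γ)`, and
-- elsewhere it is zero.
theorem continuous_conv [T2Space X] (f g : C_c(G, ℂ)) {V : Set G} (hV : Γ.IsBisection V)
    (hf : ∀ γ, γ ∉ V → f γ = 0) : Continuous (Γ.conv f g) := by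
  have hK : IsClosed (Γ.rng '' V) := (hV.isCompact.image hΓ.continuous_rng).isClosed
  have hO : IsOpen (Γ.rng '' V) := hΓ.isOpenMap_rng _ hV.isOpen
  have : CompactSpace V := isCompact_iff_compactSpace.1 hV.isCompact
  have hemb : Topology.IsClosedEmbedding (fun η : V => Γ.rng η.1) :=
    (hΓ.continuous_rng.comp continuous_subtype_val).isClosedEmbedding
      (fun a b h => Subtype.ext (hV.injOn_rng a.2 b.2 h))
  let e := hemb.toIsEmbedding.toHomeomorph
  have hmem : ∀ γ : Γ.rng ⁻¹' (Γ.rng '' V), Γ.rng γ.1 ∈ Set.range (fun η : V => Γ.rng η.1) := by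
    rintro ⟨γ, η, hη, h⟩
    exact ⟨⟨η, hη⟩, h⟩
  let σ : Γ.rng ⁻¹' (Γ.rng '' V) → V := fun γ => e.symm ⟨Γ.rng γ.1, hmem γ⟩
  have hσ : Continuous σ := e.symm.continuous.comp
    (Continuous.subtype_mk (hΓ.continuous_rng.comp continuous_subtype_val) _)
  have hσr : ∀ γ, Γ.rng (σ γ).1 = Γ.rng γ.1 := fun γ =>
    congrArg Subtype.val (e.apply_symm_apply ⟨Γ.rng γ.1, hmem γ⟩)
  have hon : ContinuousOn (Γ.conv f g) (Γ.rng ⁻¹' (Γ.rng '' V)) := by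
    rw [continuousOn_iff_continuous_domRestrict]
    have : Set.domRestrict (Γ.rng ⁻¹' (Γ.rng '' V)) (Γ.conv f g) =
        fun γ => f (σ γ).1 * g (Γ.ldiv (σ γ).1 γ.1 (hσr γ)) := by
      ext γ
      exact conv_of_mem f g hV.injOn_rng hf (σ γ).2 (hσr γ)
    rw [this]
    refine (f.continuous.comp (continuous_subtype_val.comp hσ)).mul (g.continuous.comp ?_)
    exact hΓ.continuous_ldiv.comp (Continuous.subtype_mk
      ((continuous_subtype_val.comp hσ).prodMk continuous_subtype_val) hσr)
  rw [continuous_iff_continuousAt]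
  intro γ
  by_cases hγ : Γ.rng γ ∈ Γ.rng '' V
  · exact hon.continuousAt ((hO.preimage hΓ.continuous_rng).mem_nhds hγ)
  · have h0 : (fun _ => (0 : ℂ)) =ᶠ[nhds γ] Γ.conv f g := by
      filter_upwards [(hK.isOpen_compl.preimage hΓ.continuous_rng).mem_nhds hγ] with ζ hζ
      exact (conv_of_notMem f g hf hζ).symm
    exact continuousAt_const.congr h0

omit [T2Space G] in
theorem isCompact_mul [T2Space X] {K L : Set G} (hK : IsCompact K) (hL : IsCompact L) :
    IsCompact {γ | ∃ a ∈ K, ∃ b ∈ L, ∃ h : Γ.src a = Γ.rng b, γ = Γ.mul a b h} := by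
  -- The unit space is Hausdorff, so the composable pairs in `K × L` form a compact set.
  have hcl : IsClosed {p : G × G | Γ.src p.1 = Γ.rng p.2} :=
    isClosed_eq (hΓ.continuous_src.comp continuous_fst) (hΓ.continuous_rng.comp continuous_snd)
  have h1 := (hcl.isClosedEmbedding_subtypeVal.isCompact_preimage (hK.prod hL)).image
    hΓ.continuous_mul
  convert h1 using 1
  ext γ
  constructor
  · rintro ⟨a, ha, b, hb, h, rfl⟩
    exact ⟨⟨(a, b), h⟩, ⟨ha, hb⟩, rfl⟩
  · rintro ⟨⟨⟨a, b⟩, h⟩, ⟨ha, hb⟩, rfl⟩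
    exact ⟨a, ha, b, hb, h, rfl⟩

omit [TopologicalSpace X] [TopologicalSpace G] [T2Space G] hΓ in
/-- The support of a convolution product lies in the product of the supports. -/
theorem conv_ne_zero {f g : G → ℂ} {γ : G} (h : Γ.conv f g γ ≠ 0) :
    ∃ a b, f a ≠ 0 ∧ g b ≠ 0 ∧ ∃ h : Γ.src a = Γ.rng b, γ = Γ.mul a b h := by
  rw [conv_eq] at h
  obtain ⟨η, hη⟩ : ∃ η : {η : G // Γ.rng η = Γ.rng γ}, f η.1 * g (Γ.ldiv η.1 γ η.2) ≠ 0 := by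
    by_contra! hn
    exact h (finsum_eq_zero_of_forall_eq_zero hn)
  exact ⟨η.1, Γ.ldiv η.1 γ η.2, left_ne_zero_of_mul hη, right_ne_zero_of_mul hη,
    (Γ.rng_ldiv _ _ _).symm, (Γ.mul_ldiv _ _ _).symm⟩

omit [T2Space G] in
theorem conv_add_left (f₁ f₂ : C_c(G, ℂ)) (g : G → ℂ) :
    Γ.conv (f₁ + f₂ : C_c(G, ℂ)) g = Γ.conv f₁ g + Γ.conv f₂ g := by
  ext γ
  rw [Pi.add_apply, conv_eq, conv_eq, conv_eq, ← finsum_add_distrib]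
  · refine finsum_congr fun η => ?_
    simp [add_mul]
  · exact (hΓ.locallyInjective.finite_rng f₁ _).subset fun η h h0 => h (by simp [h0])
  · exact (hΓ.locallyInjective.finite_rng f₂ _).subset fun η h h0 => h (by simp [h0])

theorem exists_conv [T2Space X] (f g : C_c(G, ℂ)) : ∃ k : C_c(G, ℂ), (k : G → ℂ) = Γ.conv f g := by
  refine hΓ.induction (P := fun f => ∃ k : C_c(G, ℂ), (k : G → ℂ) = Γ.conv f g) ?_ ?_ f
  · rintro f₁ f₂ ⟨k₁, h₁⟩ ⟨k₂, h₂⟩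
    exact ⟨k₁ + k₂, by rw [hΓ.conv_add_left, ← h₁, ← h₂]; rfl⟩
  · intro f V hV hf
    refine ⟨⟨⟨_, hΓ.continuous_conv f g hV hf⟩, HasCompactSupport.intro
      (hΓ.isCompact_mul f.hasCompactSupport.isCompact g.hasCompactSupport.isCompact) ?_⟩, rfl⟩
    intro γ hγ
    by_contra h0
    obtain ⟨a, b, ha, hb, h, e⟩ := conv_ne_zero h0
    exact hγ ⟨a, subset_tsupport _ ha, b, subset_tsupport _ hb, h, e⟩

/-- The convolution product as a compactly supported function. -/
noncomputable def convC [T2Space X] (f g : C_c(G, ℂ)) : C_c(G, ℂ) :=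
  Classical.choose (hΓ.exists_conv f g)

theorem coe_convC [T2Space X] (f g : C_c(G, ℂ)) : (hΓ.convC f g : G → ℂ) = Γ.conv f g :=
  Classical.choose_spec (hΓ.exists_conv f g)

/-- The involution on compactly supported functions. -/
noncomputable def involC (f : C_c(G, ℂ)) : C_c(G, ℂ) :=
  ⟨⟨Γ.invol f, continuous_star.comp (f.continuous.comp hΓ.continuous_inv)⟩,
    HasCompactSupport.intro (f.hasCompactSupport.isCompact.image hΓ.continuous_inv) fun γ hγ => by
      change star (f (Γ.inv γ)) = 0
      rw [star_eq_zero]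
      by_contra h0
      exact hγ ⟨_, subset_tsupport _ h0, Γ.inv_inv γ⟩⟩

theorem involC_apply (f : C_c(G, ℂ)) (γ : G) : hΓ.involC f γ = star (f (Γ.inv γ)) := rfl

/-- The indicator function of a set of units. -/
noncomputable def unitInd {W : Set X} (hc : IsCompact W) (ho : IsOpen W) : C_c(G, ℂ) :=
  ind (Γ.one '' W) (hΓ.isBisection_one hc ho).isCompact (hΓ.isBisection_one hc ho).isOpen

open Classical in
theorem unitInd_apply {W : Set X} (hc : IsCompact W) (ho : IsOpen W) (γ : G) :
    hΓ.unitInd hc ho γ = if γ ∈ Γ.one '' W then 1 else 0 := rfl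

open Classical in
theorem conv_unitInd_left {W : Set X} (hc : IsCompact W) (ho : IsOpen W) (f : G → ℂ) (γ : G) :
    Γ.conv (hΓ.unitInd hc ho) f γ = if Γ.rng γ ∈ W then f γ else 0 := by
  have h0 : ∀ γ, γ ∉ Γ.one '' W → hΓ.unitInd hc ho γ = 0 := fun γ h => if_neg h
  split_ifs with h
  · have hm : Γ.one (Γ.rng γ) ∈ Γ.one '' W := ⟨_, h, rfl⟩
    rw [conv_of_mem _ f (hΓ.isBisection_one hc ho).injOn_rng h0 hm (Γ.rng_one _),
      unitInd_apply, if_pos hm, _root_.one_mul, ldiv]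
    congr 1
    exact (Γ.mul_congr (Γ.inv_one _) rfl _ (Γ.src_one _)).trans (Γ.one_mul γ)
  · refine conv_of_notMem _ f h0 ?_
    rintro ⟨_, ⟨x, hx, rfl⟩, e⟩
    rw [Γ.rng_one] at e
    exact h (e ▸ hx)

open Classical in
theorem conv_unitInd_right {W : Set X} (hc : IsCompact W) (ho : IsOpen W) (f : G → ℂ) (γ : G) :
    Γ.conv f (hΓ.unitInd hc ho) γ = if Γ.src γ ∈ W then f γ else 0 := by
  rw [conv_eq, finsum_eq_single _ ⟨γ, rfl⟩]
  · have e : Γ.ldiv γ γ rfl = Γ.one (Γ.src γ) := Γ.inv_mul γ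
    rw [e, unitInd_apply]
    have : Γ.one (Γ.src γ) ∈ Γ.one '' W ↔ Γ.src γ ∈ W := by
      constructor
      · rintro ⟨x, hx, e⟩
        have := congrArg Γ.rng e
        rw [Γ.rng_one, Γ.rng_one] at this
        rwa [← this]
      · exact fun h => ⟨_, h, rfl⟩
    simp [this]
  · rintro ⟨η, h⟩ hne
    rw [unitInd_apply, if_neg, mul_zero]
    rintro ⟨x, -, e⟩
    apply hne
    refine Subtype.ext ?_
    have h1 := Γ.mul_ldiv η γ h
    have h2 : x = Γ.src η := by rw [← Γ.rng_ldiv η γ h, ← e, Γ.rng_one]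
    exact ((Γ.mul_one' h2 ((Γ.rng_one x).trans h2).symm).symm.trans (Γ.mul_congr rfl e _ _)).trans h1

end IsAmple

end ArrowGroupoid

/-! ### The full C*-algebra: coordinates, approximation and norm estimates. -/

namespace ArrowGroupoid

variable {X : Type u} {G : Type v} [TopologicalSpace G] {Γ : ArrowGroupoid X G}

namespace RepProduct

/-- The coordinate of an element of the product at a representation. -/
noncomputable def eval (y : Γ.RepProduct) (π : Γ.Rep) : π.H →L[ℂ] π.H :=
  @id (lp (fun π : Γ.Rep => (π.H →L[ℂ] π.H)) ∞) y π

theorem eval_zero (π : Γ.Rep) : (0 : Γ.RepProduct).eval π = 0 := rfl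

theorem ext {y z : Γ.RepProduct} (h : ∀ π, y.eval π = z.eval π) : y = z :=
  lp.ext (E := fun π : Γ.Rep => (π.H →L[ℂ] π.H)) (funext h)

theorem norm_eval_le (y : Γ.RepProduct) (π : Γ.Rep) : ‖y.eval π‖ ≤ ‖y‖ :=
  lp.norm_apply_le_norm (E := fun π : Γ.Rep => (π.H →L[ℂ] π.H)) ENNReal.top_ne_zero
    (@id (lp (fun π : Γ.Rep => (π.H →L[ℂ] π.H)) ∞) y) π

theorem norm_le {y : Γ.RepProduct} {M : ℝ} (hM : 0 ≤ M) (h : ∀ π, ‖y.eval π‖ ≤ M) : ‖y‖ ≤ M :=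
  lp.norm_le_of_forall_le (E := fun π : Γ.Rep => (π.H →L[ℂ] π.H))
    (f := @id (lp (fun π : Γ.Rep => (π.H →L[ℂ] π.H)) ∞) y) hM h

end RepProduct

variable (h : Γ.LocallyInjective)

theorem eval_universal (f : C_c(G, ℂ)) (π : Γ.Rep) : (universal h f).eval π = π.map f := rfl

/-- The image of a compactly supported function in the full C*-algebra. -/
noncomputable def emb (f : C_c(G, ℂ)) : fullCStar h :=
  ⟨universal h f, NonUnitalStarSubalgebra.le_topologicalClosure _
    (NonUnitalStarAlgebra.subset_adjoin ℂ _ ⟨f, rfl⟩)⟩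

/-- The coordinate of an element of the full C*-algebra at a representation. -/
noncomputable def ev (π : Γ.Rep) (a : fullCStar h) : π.H →L[ℂ] π.H := a.1.eval π

theorem ev_emb (f : C_c(G, ℂ)) (π : Γ.Rep) : ev h π (emb h f) = π.map f := rfl

theorem ev_add (a b : fullCStar h) (π : Γ.Rep) : ev h π (a + b) = ev h π a + ev h π b := rfl

theorem ev_sub (a b : fullCStar h) (π : Γ.Rep) : ev h π (a - b) = ev h π a - ev h π b := rfl

theorem ev_mul (a b : fullCStar h) (π : Γ.Rep) : ev h π (a * b) = ev h π a * ev h π b := rfl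

theorem ev_star (a : fullCStar h) (π : Γ.Rep) : ev h π (star a) = star (ev h π a) := rfl

theorem ev_zero (π : Γ.Rep) : ev h π 0 = 0 := rfl

variable {h}

theorem ev_ext {a b : fullCStar h} (e : ∀ π, ev h π a = ev h π b) : a = b :=
  Subtype.ext (RepProduct.ext e)

theorem norm_ev_le (a : fullCStar h) (π : Γ.Rep) : ‖ev h π a‖ ≤ ‖a‖ := RepProduct.norm_eval_le a.1 π

theorem norm_emb_le {f : C_c(G, ℂ)} {M : ℝ} (hM : 0 ≤ M) (hf : Γ.iNorm f ≤ ENNReal.ofReal M) :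
    ‖emb h f‖ ≤ M := by
  refine RepProduct.norm_le hM fun π => ?_
  have := (π.bounded f).trans hf
  rw [← ofReal_norm] at this
  exact (ENNReal.ofReal_le_ofReal_iff hM).1 this

theorem emb_add (f g : C_c(G, ℂ)) : emb h (f + g) = emb h f + emb h g :=
  ev_ext fun π => by simp only [ev_add, ev_emb, map_add]

theorem emb_sub (f g : C_c(G, ℂ)) : emb h (f - g) = emb h f - emb h g :=
  ev_ext fun π => by simp only [ev_sub, ev_emb, map_sub]

theorem emb_smul (c : ℂ) (f : C_c(G, ℂ)) : emb h (c • f) = c • emb h f :=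
  ev_ext fun π => by
    rw [ev_emb, map_smul]
    rfl

theorem emb_mul {f g k : C_c(G, ℂ)} (e : (k : G → ℂ) = Γ.conv f g) :
    emb h f * emb h g = emb h k :=
  ev_ext fun π => by rw [ev_mul, ev_emb, ev_emb, ev_emb, π.map_conv f g k e]

theorem emb_star {f k : C_c(G, ℂ)} (e : (k : G → ℂ) = Γ.invol f) : star (emb h f) = emb h k :=
  ev_ext fun π => by rw [ev_star, ev_emb, ev_emb, π.map_invol f k e]

/-- The compactly supported functions are closed under convolution and involution, so their image is
already a `*`-algebra, and the full C*-algebra is just its closure. -/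
theorem exists_emb_near [TopologicalSpace X] [T2Space X] [T2Space G] (hΓ : Γ.IsAmple)
    (a : fullCStar h) {ε : ℝ} (hε : 0 < ε) : ∃ f : C_c(G, ℂ), ‖a - emb h f‖ < ε := by
  let S : NonUnitalStarSubalgebra ℂ Γ.RepProduct :=
    { carrier := Set.range (universal h)
      add_mem' := by
        rintro _ _ ⟨f, rfl⟩ ⟨g, rfl⟩
        exact ⟨f + g, congrArg Subtype.val (emb_add (h := h) f g)⟩
      zero_mem' := ⟨0, RepProduct.ext fun π => by
        rw [eval_universal, map_zero, RepProduct.eval_zero]⟩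
      mul_mem' := by
        rintro _ _ ⟨f, rfl⟩ ⟨g, rfl⟩
        exact ⟨hΓ.convC f g, (congrArg Subtype.val (emb_mul (h := h) (hΓ.coe_convC f g))).symm⟩
      smul_mem' := by
        rintro c _ ⟨f, rfl⟩
        exact ⟨c • f, congrArg Subtype.val (emb_smul (h := h) c f)⟩
      star_mem' := by
        rintro _ ⟨f, rfl⟩
        exact ⟨hΓ.involC f,
          (congrArg Subtype.val (emb_star (h := h) (f := f) (k := hΓ.involC f) rfl)).symm⟩ }
  have h1 : NonUnitalStarAlgebra.adjoin ℂ (Set.range (universal h)) ≤ S :=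
    NonUnitalStarAlgebra.adjoin_le (S := S) (le_refl _)
  have h2 : a.1 ∈ closure (Set.range (universal h)) := by
    have h3 : a.1 ∈ closure ((NonUnitalStarAlgebra.adjoin ℂ
      (Set.range (universal h)) : NonUnitalStarSubalgebra ℂ Γ.RepProduct) : Set Γ.RepProduct) := a.2
    exact closure_mono h1 h3
  obtain ⟨_, ⟨f, rfl⟩, hf⟩ := Metric.mem_closure_iff.1 h2 ε hε
  exact ⟨f, by rwa [dist_eq_norm] at hf⟩

/-- A function that is bounded by `M` and supported on the units has norm at most `M`. -/
theorem norm_emb_le_of_units {f : C_c(G, ℂ)} {M : ℝ} (hM : 0 ≤ M) (hf : ∀ γ, ‖f γ‖ ≤ M)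
    (hu : ∀ γ, γ ∉ Set.range Γ.one → f γ = 0) : ‖emb h f‖ ≤ M := by
  refine norm_emb_le hM ?_
  have hb : ∀ γ, ‖f γ‖ₑ ≤ ENNReal.ofReal M := fun γ => by
    rw [← ofReal_norm]; exact ENNReal.ofReal_le_ofReal (hf γ)
  -- Each fibre contains one unit only, so the `I`-norm of a function supported on units is its
  -- supremum norm.
  have hr : Set.InjOn Γ.rng (Set.range Γ.one) := by
    rintro _ ⟨x, rfl⟩ _ ⟨y, rfl⟩ e
    rw [Γ.rng_one, Γ.rng_one] at e; rw [e]
  have hs : Set.InjOn Γ.src (Set.range Γ.one) := by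
    rintro _ ⟨x, rfl⟩ _ ⟨y, rfl⟩ e
    rw [Γ.src_one, Γ.src_one] at e; rw [e]
  refine max_le (iSup_le fun x => ?_) (iSup_le fun x => ?_)
  · simpa using fibre_sum_le Γ.src f (Set.range Γ.one) {Set.range Γ.one} hu (by simp)
      (by simpa using hs) _ hb x
  · simpa using fibre_sum_le Γ.rng f (Set.range Γ.one) {Set.range Γ.one} hu (by simp)
      (by simpa using hr) _ hb x

omit [TopologicalSpace G] in
theorem regKer_one (f : G → ℂ) (γ : G) (x : X) (e : Γ.src γ = x) :
    Γ.regKer f γ (Γ.one x) = f γ := by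
  have e' : Γ.src γ = Γ.src (Γ.one x) := e.trans (Γ.src_one x).symm
  rw [Γ.regKer_of_eq f e', Γ.rdiv_one]

/-- The values of a function are bounded by the norm of its image in the regular
representation. -/
theorem norm_apply_le_regRep (f : C_c(G, ℂ)) (γ : G) : ‖f γ‖ ≤ ‖(regRep h).map f‖ := by
  have h1 := coord_regRep_map h f γ (Γ.one (Γ.src γ))
  rw [regKer_one _ _ _ rfl] at h1
  rw [← h1]
  refine (norm_coord_le h _ _).trans (((regRep h).map f).le_opNorm _ |>.trans ?_)
  rw [norm_basisVec, _root_.mul_one]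

end ArrowGroupoid

namespace ArrowGroupoid

variable {X : Type u} {G : Type v} [TopologicalSpace X] [TopologicalSpace G] {Γ : ArrowGroupoid X G}

/-! ## Functions supported on a compact subgroupoid -/

/-- If `a > b > 0`, the powers of `a / b` are unbounded; if `b = 0`, the case `n = 0` suffices. This
removes the constant `C` from a norm comparison. -/
theorem le_of_pow_two_pow_le {a b C : ℝ} (hb : 0 ≤ b)
    (hab : ∀ n : ℕ, a ^ 2 ^ (n + 1) ≤ C * b ^ 2 ^ (n + 1)) : a ≤ b := by
  by_contra! hlt
  rcases hb.eq_or_lt with rfl | hb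
  · have := hab 0
    norm_num at this
    nlinarith
  · have h1 : 1 < a / b := (one_lt_div hb).2 hlt
    obtain ⟨n, hn⟩ := pow_unbounded_of_one_lt C h1
    have h2 : (a / b) ^ n ≤ (a / b) ^ 2 ^ (n + 1) :=
      pow_le_pow_right₀ h1.le (n.lt_two_pow_self.le.trans (Nat.pow_le_pow_right (by norm_num) (by omega)))
    have h3 := hab n
    rw [← div_le_iff₀ (by positivity), ← div_pow] at h3
    linarith

omit [TopologicalSpace X] in
-- `C` counts the sets in a finite cover of `K` by sets on which range and source are injective;
-- this bounds the `I`-norm. It does not depend on the representation.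
theorem LocallyInjective.exists_norm_map_le (h : Γ.LocallyInjective) {K : Set G}
    (hK : IsCompact K) : ∃ C : ℝ, ∀ (π : Γ.Rep) (f : C_c(G, ℂ)) (M : ℝ), 0 ≤ M →
      (∀ γ, γ ∉ K → f γ = 0) → (∀ γ, ‖f γ‖ ≤ M) → ‖π.map f‖ ≤ C * M := by
  classical
  choose U hU hmem hr hs using h
  obtain ⟨t, ht⟩ := hK.elim_finite_subcover U hU (fun γ _ => Set.mem_iUnion.2 ⟨γ, hmem γ⟩)
  have hcov : K ⊆ ⋃ V ∈ t.image U, V := by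
    intro γ hγ
    have := ht hγ
    simp only [Set.mem_iUnion] at this ⊢
    obtain ⟨i, hi, hγi⟩ := this
    exact ⟨U i, Finset.mem_image_of_mem U hi, hγi⟩
  have hrange : ∀ V ∈ t.image U, Set.InjOn Γ.rng V ∧ Set.InjOn Γ.src V := by
    intro V hV
    obtain ⟨i, -, rfl⟩ := Finset.mem_image.1 hV
    exact ⟨hr i, hs i⟩
  refine ⟨(t.image U).card, fun π f M hM0 hf hM => ?_⟩
  have hM' : ∀ γ, ‖f γ‖ₑ ≤ ENNReal.ofReal M := fun γ => by
    rw [← ofReal_norm]; exact ENNReal.ofReal_le_ofReal (hM γ)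
  have h1 : Γ.iNorm f ≤ ((t.image U).card : ℝ≥0∞) * ENNReal.ofReal M := by
    refine max_le ?_ ?_
    · exact iSup_le fun x => fibre_sum_le Γ.src f K _ hf hcov (fun V hV => (hrange V hV).2) _ hM' x
    · exact iSup_le fun x => fibre_sum_le Γ.rng f K _ hf hcov (fun V hV => (hrange V hV).1) _ hM' x
  have h2 := (π.bounded f).trans h1
  rw [← ENNReal.ofReal_natCast, ← ENNReal.ofReal_mul (by positivity), ← ofReal_norm] at h2
  exact (ENNReal.ofReal_le_ofReal_iff (by positivity)).1 h2

/-- On functions supported on a compact subgroupoid, every representation is bounded by the regular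
one. -/
theorem IsAmple.norm_map_le_regRep [T2Space X] [T2Space G] (hΓ : Γ.IsAmple)
    (h : Γ.LocallyInjective) {K : Set G} (hK : IsCompact K)
    (hmul : ∀ a ∈ K, ∀ b ∈ K, ∀ e : Γ.src a = Γ.rng b, Γ.mul a b e ∈ K)
    (hinv : ∀ a ∈ K, Γ.inv a ∈ K) (f : C_c(G, ℂ)) (hf : ∀ γ, γ ∉ K → f γ = 0) (π : Γ.Rep) :
    ‖π.map f‖ ≤ ‖(regRep h).map f‖ := by
  obtain ⟨C, hC⟩ := h.exists_norm_map_le hK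
  -- Here `g n = (f^* f)^(2^n)`. These functions stay supported in `K`, and the C*-identity gives
  -- `‖π(g n)‖ = ‖π(f)‖^(2^(n+1))` in every representation.
  let g : ℕ → C_c(G, ℂ) := fun n => Nat.rec (hΓ.convC (hΓ.involC f) f) (fun _ u => hΓ.convC u u) n
  have g0 : g 0 = hΓ.convC (hΓ.involC f) f := rfl
  have gs : ∀ n, g (n + 1) = hΓ.convC (g n) (g n) := fun _ => rfl
  have hconv : ∀ u v : C_c(G, ℂ), (∀ γ, γ ∉ K → u γ = 0) → (∀ γ, γ ∉ K → v γ = 0) →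
      ∀ γ, γ ∉ K → hΓ.convC u v γ = 0 := by
    intro u v hu hv γ hγ
    by_contra h0
    rw [hΓ.coe_convC] at h0
    obtain ⟨a, b, ha, hb, e, rfl⟩ := IsAmple.conv_ne_zero h0
    exact hγ (hmul a (by by_contra h1; exact ha (hu a h1)) b (by by_contra h1; exact hb (hv b h1)) e)
  have hsupp : ∀ n γ, γ ∉ K → g n γ = 0 := by
    intro n
    induction n with
    | zero =>
      refine hconv _ _ (fun γ hγ => ?_) hf
      rw [hΓ.involC_apply, hf, star_zero]
      exact fun h1 => hγ (by simpa [Γ.inv_inv] using hinv _ h1)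
    | succ n ih => exact hconv _ _ ih ih
  have hmap0 : ∀ π : Γ.Rep, π.map (g 0) = star (π.map f) * π.map f := fun π => by
    rw [g0, π.map_conv _ _ _ (hΓ.coe_convC _ _), π.map_invol f (hΓ.involC f) rfl]
  have hmaps : ∀ (π : Γ.Rep) n, π.map (g (n + 1)) = π.map (g n) * π.map (g n) := fun π n => by
    rw [gs, π.map_conv _ _ _ (hΓ.coe_convC _ _)]
  have hself : ∀ (π : Γ.Rep) n, star (π.map (g n)) = π.map (g n) := by
    intro π n
    induction n with
    | zero => rw [hmap0, star_mul, star_star]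
    | succ n ih => rw [hmaps, star_mul, ih]
  have hnorm : ∀ (π : Γ.Rep) n, ‖π.map (g n)‖ = ‖π.map f‖ ^ 2 ^ (n + 1) := by
    intro π n
    induction n with
    | zero => rw [hmap0, CStarRing.norm_star_mul_self]; ring
    | succ n ih =>
      have h1 := CStarRing.norm_star_mul_self (x := π.map (g n))
      rw [hself] at h1
      rw [hmaps, h1, ih]
      ring
  refine le_of_pow_two_pow_le (norm_nonneg _) (C := C) fun n => ?_
  rw [← hnorm, ← hnorm]
  -- The supremum norm of `g n` is at most its norm in the regular representation, so `π(g n)` is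
  -- bounded by `C` times the latter, with `C` independent of `n`.
  exact hC π _ _ (norm_nonneg _) (hsupp n) (norm_apply_le_regRep _)

/-! ## Twisting by a cocycle -/

/-- A continuous homomorphism to the integers. -/
structure IsCocycle (Γ : ArrowGroupoid X G) (c : G → ℤ) : Prop where
  map_mul : ∀ a b h, c (Γ.mul a b h) = c a + c b
  continuous : Continuous c

namespace IsCocycle

variable {c : G → ℤ} (hc : Γ.IsCocycle c)
include hc

omit [TopologicalSpace X]

theorem map_one (x : X) : c (Γ.one x) = 0 := by
  have h1 := hc.map_mul _ _ (Γ.src_one (Γ.rng (Γ.one x)))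
  rw [Γ.one_mul] at h1
  have h2 := hc.map_mul _ _ (Γ.src_inv (Γ.one x))
  have h3 : Γ.one (Γ.rng (Γ.one x)) = Γ.one x := by rw [Γ.rng_one]
  rw [h3] at h1
  omega

theorem map_inv (a : G) : c (Γ.inv a) = - c a := by
  have h1 := hc.map_mul _ _ (Γ.src_inv a)
  rw [Γ.inv_mul, hc.map_one] at h1
  omega

/-- The character `z^c`. -/
noncomputable def char (z : Circle) : C(G, ℂ) :=
  ⟨fun γ => ((z ^ c γ : Circle) : ℂ),
    (continuous_of_discreteTopology (f := fun n : ℤ => ((z ^ n : Circle) : ℂ))).comp hc.continuous⟩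

theorem char_apply (z : Circle) (γ : G) : hc.char z γ = ((z ^ c γ : Circle) : ℂ) := rfl

/-- The representation `f ↦ π(z^c f)`. -/
noncomputable def twist (π : Γ.Rep) (z : Circle) : Γ.Rep where
  H := π.H
  map :=
    { toFun := fun f => π.map (weight (hc.char z) f)
      map_add' := fun f g => by
        rw [← map_add]; congr 1; ext γ; simp [mul_add]
      map_smul' := fun k f => by
        rw [RingHom.id_apply, ← map_smul]; congr 1; ext γ; simp; ring }
  map_conv f g k hk := π.map_conv _ _ _ (by
    ext γ
    rw [weight_apply, hk, conv_eq, conv_eq, ← smul_eq_mul, smul_finsum]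
    refine finsum_congr fun η => ?_
    have h1 : c γ = c η.1 + c (Γ.ldiv η.1 γ η.2) := by
      conv_lhs => rw [← Γ.mul_ldiv η.1 γ η.2]
      exact hc.map_mul _ _ _
    simp only [weight_apply, char_apply, h1, zpow_add, Circle.coe_mul, smul_eq_mul]
    ring)
  map_invol f k hk := π.map_invol _ _ (by
    ext γ
    simp only [weight_apply, hk, invol, char_apply, hc.map_inv, star_mul', zpow_neg]
    congr 1
    simp [← Circle.coe_inv_eq_conj])
  bounded f := by
    refine (π.bounded _).trans (le_of_eq ?_)
    have h1 : ∀ γ, ‖weight (hc.char z) f γ‖ₑ = ‖f γ‖ₑ := fun γ => by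
      rw [weight_apply, enorm_mul, char_apply, ← ofReal_norm, Circle.norm_coe]
      simp
    simp only [iNorm, h1]

variable (h : Γ.LocallyInjective)

/-- The coordinate of an element at a twisted representation. -/
noncomputable def evTwist (π : Γ.Rep) (z : Circle) (a : fullCStar h) : π.H →L[ℂ] π.H :=
  ev h (hc.twist π z) a

theorem evTwist_emb (π : Γ.Rep) (z : Circle) (f : C_c(G, ℂ)) :
    hc.evTwist h π z (emb h f) = π.map (weight (hc.char z) f) := rfl

theorem evTwist_sub (π : Γ.Rep) (z : Circle) (a b : fullCStar h) :
    hc.evTwist h π z (a - b) = hc.evTwist h π z a - hc.evTwist h π z b := rfl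

theorem evTwist_mul (π : Γ.Rep) (z : Circle) (a b : fullCStar h) :
    hc.evTwist h π z (a * b) = hc.evTwist h π z a * hc.evTwist h π z b := rfl

theorem evTwist_star (π : Γ.Rep) (z : Circle) (a : fullCStar h) :
    hc.evTwist h π z (star a) = star (hc.evTwist h π z a) := rfl

theorem norm_evTwist_le (π : Γ.Rep) (z : Circle) (a : fullCStar h) :
    ‖hc.evTwist h π z a‖ ≤ ‖a‖ := norm_ev_le a (hc.twist π z)

/-- The part of a function supported on `c = n`. -/
noncomputable def part (n : ℤ) (f : C_c(G, ℂ)) : C_c(G, ℂ) :=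
  weight (clopenInd (c ⁻¹' {n}) ((isClopen_discrete _).preimage hc.continuous)) f

open Classical in
theorem part_apply (n : ℤ) (f : C_c(G, ℂ)) (γ : G) :
    hc.part n f γ = if c γ = n then f γ else 0 := by
  simp [part]

/-- The cocycle takes finitely many values on the compact support, so `z ↦ π(z^c f)` is a
trigonometric polynomial. The index `0` is included so that its constant term can be isolated. -/
theorem exists_map_twist (f : C_c(G, ℂ)) : ∃ S : Finset ℤ, 0 ∈ S ∧ ∀ (π : Γ.Rep) (z : Circle),
    π.map (weight (hc.char z) f) = ∑ n ∈ S, ((z ^ n : Circle) : ℂ) • π.map (hc.part n f) := by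
  classical
  have hfin : (c '' tsupport f).Finite :=
    (f.hasCompactSupport.isCompact.image hc.continuous).finite_of_discrete
  refine ⟨insert 0 hfin.toFinset, Finset.mem_insert_self _ _, fun π z => ?_⟩
  simp only [← map_smul, ← map_sum]
  congr 1
  ext γ
  rw [weight_apply, CompactlySupportedContinuousMap.sum_apply]
  simp only [CompactlySupportedContinuousMap.smul_apply, part_apply, char_apply, smul_eq_mul,
    mul_ite, mul_zero]
  by_cases h0 : f γ = 0
  · simp [h0]
  · have hm : c γ ∈ insert 0 hfin.toFinset := by
      refine Finset.mem_insert_of_mem ?_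
      rw [Set.Finite.mem_toFinset]
      exact ⟨γ, subset_tsupport _ h0, rfl⟩
    rw [Finset.sum_ite_eq _ (c γ), if_pos hm]

omit [TopologicalSpace G] hc in
theorem circle_exp_zpow (n : ℤ) (t : ℝ) :
    ((Circle.exp t ^ n : Circle) : ℂ) = Complex.exp ((n * Complex.I) * t) := by
  rw [Circle.coe_zpow, Circle.coe_exp, ← Complex.exp_int_mul]
  congr 1; ring

omit [TopologicalSpace G] hc in
theorem continuous_circle_zpow (n : ℤ) :
    Continuous fun t : ℝ => ((Circle.exp t ^ n : Circle) : ℂ) := by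
  simp only [circle_exp_zpow]
  fun_prop

omit [TopologicalSpace G] hc in
theorem integral_circle_zpow (n : ℤ) (hn : n ≠ 0) :
    ∫ t in (0 : ℝ)..2 * Real.pi, ((Circle.exp t ^ n : Circle) : ℂ) = 0 := by
  simp only [circle_exp_zpow]
  rw [integral_exp_mul_complex (by simp [hn])]
  have h2 : Complex.exp (n * Complex.I * ((2 * Real.pi : ℝ) : ℂ)) = 1 := by
    rw [Complex.exp_eq_one_iff]
    exact ⟨n, by push_cast; ring⟩
  rw [h2]
  simp

theorem continuous_evTwist_emb (π : Γ.Rep) (f : C_c(G, ℂ)) :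
    Continuous fun t : ℝ => hc.evTwist h π (Circle.exp t) (emb h f) := by
  obtain ⟨S, -, hS⟩ := hc.exists_map_twist f
  simp only [evTwist_emb, hS]
  refine continuous_finsetSum _ fun n _ => ?_
  exact (continuous_circle_zpow n).smul continuous_const

/-- Averaging over the circle leaves only the constant Fourier coefficient, the part of `f` on the
kernel of `c`. -/
theorem integral_evTwist_emb (π : Γ.Rep) (f : C_c(G, ℂ)) :
    ∫ t in (0 : ℝ)..2 * Real.pi, hc.evTwist h π (Circle.exp t) (emb h f) =
      (2 * Real.pi : ℝ) • π.map (hc.part 0 f) := by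
  classical
  obtain ⟨S, h0, hS⟩ := hc.exists_map_twist f
  simp only [evTwist_emb, hS]
  rw [intervalIntegral.integral_finsetSum
    (f := fun (n : ℤ) (t : ℝ) => ((Circle.exp t ^ n : Circle) : ℂ) • π.map (hc.part n f))
    fun n _ => ((continuous_circle_zpow n).smul continuous_const).intervalIntegrable _ _]
  rw [Finset.sum_eq_single_of_mem 0 h0]
  · simp
  · intro n _ hn
    rw [intervalIntegral.integral_smul_const, integral_circle_zpow n hn, zero_smul]

end IsCocycle
end ArrowGroupoid

namespace ArrowGroupoid

variable {X : Type u} {G : Type v} [TopologicalSpace X] [TopologicalSpace G] {Γ : ArrowGroupoid X G}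

namespace IsCocycle

variable {c : G → ℤ} (hc : Γ.IsCocycle c) (h : Γ.LocallyInjective)
include hc

/-- Twisted evaluations are contractive, so the function is a uniform limit of trigonometric
polynomials. -/
theorem continuous_evTwist [T2Space X] [T2Space G] (hΓ : Γ.IsAmple) (π : Γ.Rep)
    (a : fullCStar h) : Continuous fun t : ℝ => hc.evTwist h π (Circle.exp t) a := by
  refine continuous_of_uniform_approx_of_continuous fun u hu => ?_
  obtain ⟨ε, hε, hεu⟩ := Metric.mem_uniformity_dist.1 hu
  obtain ⟨f, hf⟩ := exists_emb_near hΓ a hε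
  refine ⟨_, hc.continuous_evTwist_emb h π f, fun t => hεu ?_⟩
  rw [dist_eq_norm, ← evTwist_sub]
  exact (hc.norm_evTwist_le h π _ _).trans_lt hf

theorem evTwist_one [T2Space X] [T2Space G] (hΓ : Γ.IsAmple) (π : Γ.Rep) (a : fullCStar h) :
    hc.evTwist h π 1 a = ev h π a := by
  have hf : ∀ f : C_c(G, ℂ), hc.evTwist h π 1 (emb h f) = ev h π (emb h f) := by
    intro f
    rw [evTwist_emb, ev_emb]
    congr 1
    ext γ
    simp [char_apply]
  rw [← sub_eq_zero, ← norm_le_zero_iff]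
  refine le_of_forall_pos_le_add fun ε hε => ?_
  obtain ⟨f, hfa⟩ := exists_emb_near hΓ a (half_pos hε)
  have e : hc.evTwist h π 1 a - ev h π a =
      hc.evTwist h π 1 (a - emb h f) - ev h π (a - emb h f) := by
    rw [evTwist_sub, ev_sub, hf]; abel
  rw [e]
  have h1 := hc.norm_evTwist_le h π 1 (a - emb h f)
  have h2 := norm_ev_le (a - emb h f) π
  have h3 := norm_sub_le (hc.evTwist h π 1 (a - emb h f)) (ev h π (a - emb h f))
  linarith

/-- If the kernel of the cocycle is exhausted by compact subgroupoids, then an element that vanishes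
at all twists of the regular representation is zero. -/
theorem eq_zero_of_evTwist_regRep [T2Space X] [T2Space G] (hΓ : Γ.IsAmple)
    (hker : ∀ f : C_c(G, ℂ), (∀ γ, c γ ≠ 0 → f γ = 0) → ∀ π : Γ.Rep,
      ‖π.map f‖ ≤ ‖(regRep h).map f‖)
    (a : fullCStar h) (ha : ∀ z, hc.evTwist h (regRep h) z a = 0) : a = 0 := by
  have hpi : (0 : ℝ) ≤ 2 * Real.pi := by positivity
  have hint : ∀ (π : Γ.Rep) (b : fullCStar h),
      IntervalIntegrable (fun t : ℝ => hc.evTwist h π (Circle.exp t) b) MeasureTheory.volume 0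
        (2 * Real.pi) := fun π b => (hc.continuous_evTwist h hΓ π b).intervalIntegrable _ _
  have hbound : ∀ (π : Γ.Rep) (b : fullCStar h),
      ‖∫ t in (0 : ℝ)..2 * Real.pi, hc.evTwist h π (Circle.exp t) b‖ ≤ ‖b‖ * (2 * Real.pi) := by
    intro π b
    have := intervalIntegral.norm_integral_le_of_norm_le_const (a := 0) (b := 2 * Real.pi)
      (f := fun t : ℝ => hc.evTwist h π (Circle.exp t) b) (C := ‖b‖)
      fun t _ => hc.norm_evTwist_le h π _ b
    rwa [sub_zero, abs_of_nonneg hpi] at this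
  -- Approximate `a^* a` by `f`. The average of `a^* a` in the regular representation is zero, so
  -- the part of `f` on the kernel of `c` is small there; by `hker` it is small in `π`, hence so is
  -- the average in `π`.
  have hzero : ∀ (π : Γ.Rep),
      ∫ t in (0 : ℝ)..2 * Real.pi, hc.evTwist h π (Circle.exp t) (star a * a) = 0 := by
    intro π
    rw [← norm_le_zero_iff]
    refine le_of_forall_pos_le_add fun ε hε => ?_
    have hε' : 0 < ε / (2 * (2 * Real.pi)) := by positivity
    obtain ⟨f, hf⟩ := exists_emb_near hΓ (star a * a) hε'
    have h1 : ∀ π : Γ.Rep, ‖(∫ t in (0 : ℝ)..2 * Real.pi,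
        hc.evTwist h π (Circle.exp t) (star a * a)) - (2 * Real.pi : ℝ) • π.map (hc.part 0 f)‖
          ≤ ε / 2 := by
      intro π
      rw [← hc.integral_evTwist_emb h, ← intervalIntegral.integral_sub (hint _ _) (hint _ _)]
      simp only [← evTwist_sub]
      refine (hbound π _).trans ?_
      calc _ ≤ ε / (2 * (2 * Real.pi)) * (2 * Real.pi) := by gcongr
        _ = ε / 2 := by field_simp
    have h2 : ∫ t in (0 : ℝ)..2 * Real.pi,
        hc.evTwist h (regRep h) (Circle.exp t) (star a * a) = 0 := by
      simp [evTwist_mul, ha]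
    have h3 := h1 (regRep h)
    rw [h2, zero_sub, norm_neg, norm_smul] at h3
    have h4 := hker (hc.part 0 f) (fun γ hγ => by rw [part_apply, if_neg hγ]) π
    have h5 : ‖(2 * Real.pi : ℝ) • π.map (hc.part 0 f)‖ ≤ ε / 2 := by
      rw [norm_smul]
      refine le_trans ?_ h3
      gcongr
    have h6 := norm_sub_norm_le (∫ t in (0 : ℝ)..2 * Real.pi,
        hc.evTwist h π (Circle.exp t) (star a * a)) ((2 * Real.pi : ℝ) • π.map (hc.part 0 f))
    linarith [h1 π]
  refine ev_ext fun π => ?_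
  rw [ev_zero, ← hc.evTwist_one h hΓ π a]
  ext ξ
  let L : (π.H →L[ℂ] π.H) →L[ℂ] ℂ :=
    (innerSL ℂ ξ).comp (ContinuousLinearMap.apply ℂ π.H ξ)
  have hL : ∀ t : ℝ, L (hc.evTwist h π (Circle.exp t) (star a * a)) =
      ((‖hc.evTwist h π (Circle.exp t) a ξ‖ ^ 2 : ℝ) : ℂ) := by
    intro t
    change inner ℂ ξ ((star (hc.evTwist h π (Circle.exp t) a))
      (hc.evTwist h π (Circle.exp t) a ξ)) = _
    rw [ContinuousLinearMap.star_eq_adjoint, ContinuousLinearMap.adjoint_inner_right,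
      inner_self_eq_norm_sq_to_K]
    norm_cast
  -- A continuous nonnegative function with zero integral vanishes, in particular at `t = 0`, where
  -- the twist is trivial.
  have hI : ∫ t in (0 : ℝ)..2 * Real.pi, ‖hc.evTwist h π (Circle.exp t) a ξ‖ ^ 2 = 0 := by
    have h1 := L.intervalIntegral_comp_comm (hint π (star a * a))
    rw [hzero, map_zero] at h1
    simp only [hL] at h1
    rw [intervalIntegral.integral_ofReal] at h1
    exact_mod_cast h1
  by_contra hne
  have hcont : Continuous fun t : ℝ => ‖hc.evTwist h π (Circle.exp t) a ξ‖ ^ 2 :=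
    (((hc.continuous_evTwist h hΓ π a).clm_apply continuous_const).norm).pow 2
  have hpos := intervalIntegral.integral_pos (a := 0) (b := 2 * Real.pi) (by positivity)
    hcont.continuousOn (fun t _ => by positivity) ⟨0, ⟨le_refl _, hpi⟩, by
      rw [Circle.exp_zero]
      exact pow_pos (norm_pos_iff.2 hne) 2⟩
  exact hpos.ne' hI

end IsCocycle

/-! ## Ideals -/

/-- Modulo `I` the idempotent `p` equals `p - y`, hence also every power of `p - y`. These powers
tend to zero and `I` is closed. -/
theorem mem_of_norm_sub_lt_one {A : Type*} [NonUnitalCStarAlgebra A] (I : TwoSidedIdeal A)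
    (hI : IsClosed (I : Set A)) {p y : A} (hp : p * p = p) (hy : y ∈ I) (hlt : ‖p - y‖ < 1) :
    p ∈ I := by
  let u : ℕ → A := fun n => Nat.rec (p - y) (fun _ w => w * (p - y)) n
  have us : ∀ n, u (n + 1) = u n * (p - y) := fun _ => rfl
  have h1 : ∀ n, p - u n ∈ I := by
    intro n
    induction n with
    | zero =>
      have : p - u 0 = y := sub_sub_cancel p y
      rwa [this]
    | succ n ih =>
      have : p - u (n + 1) = (p - u n) * p + u n * y := by
        rw [us, sub_mul, hp, mul_sub]; abel
      rw [this]
      exact I.add_mem (I.mul_mem_right _ _ ih) (I.mul_mem_left _ _ hy)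
  have h2 : ∀ n, ‖u n‖ ≤ ‖p - y‖ ^ (n + 1) := by
    intro n
    induction n with
    | zero => exact (pow_one _).ge
    | succ n ih =>
      rw [us, pow_succ]
      exact (norm_mul_le _ _).trans (by gcongr)
  have h3 : Filter.Tendsto u Filter.atTop (nhds 0) := by
    refine squeeze_zero_norm h2 ?_
    exact (tendsto_pow_atTop_nhds_zero_of_lt_one (norm_nonneg _) hlt).comp
      (Filter.tendsto_add_atTop_nat 1)
  have h4 : Filter.Tendsto (fun n => p - u n) Filter.atTop (nhds p) := by
    simpa using h3.const_sub p
  exact hI.mem_of_tendsto h4 (Filter.Eventually.of_forall h1)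

namespace IsAmple

variable (hΓ : Γ.IsAmple) (h : Γ.LocallyInjective)
include hΓ

theorem exists_compact_open (x : X) (U : Set X) (hU : IsOpen U) (hx : x ∈ U) :
    ∃ W ⊆ U, x ∈ W ∧ IsCompact W ∧ IsOpen W := by
  obtain ⟨V, hVU, hxV, hVc, hVo, -, -⟩ := hΓ.exists_bisection (Γ.one x) (Γ.rng ⁻¹' U)
    (hU.preimage hΓ.continuous_rng) (by simpa [Γ.rng_one] using hx)
  refine ⟨Γ.rng '' V, ?_, ⟨_, hxV, Γ.rng_one x⟩, hVc.image hΓ.continuous_rng,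
    hΓ.isOpenMap_rng _ hVo⟩
  rintro _ ⟨γ, hγ, rfl⟩
  exact hVU hγ

variable [T2Space X] [T2Space G]

omit [T2Space X] in
theorem emb_unitInd_mul_self {W : Set X} (hc : IsCompact W) (ho : IsOpen W) :
    emb h (hΓ.unitInd hc ho) * emb h (hΓ.unitInd hc ho) = emb h (hΓ.unitInd hc ho) := by
  classical
  refine emb_mul (funext fun γ => ?_)
  rw [conv_unitInd_left, unitInd_apply]
  by_cases hγ : γ ∈ Γ.one '' W
  · obtain ⟨x, hx, rfl⟩ := hγ
    rw [Γ.rng_one, if_pos hx]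
  · rw [if_neg hγ, ite_self]

omit [T2Space X] in
theorem norm_emb_unitInd_le {W : Set X} (hc : IsCompact W) (ho : IsOpen W) :
    ‖emb h (hΓ.unitInd hc ho)‖ ≤ 1 := by
  classical
  refine norm_emb_le_of_units zero_le_one (fun γ => ?_) (fun γ hγ => ?_)
  · rw [unitInd_apply]; split_ifs <;> simp
  · rw [unitInd_apply, if_neg]
    rintro ⟨x, -, rfl⟩
    exact hγ ⟨x, rfl⟩

omit [T2Space G] in
/-- If an arrow set is compact and has no arrow from `x` to itself, then it has none from `W` to
`W`, for some neighbourhood `W` of `x`. -/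
theorem exists_separating {K : Set G} (hK : IsCompact K) (x : X)
    (hx : ∀ γ ∈ K, ¬ (Γ.rng γ = x ∧ Γ.src γ = x)) :
    ∃ U : Set X, IsOpen U ∧ x ∈ U ∧ ∀ γ ∈ K, ¬ (Γ.rng γ ∈ U ∧ Γ.src γ ∈ U) := by
  have hcl := (hK.image (hΓ.continuous_rng.prodMk hΓ.continuous_src)).isClosed
  obtain ⟨u, v, hu, hv, hxu, hxv, huv⟩ := isOpen_prod_iff.1 hcl.isOpen_compl x x (by
    rintro ⟨γ, hγ, e⟩
    exact hx γ hγ ⟨congrArg Prod.fst e, congrArg Prod.snd e⟩)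
  refine ⟨u ∩ v, hu.inter hv, ⟨hxu, hxv⟩, fun γ hγ hm => ?_⟩
  exact huv (Set.mk_mem_prod hm.1.1 hm.2.2) ⟨γ, hγ, rfl⟩

/-- Values of functions at units survive in the quotient by an ideal that contains no indicator
function of a nonempty set of units. -/
theorem norm_apply_one_le (hfree : Γ.IsTopologicallyFree) (I : TwoSidedIdeal (fullCStar h))
    (hI : IsClosed (I : Set (fullCStar h)))
    (hne : ∀ (W : Set X) (hc : IsCompact W) (ho : IsOpen W), W.Nonempty →
      emb h (hΓ.unitInd hc ho) ∉ I)
    (f : C_c(G, ℂ)) (y : fullCStar h) (hy : y ∈ I) (x : X) :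
    ‖f (Γ.one x)‖ ≤ ‖emb h f - y‖ := by
  classical
  by_contra! hlt
  have hfc : Continuous fun x => f (Γ.one x) := f.continuous.comp hΓ.continuous_one
  -- The assumed inequality is an open condition on `x`, so it also holds at some point with trivial
  -- isotropy.
  obtain ⟨x₁, hx₁, hiso⟩ := hfree.inter_open_nonempty {x | ‖emb h f - y‖ < ‖f (Γ.one x)‖}
    (isOpen_lt continuous_const hfc.norm) ⟨x, hlt⟩
  change ‖emb h f - y‖ < ‖f (Γ.one x₁)‖ at hx₁
  change Γ.HasTrivialIsotropy x₁ at hiso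
  set v := f (Γ.one x₁) with hv
  have hv0 : 0 < ‖v‖ := (norm_nonneg _).trans_lt hx₁
  set ε := (‖v‖ - ‖emb h f - y‖) / 2 with hε
  have hε0 : 0 < ε := by rw [hε]; linarith
  -- This compact set contains no arrow from `x₁` to itself. For a small neighbourhood `W` of `x₁`,
  -- therefore, `1_W f 1_W` lives on units, where it is within `ε` of `v 1_W`.
  have hK : IsCompact (tsupport f \ Set.range Γ.one) :=
    f.hasCompactSupport.isCompact.diff hΓ.isOpen_units
  obtain ⟨U, hU, hxU, hsep⟩ := hΓ.exists_separating hK x₁ (by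
    rintro γ ⟨-, hγ⟩ ⟨h1, h2⟩
    exact hγ ⟨x₁, (hiso γ h1 h2).symm⟩)
  obtain ⟨W, hWU, hxW, hWc, hWo⟩ := hΓ.exists_compact_open x₁
    (U ∩ {x | ‖f (Γ.one x) - v‖ < ε}) (hU.inter (isOpen_lt (hfc.sub continuous_const).norm
      continuous_const)) ⟨hxU, by simpa [hv] using hε0⟩
  apply hne W hWc hWo ⟨x₁, hxW⟩
  set u := hΓ.unitInd hWc hWo with hu
  set p := emb h u with hp
  have hpp : p * p = p := hΓ.emb_unitInd_mul_self h hWc hWo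
  have hp1 : ‖p‖ ≤ 1 := hΓ.norm_emb_unitInd_le h hWc hWo
  have hk : p * emb h f * p = emb h (hΓ.convC (hΓ.convC u f) u) := by
    rw [hp, emb_mul (hΓ.coe_convC u f), emb_mul (hΓ.coe_convC _ u)]
  have hd : ‖p * emb h f * p - v • p‖ ≤ ε := by
    rw [hk, hp, ← emb_smul, ← emb_sub]
    have hval : ∀ γ, (hΓ.convC (hΓ.convC u f) u - v • u) γ =
        if γ ∈ Γ.one '' W then f γ - v else 0 := by
      intro γ
      rw [CompactlySupportedContinuousMap.sub_apply, CompactlySupportedContinuousMap.smul_apply,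
        hΓ.coe_convC, hu, conv_unitInd_right, ← hu, hΓ.coe_convC, hu, conv_unitInd_left,
        unitInd_apply]
      by_cases hγ : γ ∈ Γ.one '' W
      · obtain ⟨x, hx, rfl⟩ := hγ
        have hm : Γ.one x ∈ Γ.one '' W := ⟨x, hx, rfl⟩
        simp only [if_pos hm, Γ.rng_one, Γ.src_one, if_pos hx, smul_eq_mul, _root_.mul_one]
      · rw [if_neg hγ, if_neg hγ, smul_zero, sub_zero]
        split_ifs with h1 h2
        · by_contra h0
          refine hsep γ ⟨subset_tsupport _ h0, ?_⟩ ⟨(hWU h2).1, (hWU h1).1⟩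
          rintro ⟨x, rfl⟩
          rw [Γ.rng_one] at h2
          exact hγ ⟨x, h2, rfl⟩
        · rfl
        · rfl
    refine norm_emb_le_of_units hε0.le (fun γ => ?_) (fun γ hγ => ?_)
    · rw [hval]
      split_ifs with h1
      · obtain ⟨x, hx, rfl⟩ := h1
        exact (hWU hx).2.le
      · simpa using hε0.le
    · rw [hval, if_neg]
      rintro ⟨x, -, rfl⟩
      exact hγ ⟨x, rfl⟩
  have hδ : ‖p * emb h f * p - p * y * p‖ ≤ ‖emb h f - y‖ := by
    rw [← sub_mul, ← mul_sub]
    calc _ ≤ ‖p‖ * ‖emb h f - y‖ * ‖p‖ := (norm_mul_le _ _).trans (by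
            gcongr; exact norm_mul_le _ _)
      _ ≤ 1 * ‖emb h f - y‖ * 1 := by gcongr
      _ = _ := by ring
  have hy' : v⁻¹ • (p * y * p) ∈ I := by
    rw [← smul_mul_assoc, ← smul_mul_assoc]
    exact I.mul_mem_right _ _ (I.mul_mem_left _ _ hy)
  -- The choice of `ε` gives `ε + ‖f - y‖ < ‖v‖`, so `p = 1_W` is at distance less than one from
  -- `v⁻¹ p y p`, an element of `I`.
  refine mem_of_norm_sub_lt_one I hI hpp hy' ?_
  have hv' : v ≠ 0 := norm_pos_iff.1 hv0
  have e : p - v⁻¹ • (p * y * p) = v⁻¹ • (v • p - p * y * p) := by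
    rw [smul_sub, smul_smul, inv_mul_cancel₀ hv', one_smul]
  have h1 : ‖v • p - p * y * p‖ ≤ ε + ‖emb h f - y‖ := by
    have : v • p - p * y * p = (p * emb h f * p - p * y * p) - (p * emb h f * p - v • p) := by abel
    rw [this]
    exact (norm_sub_le _ _).trans (by linarith)
  rw [e, norm_smul, norm_inv, inv_mul_lt_iff₀ hv0]
  refine h1.trans_lt ?_
  rw [hε]; linarith

end IsAmple

omit [TopologicalSpace X] in
theorem coord_eq_inner (h : Γ.LocallyInjective) (ξ : (regRep h).H) (γ : G) :
    coord h ξ γ = inner ℂ (basisVec h γ) ξ := by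
  classical
  have := lp.inner_single_left (𝕜 := ℂ) γ (1 : ℂ) (@id (SchurTest.L2 G) ξ)
  refine Eq.trans ?_ this.symm
  simp [coord]

end ArrowGroupoid

/-! ### The simplicity criterion. -/

namespace ArrowGroupoid

variable {X : Type u} {G : Type v} [TopologicalSpace X] [TopologicalSpace G] {Γ : ArrowGroupoid X G}

namespace IsAmple

variable (hΓ : Γ.IsAmple) (h : Γ.LocallyInjective) [T2Space X] [T2Space G]
include hΓ

/-- The diagonal entries at units depend only on values at units, which by `norm_apply_one_le`
vanish on `I`. Since `c` is zero on units, the twist does not affect them. -/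
theorem evTwist_regRep_eq_zero {c : G → ℤ} (hc : Γ.IsCocycle c) (hfree : Γ.IsTopologicallyFree)
    (I : TwoSidedIdeal (fullCStar h)) (hI : IsClosed (I : Set (fullCStar h)))
    (hne : ∀ (W : Set X) (hc : IsCompact W) (ho : IsOpen W), W.Nonempty →
      emb h (hΓ.unitInd hc ho) ∉ I)
    {y : fullCStar h} (hy : y ∈ I) (z : Circle) : hc.evTwist h (regRep h) z y = 0 := by
  classical
  have hco : ∀ (f : C_c(G, ℂ)) (γ : G) (x : X),
      coord h (hc.evTwist h (regRep h) z (emb h f) (basisVec h (Γ.one x))) γ =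
        if Γ.src γ = x then hc.char z γ * f γ else 0 := by
    intro f γ x
    rw [hc.evTwist_emb, coord_regRep_map]
    split_ifs with e
    · rw [regKer_one _ _ _ e, weight_apply]
    · rw [regKer, dif_neg (by rwa [Γ.src_one])]
  have h1 : ∀ w ∈ I, ∀ x : X,
      coord h (hc.evTwist h (regRep h) z w (basisVec h (Γ.one x))) (Γ.one x) = 0 := by
    intro w hw x
    rw [← norm_le_zero_iff]
    refine le_of_forall_pos_le_add fun ε hε => ?_
    obtain ⟨f, hf⟩ := exists_emb_near hΓ w (half_pos hε)
    have h2 := hΓ.norm_apply_one_le h hfree I hI hne f w hw x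
    have h3 := hco f (Γ.one x) x
    rw [if_pos (Γ.src_one x), hc.char_apply, hc.map_one, zpow_zero, Circle.coe_one,
      _root_.one_mul] at h3
    have h4 : ‖coord h (hc.evTwist h (regRep h) z w (basisVec h (Γ.one x))) (Γ.one x) -
        f (Γ.one x)‖ ≤ ‖w - emb h f‖ := by
      rw [← h3]
      have h5 := norm_coord_le h (hc.evTwist h (regRep h) z (w - emb h f) (basisVec h (Γ.one x)))
        (Γ.one x)
      refine h5.trans ((ContinuousLinearMap.le_opNorm _ _).trans ?_)
      rw [norm_basisVec, _root_.mul_one]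
      exact hc.norm_evTwist_le h _ _ _
    rw [norm_sub_rev] at h2
    have h6 := norm_sub_norm_le
      (coord h (hc.evTwist h (regRep h) z w (basisVec h (Γ.one x))) (Γ.one x)) (f (Γ.one x))
    linarith
  -- The diagonal entry of `w^* w` at `x` is the squared norm of the image under `w` of the basis
  -- vector at `x`.
  have h2 : ∀ w ∈ I, ∀ x : X, hc.evTwist h (regRep h) z w (basisVec h (Γ.one x)) = 0 := by
    intro w hw x
    have h3 := h1 (star w * w) (I.mul_mem_left _ _ hw) x
    rw [coord_eq_inner, hc.evTwist_mul, hc.evTwist_star] at h3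
    change inner ℂ _ ((star (hc.evTwist h (regRep h) z w))
      (hc.evTwist h (regRep h) z w (basisVec h (Γ.one x)))) = 0 at h3
    rw [ContinuousLinearMap.star_eq_adjoint, ContinuousLinearMap.adjoint_inner_right,
      inner_self_eq_zero] at h3
    exact h3
  refine ext_basisVec h fun γ => ?_
  obtain ⟨V, -, hγV, hVc, hVo, hVr, hVs⟩ := hΓ.exists_bisection γ _ isOpen_univ trivial
  have h3 := h2 (y * emb h (ind V hVc hVo)) (I.mul_mem_right _ _ hy) (Γ.src γ)
  -- The indicator function of a bisection through `γ` carries the basis vector at the unit `s(γ)`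
  -- to a unimodular multiple of the one at `γ`, so the vanishing passes from units to all arrows.
  have h4 : hc.evTwist h (regRep h) z (emb h (ind V hVc hVo)) (basisVec h (Γ.one (Γ.src γ))) =
      hc.char z γ • basisVec h γ := by
    refine coord_ext h fun ζ => ?_
    rw [hco]
    change _ = hc.char z γ * coord h (basisVec h γ) ζ
    by_cases hζ : ζ = γ
    · subst hζ
      rw [if_pos rfl, coord_basisVec, ind_apply, if_pos hγV]
    · rw [coord_basisVec_ne h hζ, mul_zero, ind_apply]
      split_ifs with e1 e2
      · exact absurd (hVs e2 hγV e1) hζ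
      · rw [mul_zero]
      · rfl
  rw [hc.evTwist_mul] at h3
  change hc.evTwist h (regRep h) z y (hc.evTwist h (regRep h) z (emb h (ind V hVc hVo))
    (basisVec h (Γ.one (Γ.src γ)))) = 0 at h3
  rw [h4, map_smul, smul_eq_zero] at h3
  rcases h3 with h3 | h3
  · exact absurd h3 (Circle.coe_ne_zero _)
  · rw [h3]; rfl

omit [T2Space X] in
theorem unitInd_mem_mono (I : TwoSidedIdeal (fullCStar h)) {W W' : Set X} (hc : IsCompact W)
    (ho : IsOpen W) (hc' : IsCompact W') (ho' : IsOpen W') (hW : W' ⊆ W)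
    (hI : emb h (hΓ.unitInd hc ho) ∈ I) : emb h (hΓ.unitInd hc' ho') ∈ I := by
  classical
  have : emb h (hΓ.unitInd hc ho) * emb h (hΓ.unitInd hc' ho') = emb h (hΓ.unitInd hc' ho') := by
    refine emb_mul (funext fun γ => ?_)
    rw [conv_unitInd_left, unitInd_apply]
    by_cases hγ : γ ∈ Γ.one '' W'
    · obtain ⟨x, hx, rfl⟩ := hγ
      rw [Γ.rng_one, if_pos (hW hx)]
    · rw [if_neg hγ, ite_self]
  rw [← this]
  exact I.mul_mem_right _ _ hI

/-- `1_(W ∪ W') = 1_W + 1_(W' \ W)`, and the last term is a multiple of `1_W'`. -/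
theorem unitInd_mem_union (I : TwoSidedIdeal (fullCStar h)) {W W' : Set X} (hc : IsCompact W)
    (ho : IsOpen W) (hc' : IsCompact W') (ho' : IsOpen W')
    (hI : emb h (hΓ.unitInd hc ho) ∈ I) (hI' : emb h (hΓ.unitInd hc' ho') ∈ I) :
    emb h (hΓ.unitInd (hc.union hc') (ho.union ho')) ∈ I := by
  classical
  have hdc : IsCompact (W' \ W) := hc'.diff ho
  have hdo : IsOpen (W' \ W) := ho'.sdiff hc.isClosed
  have hd := hΓ.unitInd_mem_mono h I hc' ho' hdc hdo Set.sdiff_subset hI'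
  have e : hΓ.unitInd (hc.union hc') (ho.union ho') = hΓ.unitInd hc ho + hΓ.unitInd hdc hdo := by
    ext γ
    rw [CompactlySupportedContinuousMap.add_apply, unitInd_apply, unitInd_apply, unitInd_apply]
    by_cases hγ : γ ∈ Set.range Γ.one
    · obtain ⟨x, rfl⟩ := hγ
      have hinj : Function.Injective Γ.one := fun a b e => by
        rw [← Γ.rng_one a, e, Γ.rng_one]
      simp only [hinj.mem_set_image, Set.mem_union, Set.mem_sdiff]
      by_cases h1 : x ∈ W <;> by_cases h2 : x ∈ W' <;> simp [h1, h2]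
    · have hn : ∀ S : Set X, γ ∉ Γ.one '' S := fun S hS => hγ (Set.image_subset_range _ _ hS)
      simp only [if_neg (hn _), add_zero]
  rw [e, emb_add]
  exact I.add_mem hI hd

omit [T2Space X] in
-- `1_V = 1_V 1_U` lies in the ideal, and `1_(r(V)) = 1_V 1_V^*`.
theorem unitInd_rng_mem (I : TwoSidedIdeal (fullCStar h)) {U : Set X} (hc : IsCompact U)
    (ho : IsOpen U) (hI : emb h (hΓ.unitInd hc ho) ∈ I) {V : Set G} (hV : Γ.IsBisection V)
    (hVU : ∀ γ ∈ V, Γ.src γ ∈ U) :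
    emb h (hΓ.unitInd (hV.isCompact.image hΓ.continuous_rng) (hΓ.isOpenMap_rng _ hV.isOpen)) ∈
      I := by
  classical
  set f := ind V hV.isCompact hV.isOpen with hf
  have h1 : emb h f * emb h (hΓ.unitInd hc ho) = emb h f := by
    refine emb_mul (funext fun γ => ?_)
    rw [conv_unitInd_right, hf, ind_apply]
    by_cases hγ : γ ∈ V
    · rw [if_pos (hVU γ hγ)]
    · rw [if_neg hγ, ite_self]
  have h2 : emb h f * emb h (hΓ.involC f) =
      emb h (hΓ.unitInd (hV.isCompact.image hΓ.continuous_rng)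
        (hΓ.isOpenMap_rng _ hV.isOpen)) := by
    refine emb_mul (funext fun γ => ?_)
    have h0 : ∀ γ, γ ∉ V → f γ = 0 := fun γ hγ => by rw [hf, ind_apply, if_neg hγ]
    rw [unitInd_apply]
    by_cases hγ : Γ.rng γ ∈ Γ.rng '' V
    · obtain ⟨η, hη, e⟩ := hγ
      rw [conv_of_mem _ _ hV.injOn_rng h0 hη e, involC_apply, hf, ind_apply, if_pos hη,
        _root_.one_mul, ind_apply]
      by_cases hu : γ ∈ Γ.one '' (Γ.rng '' V)
      · obtain ⟨x, hx, rfl⟩ := hu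
        have e1 : Γ.ldiv η (Γ.one x) e = Γ.inv η :=
          Γ.mul_one' (by rw [Γ.src_inv, e, Γ.rng_one]) _
        rw [if_pos ⟨x, hx, rfl⟩, e1, Γ.inv_inv, if_pos hη, star_one]
      · rw [if_neg hu, if_neg, star_zero]
        intro hm
        have hs : Γ.src (Γ.inv (Γ.ldiv η γ e)) = Γ.src η := by
          rw [Γ.src_inv, Γ.rng_ldiv]
        have e2 := hV.injOn_src hm hη hs
        have e3 : Γ.ldiv η γ e = Γ.inv η :=
          (Γ.inv_inv _).symm.trans (congrArg Γ.inv e2)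
        have e4 := Γ.mul_ldiv η γ e
        have e5 : γ = Γ.one (Γ.rng η) := by
          rw [← e4, ← Γ.mul_inv η]
          exact Γ.mul_congr rfl e3 _ _
        exact hu ⟨_, ⟨η, hη, rfl⟩, e5.symm⟩
    · rw [conv_of_notMem _ _ h0 hγ, if_neg]
      rintro ⟨x, hx, rfl⟩
      rw [Γ.rng_one] at hγ
      exact hγ hx
  rw [← h2, ← h1]
  exact I.mul_mem_right _ _ (I.mul_mem_left _ _ hI)

variable [CompactSpace X]

theorem one_mul_eq (a : fullCStar h) : emb h (hΓ.unitInd isCompact_univ isOpen_univ) * a = a := by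
  classical
  set e := emb h (hΓ.unitInd isCompact_univ isOpen_univ) with he
  have hf : ∀ f : C_c(G, ℂ), e * emb h f = emb h f := fun f =>
    emb_mul (funext fun γ => by rw [conv_unitInd_left, if_pos (Set.mem_univ _)])
  rw [← sub_eq_zero, ← norm_le_zero_iff]
  refine le_of_forall_pos_le_add fun ε hε => ?_
  obtain ⟨f, hfa⟩ := exists_emb_near hΓ a (half_pos hε)
  have h1 : e * a - a = e * (a - emb h f) - (a - emb h f) := by rw [mul_sub, hf]; abel
  have h2 : ‖e * (a - emb h f)‖ ≤ 1 * ‖a - emb h f‖ :=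
    (norm_mul_le _ _).trans (by gcongr; exact hΓ.norm_emb_unitInd_le h _ _)
  have h3 := norm_sub_le (e * (a - emb h f)) (a - emb h f)
  rw [h1]
  linarith

/-- The orbit of each point meets `U`, so a bisection carries a part of `U` onto a neighbourhood of
that point. Finitely many such neighbourhoods cover the unit space, and its indicator function is an
identity. -/
theorem eq_top_of_unitInd_mem (hmin : Γ.IsMinimal) (I : TwoSidedIdeal (fullCStar h)) {U : Set X}
    (hc : IsCompact U) (ho : IsOpen U) (hU : U.Nonempty) (hI : emb h (hΓ.unitInd hc ho) ∈ I) :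
    I = ⊤ := by
  have key : ∃ (W : Set X) (hc : IsCompact W) (ho : IsOpen W), Set.univ ⊆ W ∧
      emb h (hΓ.unitInd hc ho) ∈ I := by
    refine isCompact_univ.induction_on (p := fun S => ∃ (W : Set X) (hc : IsCompact W)
      (ho : IsOpen W), S ⊆ W ∧ emb h (hΓ.unitInd hc ho) ∈ I) ?_ ?_ ?_ ?_
    · exact ⟨U, hc, ho, Set.empty_subset _, hI⟩
    · rintro S T hST ⟨W, hc, ho, hW, hI⟩
      exact ⟨W, hc, ho, hST.trans hW, hI⟩
    · rintro S T ⟨W, hc, ho, hW, hI⟩ ⟨W', hc', ho', hW', hI'⟩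
      exact ⟨W ∪ W', hc.union hc', ho.union ho', Set.union_subset_union hW hW',
        hΓ.unitInd_mem_union h I hc ho hc' ho' hI hI'⟩
    · intro x _
      obtain ⟨y, hy, γ, hsγ, hrγ⟩ := (hmin x).inter_open_nonempty U ho hU
      obtain ⟨V, hVU, hγV, hVc, hVo, hVr, hVs⟩ := hΓ.exists_bisection (Γ.inv γ) (Γ.src ⁻¹' U)
        (ho.preimage hΓ.continuous_src) (by
          change Γ.src (Γ.inv γ) ∈ U
          rw [Γ.src_inv, hrγ]; exact hy)
      refine ⟨Γ.rng '' V, ?_, Γ.rng '' V, hVc.image hΓ.continuous_rng, hΓ.isOpenMap_rng _ hVo,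
        subset_rfl, hΓ.unitInd_rng_mem h I hc ho hI ⟨hVc, hVo, hVr, hVs⟩ hVU⟩
      refine mem_nhdsWithin_of_mem_nhds ((hΓ.isOpenMap_rng _ hVo).mem_nhds ⟨_, hγV, ?_⟩)
      rw [Γ.rng_inv, hsγ]
  obtain ⟨W, hWc, hWo, hW, hWI⟩ := key
  have h1 := hΓ.unitInd_mem_mono h I hWc hWo isCompact_univ isOpen_univ hW hWI
  rw [eq_top_iff]
  intro a _
  rw [← hΓ.one_mul_eq h a]
  exact I.mul_mem_right _ _ h1

/-- The full C*-algebra of a minimal, topologically free ample groupoid over a compact space, with a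
cocycle to the integers whose kernel is exhausted by compact subgroupoids, is simple. -/
theorem isSimpleCStar [Nonempty X] {c : G → ℤ} (hc : Γ.IsCocycle c)
    (hker : ∀ f : C_c(G, ℂ), (∀ γ, c γ ≠ 0 → f γ = 0) → ∀ π : Γ.Rep,
      ‖π.map f‖ ≤ ‖(regRep h).map f‖)
    (hfree : Γ.IsTopologicallyFree) (hmin : Γ.IsMinimal) : IsSimpleCStar (fullCStar h) := by
  classical
  constructor
  · obtain ⟨x⟩ := ‹Nonempty X›
    refine ⟨⟨emb h (hΓ.unitInd isCompact_univ isOpen_univ), 0, fun e => ?_⟩⟩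
    have h1 := norm_apply_le_regRep (h := h) (hΓ.unitInd isCompact_univ isOpen_univ) (Γ.one x)
    have h2 : (regRep h).map (hΓ.unitInd isCompact_univ isOpen_univ) = 0 :=
      congrArg (ev h (regRep h)) e
    rw [h2, norm_zero, unitInd_apply, if_pos ⟨x, trivial, rfl⟩, norm_one] at h1
    linarith
  · intro I hI
    by_cases hex : ∃ (W : Set X) (hc : IsCompact W) (ho : IsOpen W), W.Nonempty ∧
        emb h (hΓ.unitInd hc ho) ∈ I
    · obtain ⟨W, hWc, hWo, hW, hWI⟩ := hex
      exact Or.inr (hΓ.eq_top_of_unitInd_mem h hmin I hWc hWo hW hWI)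
    · left
      rw [eq_bot_iff]
      intro y hy
      rw [hc.eq_zero_of_evTwist_regRep h hΓ hker y fun z =>
        hΓ.evTwist_regRep_eq_zero h hc hfree I hI
          (fun W hWc hWo hW hm => hex ⟨W, hWc, hWo, hW, hm⟩) hy z]
      exact TwoSidedIdeal.zero_mem _

end IsAmple

end ArrowGroupoid

/-! ### Degrees and joins of normal forms. -/

namespace NormalForm

/-- The number of edges `α`. -/
def numA : NormalForm → ℕ
  | block m _ => m
  | cons m _ _ t => m + t.numA

/-- The number of edges `β` and `γ`. -/
def numO : NormalForm → ℕ
  | block _ n => n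
  | cons _ n _ t => n + 1 + t.numO

theorem numA_add_numO (a : NormalForm) : a.numA + a.numO = a.length := by
  induction a with
  | block m n => rfl
  | cons m n j t ih => simp only [numA, numO, length]; omega

theorem numA_mul (a b : NormalForm) : (a.mul b).numA = a.numA + b.numA := by
  induction a with
  | block m n => cases b <;> simp only [mul, numA] <;> omega
  | cons m n j t ih => simp only [mul, numA, ih]; omega

theorem numO_mul (a b : NormalForm) : (a.mul b).numO = a.numO + b.numO := by
  induction a with
  | block m n => cases b <;> simp only [mul, numO] <;> omega
  | cons m n j t ih => simp only [mul, numO, ih]; omega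

/-- Two prefixes of the same element have a join, and the degree of the join is the join of the
degrees. -/
theorem exists_join (p q a b : NormalForm) (h : p.mul a = q.mul b) :
    ∃ s t r, p.mul s = q.mul t ∧ a = s.mul r ∧ b = t.mul r ∧
      (p.mul s).numA = max p.numA q.numA ∧ (p.mul s).numO = max p.numO q.numO := by
  induction p generalizing q with
  | block m n =>
    cases q with
    | block m' n' =>
      cases a with
      | block x y =>
        cases b with
        | block x' y' =>
          simp only [mul, block.injEq] at h
          -- Inside `Λ₁` the join of `α^m β^n` and `α^m' β^n'` has the maximal exponents.
          refine ⟨block (max m m' - m) (max n n' - n), block (max m m' - m') (max n n' - n'),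
            block (m + x - max m m') (n + y - max n n'), ?_⟩
          simp only [mul, block.injEq, numA, numO]
          omega
        | cons x' y' j t => simp [mul] at h
      | cons x y j t =>
        cases b with
        | block x' y' => simp [mul] at h
        | cons x' y' j' t' =>
          simp only [mul, cons.injEq] at h
          refine ⟨block (max m m' - m) (max n n' - n), block (max m m' - m') (max n n' - n'),
            cons (m + x - max m m') (n + y - max n n') j t, ?_⟩
          obtain ⟨h1, h2, rfl, rfl⟩ := h
          simp only [mul, block.injEq, cons.injEq, numA, numO, and_true]
          omega
    | cons m' n' j t =>
      cases a with
      | block x y => simp [mul] at h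
      | cons x y j' t' =>
        simp only [mul, cons.injEq] at h
        obtain ⟨h1, h2, rfl, rfl⟩ := h
        -- The first `γ` of `q` fixes where the initial block ends, so the block `p` is a prefix of
        -- `q`, and `q` is the join.
        refine ⟨cons (m' - m) (n' - n) j' t, block 0 0, b, ?_⟩
        simp only [mul, cons.injEq, numA, numO, mul_one, one_mul, and_true, true_and]
        omega
  | cons m n j t ih =>
    cases q with
    | block m' n' =>
      cases b with
      | block x y => simp [mul] at h
      | cons x y j' t' =>
        simp only [mul, cons.injEq] at h
        obtain ⟨h1, h2, rfl, rfl⟩ := h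
        refine ⟨block 0 0, cons (m - m') (n - n') j t, a, ?_⟩
        simp only [mul, cons.injEq, numA, numO, mul_one, one_mul, and_true, true_and]
        omega
    | cons m' n' j' t' =>
      simp only [mul, cons.injEq] at h
      obtain ⟨rfl, rfl, rfl, h⟩ := h
      obtain ⟨s, r, z, h1, h2, h3, h4, h5⟩ := ih t' h
      refine ⟨s, r, z, by simp only [mul, h1], h2, h3, ?_, ?_⟩
      · simp only [mul, numA, h4]; omega
      · simp only [mul, numO, h5]; omega

/-- A prefix is determined by its degree. -/
theorem eq_of_degree {p q a b : NormalForm} (h : p.mul a = q.mul b) (hA : p.numA = q.numA)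
    (hO : p.numO = q.numO) : p = q := by
  obtain ⟨s, t, r, h1, -, -, h4, h5⟩ := exists_join p q a b h
  have hs := numA_add_numO s
  have ht := numA_add_numO t
  have h6 := congrArg numA h1
  have h7 := congrArg numO h1
  rw [numA_mul, numA_mul] at h6
  rw [numO_mul, numO_mul] at h7
  rw [numA_mul] at h4
  rw [numO_mul] at h5
  -- The join has the common degree of `p` and `q`, so both complements have length zero.
  rw [eq_one_of_length s (by omega), eq_one_of_length t (by omega), mul_one, mul_one] at h1
  exact h1

theorem exists_factor (w : NormalForm) (n : ℕ) (h : n ≤ w.length) :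
    ∃ p s, w = mul p s ∧ p.length = n := by
  induction w generalizing n with
  | block x y =>
    simp only [length] at h
    refine ⟨block (min n x) (n - min n x), block (x - min n x) (y - (n - min n x)), ?_, ?_⟩
    · simp only [mul, block.injEq]; omega
    · simp only [length]; omega
  | cons x y j t ih =>
    simp only [length] at h
    by_cases h1 : n ≤ x + y
    · refine ⟨block (min n x) (n - min n x), cons (x - min n x) (y - (n - min n x)) j t, ?_, ?_⟩
      · simp only [mul, cons.injEq, and_true]; omega
      · simp only [length]; omega
    · obtain ⟨p, s, h2, h3⟩ := ih (n - (x + y + 1)) (by omega)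
      exact ⟨cons x y j p, s, by rw [mul, ← h2], by simp only [length]; omega⟩

theorem finite_length_le (k : ℕ → ℕ) (n i : ℕ) : {w | Valid k i w ∧ length w ≤ n}.Finite := by
  induction n using Nat.strong_induction_on generalizing i with
  | _ n ih =>
    have hb : (Set.image2 block (Set.Iic n) (Set.Iic n)).Finite :=
      (Set.finite_Iic n).image2 _ (Set.finite_Iic n)
    have hc : (⋃ x ∈ Set.Iio n, ⋃ y ∈ Set.Iio n, ⋃ j ∈ Set.Iio (k (i + (x + y))),
        cons x y j '' {w | Valid k (i + (x + y + 1)) w ∧ length w ≤ n - 1}).Finite := by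
      refine (Set.finite_Iio n).biUnion fun x hx => (Set.finite_Iio n).biUnion fun y _ =>
        (Set.finite_Iio _).biUnion fun j _ => (ih (n - 1) ?_ _).image _
      have : x < n := hx
      omega
    refine (hb.union hc).subset ?_
    rintro (⟨x, y⟩ | ⟨x, y, j, t⟩) ⟨hv, hl⟩
    · simp only [length] at hl
      exact Or.inl ⟨x, by simp; omega, y, by simp; omega, rfl⟩
    · simp only [length] at hl
      obtain ⟨h1, h2⟩ := hv
      refine Or.inr ?_
      simp only [Set.mem_iUnion]
      exact ⟨x, by simp; omega, y, by simp; omega, j, h1, t, ⟨h2, by omega⟩, rfl⟩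

end NormalForm

/-! ### Degrees and joins in `Λ`. -/

namespace Vertex

open PathCat

variable {k : ℕ → ℕ}

/-- The element of `Λ` with a given normal form. -/
def ofNF {a b : Vertex k} (w : NormalForm) (hv : w.Valid k a.level)
    (hl : a.level + w.length = b.level) : a ⟶ b := ⟨w, hv, hl⟩

theorem nf_id (a : Vertex k) : nf (𝟙 a) = NormalForm.block 0 0 := rfl

/-- The number of edges `α`. -/
def numA {a b : Vertex k} (f : a ⟶ b) : ℕ := (nf f).numA

/-- The number of edges `β` and `γ`. -/
def numO {a b : Vertex k} (f : a ⟶ b) : ℕ := (nf f).numO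

theorem numA_comp {a b c : Vertex k} (f : a ⟶ b) (g : b ⟶ c) :
    numA (f ≫ g) = numA f + numA g := NormalForm.numA_mul _ _

theorem numO_comp {a b c : Vertex k} (f : a ⟶ b) (g : b ⟶ c) :
    numO (f ≫ g) = numO f + numO g := NormalForm.numO_mul _ _

theorem level_eq {a b : Vertex k} (f : a ⟶ b) : b.level = a.level + (numA f + numO f) := by
  rw [numA, numO, NormalForm.numA_add_numO, level_add]

theorem out_ext {a : Vertex k} {μ ν : Out a} (h : nf μ.2 = nf ν.2) : μ = ν := by
  obtain ⟨⟨b⟩, μ⟩ := μ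
  obtain ⟨⟨c⟩, ν⟩ := ν
  have h1 := level_add μ
  have h2 := level_add ν
  simp only at h h1 h2
  rw [h] at h1
  obtain rfl : b = c := h1.symm.trans h2
  exact Sigma.ext rfl (heq_of_eq (hom_ext h))

theorem isPrefix_iff {a : Vertex k} {μ ν : Out a} :
    IsPrefix μ ν ↔ ∃ z, (nf μ.2).mul z = nf ν.2 := by
  constructor
  · rintro ⟨ζ, hζ⟩
    exact ⟨nf ζ, by rw [← nf_comp, hζ]⟩
  · rintro ⟨z, hz⟩
    have hv := nf_valid ν.2
    have hl := level_add ν.2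
    rw [← hz, NormalForm.valid_mul, level_add] at hv
    rw [← hz, NormalForm.length_mul, ← Nat.add_assoc, level_add] at hl
    exact ⟨ofNF z hv.2 hl, hom_ext hz⟩

theorem exists_join {a b c d : Vertex k} (f : a ⟶ b) (g : a ⟶ c) (f' : b ⟶ d) (g' : c ⟶ d)
    (h : f ≫ f' = g ≫ g') :
    ∃ (e : Vertex k) (s : b ⟶ e) (t : c ⟶ e) (r : e ⟶ d), f ≫ s = g ≫ t ∧ s ≫ r = f' ∧
      t ≫ r = g' ∧ numA (f ≫ s) = max (numA f) (numA g) ∧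
      numO (f ≫ s) = max (numO f) (numO g) := by
  obtain ⟨s, t, r, h1, h2, h3, h4, h5⟩ := NormalForm.exists_join _ _ _ _ (congrArg nf h)
  change nf f' = _ at h2
  change nf g' = _ at h3
  change (nf f).mul s = (nf g).mul t at h1
  have hf := nf_valid f'
  have hg := nf_valid g'
  have lf := level_add f'
  have lg := level_add g'
  have l1 := level_add f
  have l2 := level_add g
  rw [h2, NormalForm.valid_mul] at hf
  rw [h3, NormalForm.valid_mul] at hg
  rw [h2, NormalForm.length_mul, ← Nat.add_assoc] at lf
  rw [h3, NormalForm.length_mul, ← Nat.add_assoc] at lg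
  have l3 := congrArg NormalForm.length h1
  rw [NormalForm.length_mul, NormalForm.length_mul] at l3
  refine ⟨⟨b.level + s.length⟩, ofNF s hf.1 rfl, ofNF t hg.1 ?_, ofNF r hf.2 lf, hom_ext h1,
    hom_ext h2.symm, hom_ext h3.symm, h4, h5⟩
  change c.level + t.length = b.level + s.length
  omega

/-- The common end vertices force equal lengths, so one coordinate of the degree determines the
other. -/
theorem hom_eq_of_degree {a b d : Vertex k} {f g : a ⟶ b} {f' g' : b ⟶ d}
    (h : f ≫ f' = g ≫ g') (hA : numA f = numA g) : f = g := by
  have h1 := level_eq f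
  have h2 := level_eq g
  exact hom_ext (NormalForm.eq_of_degree (congrArg nf h) hA (by
    change numO f = numO g
    omega))

theorem finite_out (a : Vertex k) (n : ℕ) : {μ : Out a | numA μ.2 + numO μ.2 ≤ n}.Finite := by
  refine Set.Finite.of_finite_image (f := fun μ => nf μ.2) ?_ fun μ _ ν _ h => out_ext h
  refine (NormalForm.finite_length_le k n a.level).subset ?_
  rintro _ ⟨μ, hμ, rfl⟩
  exact ⟨nf_valid μ.2, by rw [← NormalForm.numA_add_numO]; exact hμ⟩

theorem exists_prefix {a : Vertex k} (μ : Out a) (n : ℕ) (h : n ≤ numA μ.2 + numO μ.2) :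
    ∃ ν : Out a, IsPrefix ν μ ∧ numA ν.2 + numO ν.2 = n := by
  obtain ⟨p, s, h1, h2⟩ := NormalForm.exists_factor (nf μ.2) n (by
    rw [← NormalForm.numA_add_numO]; exact h)
  have hv := nf_valid μ.2
  rw [h1, NormalForm.valid_mul] at hv
  refine ⟨⟨⟨a.level + p.length⟩, ofNF p hv.1 rfl⟩, isPrefix_iff.2 ⟨s, h1.symm⟩, ?_⟩
  rw [numA, numO, NormalForm.numA_add_numO]
  exact h2

/-- The edge `γ^{(0)}`. -/
def gammaEdge (a : Vertex k) (h : 0 < k a.level) : a ⟶ (⟨a.level + 1⟩ : Vertex k) :=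
  ofNF (NormalForm.cons 0 0 0 (NormalForm.block 0 0)) ⟨h, trivial⟩ rfl

/-- If an element that is not longer than `wγ` has a common extension with `wγ`, then it is a prefix
of `wγ`. -/
theorem isPrefix_of_gammaEdge {a b d : Vertex k} (w : a ⟶ b) (h : 0 < k b.level) (μ : Out a)
    (f : μ.1 ⟶ d) (g : (⟨b.level + 1⟩ : Vertex k) ⟶ d)
    (e : μ.2 ≫ f = (w ≫ gammaEdge b h) ≫ g)
    (hl : numA μ.2 + numO μ.2 ≤ numA w + numO w) : IsPrefix μ ⟨b, w⟩ := by
  -- The final `γ` commutes with nothing, so the initial blocks of `wγ` cannot grow under extension;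
  -- cutting within the length of `w` therefore cuts `w` itself.
  have key : ∀ w p x y : NormalForm, p.mul x =
      (w.mul (NormalForm.cons 0 0 0 (NormalForm.block 0 0))).mul y → p.length ≤ w.length →
        ∃ z, p.mul z = w := by
    intro w
    induction w with
    | block m n =>
      intro p x y hp hlen
      cases p with
      | block m' n' =>
        cases x with
        | block _ _ => simp [NormalForm.mul] at hp
        | cons p q j t =>
          simp only [NormalForm.mul, NormalForm.cons.injEq] at hp
          refine ⟨NormalForm.block (m - m') (n - n'), ?_⟩
          simp only [NormalForm.mul, NormalForm.block.injEq]
          omega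
      | cons m' n' j t =>
        simp only [NormalForm.mul, NormalForm.cons.injEq] at hp
        simp only [NormalForm.length] at hlen
        omega
    | cons m n j t ih =>
      intro p x y hp hlen
      cases p with
      | block m' n' =>
        cases x with
        | block _ _ => simp [NormalForm.mul] at hp
        | cons p q j' t' =>
          simp only [NormalForm.mul, NormalForm.cons.injEq] at hp
          refine ⟨NormalForm.cons (m - m') (n - n') j t, ?_⟩
          simp only [NormalForm.mul, NormalForm.cons.injEq, and_true]
          omega
      | cons m' n' j' t' =>
        simp only [NormalForm.mul, NormalForm.cons.injEq] at hp
        simp only [NormalForm.length] at hlen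
        obtain ⟨rfl, rfl, rfl, hp⟩ := hp
        obtain ⟨z, hz⟩ := ih t' x y hp (by omega)
        exact ⟨z, by rw [NormalForm.mul, hz]⟩
  refine isPrefix_iff.2 (key _ _ (nf f) (nf g) (congrArg nf e) ?_)
  rw [← NormalForm.numA_add_numO, ← NormalForm.numA_add_numO]
  exact hl

end Vertex

/-! ### The topology of `Λ^*` for a general category of paths. -/

namespace PathCat.DirHered

section General

variable {C : Type u} [Category.{v} C] {a : C}

theorem isOpen_cylinder (μ : Out a) : IsOpen (cylinder μ) :=
  TopologicalSpace.isOpen_generateFrom_of_mem ⟨μ, ∅, by simp⟩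

theorem isClosed_cylinder (μ : Out a) : IsClosed (cylinder μ) := by
  rw [← isOpen_compl_iff]
  refine TopologicalSpace.isOpen_generateFrom_of_mem ⟨⟨a, 𝟙 a⟩, {μ}, ?_⟩
  ext x
  simp only [Set.mem_compl_iff, Finset.mem_singleton, Set.iUnion_iUnion_eq_left, Set.mem_sdiff]
  exact ⟨fun h => ⟨x.id_mem, h⟩, fun h => h.2⟩

theorem isClopen_cylinder (μ : Out a) : IsClopen (cylinder μ) :=
  ⟨isClosed_cylinder μ, isOpen_cylinder μ⟩

instance : T2Space (DirHered a) where
  t2 x y hne := by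
    have : ∃ μ, ¬ (μ ∈ x.carrier ↔ μ ∈ y.carrier) := by
      by_contra! h
      exact hne (DirHered.ext (Set.ext h))
    obtain ⟨μ, hμ⟩ := this
    by_cases h : μ ∈ x.carrier
    · refine ⟨cylinder μ, (cylinder μ)ᶜ, isOpen_cylinder μ, (isClosed_cylinder μ).isOpen_compl, h,
        fun h' => hμ ⟨fun _ => h', fun _ => h⟩, disjoint_compl_right⟩
    · refine ⟨(cylinder μ)ᶜ, cylinder μ, (isClosed_cylinder μ).isOpen_compl, isOpen_cylinder μ, h,
        ?_, disjoint_compl_left⟩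
      by_contra h'
      exact hμ ⟨fun e => absurd e h, fun e => absurd e h'⟩

/-- The sets `Z(l) \ (Z(μ₁) ∪ ... ∪ Z(μₖ))` form a base. -/
theorem exists_basic {U : Set (DirHered a)} (hU : IsOpen U) {x : DirHered a} (hx : x ∈ U) :
    ∃ l ∈ x.carrier, ∃ F : Finset (Out a), (∀ μ ∈ F, μ ∉ x.carrier) ∧
      ∀ y : DirHered a, l ∈ y.carrier → (∀ μ ∈ F, μ ∉ y.carrier) → y ∈ U := by
  classical
  induction hU with
  | basic s hs =>
    obtain ⟨l, F, rfl⟩ := hs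
    simp only [Set.mem_sdiff, Set.mem_iUnion, not_exists] at hx
    refine ⟨l, hx.1, F, hx.2, fun y hl hF => ⟨hl, ?_⟩⟩
    simp only [Set.mem_iUnion, not_exists]
    exact fun μ hμ => hF μ hμ
  | univ => exact ⟨_, x.id_mem, ∅, by simp, fun _ _ _ => trivial⟩
  | inter s t _ _ ihs iht =>
    obtain ⟨l, hl, F, hF, h⟩ := ihs hx.1
    obtain ⟨l', hl', F', hF', h'⟩ := iht hx.2
    obtain ⟨n, hn, hp, hp'⟩ := x.directed l hl l' hl'
    refine ⟨n, hn, F ∪ F', ?_, fun y hy hFy => ⟨h y (y.hereditary _ hy _ hp) ?_,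
      h' y (y.hereditary _ hy _ hp') ?_⟩⟩
    · intro μ hμ
      rcases Finset.mem_union.1 hμ with h1 | h1
      exacts [hF μ h1, hF' μ h1]
    · exact fun μ hμ => hFy μ (Finset.mem_union_left _ hμ)
    · exact fun μ hμ => hFy μ (Finset.mem_union_right _ hμ)
  | sUnion S _ ih =>
    obtain ⟨s, hs, hxs⟩ := hx
    obtain ⟨l, hl, F, hF, h⟩ := ih s hs hxs
    exact ⟨l, hl, F, hF, fun y hy hFy => ⟨s, hs, h y hy hFy⟩⟩

theorem mem_act_of_isPrefix {b : C} (μ : a ⟶ b) (x : DirHered b) : (⟨b, μ⟩ : Out a) ∈ (act μ x).carrier :=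
  ⟨⟨b, 𝟙 b⟩, x.id_mem, 𝟙 _, by simp [shift]⟩

variable [IsCategoryOfPaths C]

/-- The image of `Z(l) \ ⋃ Z(ν)` is `Z(μl) \ ⋃ Z(μν)`, since every element of `Z(μ)` has the form
`μz`. -/
theorem isOpenMap_act {b : C} (μ : a ⟶ b) : IsOpenMap (act μ) := by
  classical
  intro U hU
  rw [isOpen_iff_forall_mem_open]
  rintro _ ⟨x, hx, rfl⟩
  obtain ⟨l, hl, F, hF, h⟩ := exists_basic hU hx
  refine ⟨cylinder (shift μ l) \ ⋃ ν ∈ F.image (shift μ), cylinder ν, ?_,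
    TopologicalSpace.isOpen_generateFrom_of_mem ⟨_, _, rfl⟩, ?_, ?_⟩
  · rintro y ⟨hy, hyF⟩
    have h1 : (⟨b, μ⟩ : Out a) ∈ y.carrier := y.hereditary _ hy _ ⟨l.2, rfl⟩
    obtain ⟨z, rfl⟩ := exists_act μ y h1
    refine ⟨z, h z ((shift_mem_act μ z l).1 hy) fun ν hν hνz => hyF ?_, rfl⟩
    simp only [Set.mem_iUnion]
    exact ⟨_, Finset.mem_image_of_mem _ hν, (shift_mem_act μ z ν).2 hνz⟩
  · exact (shift_mem_act μ x l).2 hl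
  · simp only [Set.mem_iUnion, not_exists]
    intro ν hν hm
    obtain ⟨ν', hν', rfl⟩ := Finset.mem_image.1 hν
    exact hF ν' hν' ((shift_mem_act μ x ν').1 hm)

end General

end PathCat.DirHered

/-! ### Continuity of the action and compactness of `Λ^*` at a vertex. -/

namespace Vertex

open PathCat PathCat.DirHered

variable {k : ℕ → ℕ}

theorem exists_join_mem {a : Vertex k} (x : DirHered a) {μ ν : Out a} (hμ : μ ∈ x.carrier)
    (hν : ν ∈ x.carrier) : ∃ (e : Vertex k) (s : μ.1 ⟶ e) (t : ν.1 ⟶ e), μ.2 ≫ s = ν.2 ≫ t ∧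
      (⟨e, μ.2 ≫ s⟩ : Out a) ∈ x.carrier ∧ numA (μ.2 ≫ s) = max (numA μ.2) (numA ν.2) ∧
      numO (μ.2 ≫ s) = max (numO μ.2) (numO ν.2) := by
  obtain ⟨l, hl, ⟨f, hf⟩, ⟨g, hg⟩⟩ := x.directed μ hμ ν hν
  obtain ⟨e, s, t, r, h1, h2, h3, h4, h5⟩ := exists_join _ _ _ _ (hf.trans hg.symm)
  exact ⟨e, s, t, h1, x.hereditary l hl _ ⟨r, by simp only [Category.assoc, h2, hf]⟩, h4, h5⟩

/-- If `l ∈ μy`, the join of `μ` and `l` is `μδ` with `δ ∈ y` no longer than `l`. There are finitely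
many such `δ`. -/
theorem isClopen_preimage_cylinder {a b : Vertex k} (μ : a ⟶ b) (l : Out a) :
    IsClopen (act μ ⁻¹' cylinder l) := by
  have hfin : {δ : Out b | numA δ.2 + numO δ.2 ≤ numA l.2 + numO l.2 ∧
      IsPrefix l (shift μ δ)}.Finite := (finite_out b _).subset fun δ h => h.1
  have : act μ ⁻¹' cylinder l = ⋃ δ ∈ {δ : Out b | numA δ.2 + numO δ.2 ≤ numA l.2 + numO l.2 ∧
      IsPrefix l (shift μ δ)}, cylinder δ := by
    ext y
    simp only [Set.mem_iUnion, Set.mem_preimage]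
    constructor
    · intro hl
      obtain ⟨e, s, t, h1, h2, h3, h4⟩ := exists_join_mem (act μ y) (mem_act_of_isPrefix μ y) hl
      rw [numA_comp] at h3
      rw [numO_comp] at h4
      refine ⟨⟨e, s⟩, ⟨?_, t, h1.symm⟩, (shift_mem_act μ y ⟨e, s⟩).1 h2⟩
      simp only
      omega
    · rintro ⟨δ, ⟨-, h1⟩, h2⟩
      exact ⟨δ, h2, h1⟩
  rw [this]
  exact hfin.isClopen_biUnion fun δ _ => isClopen_cylinder δ

theorem continuous_act {a b : Vertex k} (μ : a ⟶ b) : Continuous (act μ) := by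
  refine continuous_generateFrom_iff.2 ?_
  rintro _ ⟨l, F, rfl⟩
  rw [Set.preimage_sdiff, Set.preimage_iUnion₂]
  exact ((isClopen_preimage_cylinder μ l).isOpen).sdiff
    (F.finite_toSet.isClosed_biUnion fun ν _ => (isClopen_preimage_cylinder μ ν).isClosed)

/-- The space embeds in a product of two-point spaces. Directedness is a closed condition there
because a common extension can be taken to be a join, which leaves finitely many candidates for each
pair. -/
instance (a : Vertex k) : CompactSpace (DirHered a) := by
  classical
  let φ : DirHered a → Out a → Bool := fun x μ => decide (μ ∈ x.carrier)
  have hφ : ∀ x μ, φ x μ = true ↔ μ ∈ x.carrier := fun x μ => by simp [φ]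
  have hc : ∀ μ : Out a, IsClopen {g : Out a → Bool | g μ = true} := fun μ =>
    (isClopen_discrete {true}).preimage (continuous_apply μ)
  have hind : Topology.IsInducing φ := by
    refine ⟨le_antisymm ?_ ?_⟩
    · rw [← continuous_iff_le_induced]
      refine continuous_pi fun μ => ?_
      refine (IsLocallyConstant.iff_isOpen_fiber.2 fun v => ?_).continuous
      cases v
      · convert (isClosed_cylinder μ).isOpen_compl using 1
        ext x
        simp [φ, cylinder]
      · convert isOpen_cylinder μ using 1
        ext x
        simp [φ, cylinder]
    · refine le_generateFrom ?_
      rintro _ ⟨l, F, rfl⟩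
      refine ⟨{g | g l = true} \ ⋃ μ ∈ F, {g | g μ = true}, (hc l).isOpen.sdiff
        (F.finite_toSet.isClosed_biUnion fun μ _ => (hc μ).isClosed), ?_⟩
      rw [Set.preimage_sdiff, Set.preimage_iUnion₂]
      have h1 : ∀ μ, φ ⁻¹' {g | g μ = true} = cylinder μ := fun μ => Set.ext fun x => hφ x μ
      simp only [h1]
  have hrange : IsClosed (Set.range φ) := by
    have : Set.range φ = {g | g ⟨a, 𝟙 a⟩ = true} ∩
        (⋂ (μ) (ν) (_ : IsPrefix ν μ), {g | g μ = true}ᶜ ∪ {g | g ν = true}) ∩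
        ⋂ (μ : Out a) (ν : Out a), ({g | g μ = true}ᶜ ∪ {g | g ν = true}ᶜ) ∪
          ⋃ l ∈ {l : Out a | numA l.2 + numO l.2 ≤
            (numA μ.2 + numA ν.2) + (numO μ.2 + numO ν.2) ∧ IsPrefix μ l ∧ IsPrefix ν l},
              {g | g l = true} := by
      ext g
      simp only [Set.mem_inter_iff, Set.mem_iInter, Set.mem_union, Set.mem_compl_iff,
        Set.mem_ofPred_eq, Set.mem_iUnion]
      constructor
      · rintro ⟨x, rfl⟩
        simp only [hφ]
        refine ⟨⟨x.id_mem, fun μ ν h => ?_⟩, fun μ ν => ?_⟩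
        · by_cases hμ : μ ∈ x.carrier
          · exact Or.inr (x.hereditary μ hμ ν h)
          · exact Or.inl hμ
        · by_cases hμ : μ ∈ x.carrier
          · by_cases hν : ν ∈ x.carrier
            · obtain ⟨e, s, t, h1, h2, h3, h4⟩ := exists_join_mem x hμ hν
              refine Or.inr ⟨_, ⟨?_, ⟨s, rfl⟩, ⟨t, h1.symm⟩⟩, h2⟩
              simp only
              omega
            · exact Or.inl (Or.inr hν)
          · exact Or.inl (Or.inl hμ)
      · rintro ⟨⟨h1, h2⟩, h3⟩
        refine ⟨⟨{μ | g μ = true}, ⟨_, h1⟩, fun μ hμ ν hν => ?_, fun μ hμ ν h => ?_⟩, ?_⟩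
        · rcases h3 μ ν with (h | h) | ⟨l, ⟨-, h4, h5⟩, h6⟩
          · exact absurd hμ h
          · exact absurd hν h
          · exact ⟨l, h6, h4, h5⟩
        · rcases h2 μ ν h with h | h
          · exact absurd hμ h
          · exact h
        · ext μ
          cases hg : g μ <;> simp [φ, hg]
    rw [this]
    refine ((hc _).isClosed.inter (isClosed_iInter fun μ => isClosed_iInter fun ν =>
      isClosed_iInter fun _ => (hc μ).compl.isClosed.union (hc ν).isClosed)).inter
      (isClosed_iInter fun μ => isClosed_iInter fun ν =>
        ((hc μ).compl.isClosed.union (hc ν).compl.isClosed).union ?_)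
    exact ((finite_out a _).subset fun l h => h.1).isClosed_biUnion fun l _ => (hc l).isClosed
  rw [← isCompact_univ_iff, hind.isCompact_iff, Set.image_univ]
  exact hrange.isCompact

/-! ## The boundary -/

/-- The directed hereditary sets that contain elements of every length. -/
def IsInfinite {a : Vertex k} (x : DirHered a) : Prop :=
  ∀ n : ℕ, ∃ μ ∈ x.carrier, numA μ.2 + numO μ.2 = n

theorem isInfinite_of_forall_le {a : Vertex k} {x : DirHered a}
    (h : ∀ n : ℕ, ∃ μ ∈ x.carrier, n ≤ numA μ.2 + numO μ.2) : IsInfinite x := by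
  intro n
  obtain ⟨μ, hμ, hn⟩ := h n
  obtain ⟨ν, hν, h⟩ := exists_prefix μ n hn
  exact ⟨ν, x.hereditary μ hμ ν hν, h⟩

theorem isClosed_isInfinite (a : Vertex k) : IsClosed {x : DirHered a | IsInfinite x} := by
  have : {x : DirHered a | IsInfinite x} =
      ⋂ n : ℕ, ⋃ μ ∈ {μ : Out a | numA μ.2 + numO μ.2 = n}, cylinder μ := by
    ext x
    simp only [Set.mem_iInter, Set.mem_iUnion, Set.mem_ofPred_eq, IsInfinite]
    exact forall_congr' fun n => ⟨fun ⟨μ, h1, h2⟩ => ⟨μ, h2, h1⟩, fun ⟨μ, h1, h2⟩ => ⟨μ, h2, h1⟩⟩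
  rw [this]
  refine isClosed_iInter fun n => ?_
  exact ((finite_out a n).subset fun μ h => le_of_eq h).isClosed_biUnion
    fun μ _ => isClosed_cylinder μ

theorem isInfinite_act {a b : Vertex k} (μ : a ⟶ b) (x : DirHered b) :
    IsInfinite (act μ x) ↔ IsInfinite x := by
  constructor
  · intro h
    refine isInfinite_of_forall_le fun n => ?_
    obtain ⟨ν, hν, hn⟩ := h (n + (numA μ + numO μ))
    obtain ⟨δ, hδ, ζ, hζ⟩ := hν
    refine ⟨δ, hδ, ?_⟩
    have h1 : numA ν.2 + numA ζ = numA μ + numA δ.2 :=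
      (numA_comp _ _).symm.trans ((congrArg numA hζ).trans (numA_comp _ _))
    have h2 : numO ν.2 + numO ζ = numO μ + numO δ.2 :=
      (numO_comp _ _).symm.trans ((congrArg numO hζ).trans (numO_comp _ _))
    omega
  · intro h
    refine isInfinite_of_forall_le fun n => ?_
    obtain ⟨ν, hν, hn⟩ := h n
    refine ⟨shift μ ν, (shift_mem_act μ x ν).2 hν, ?_⟩
    simp only [shift, numA_comp, numO_comp]
    omega

theorem nf_alphaBeta (a : Vertex k) (m n : ℕ) : nf (alphaBeta a m n) = NormalForm.block m n := rfl

theorem mem_alphaBetaInfty {a : Vertex k} {μ : Out a} :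
    μ ∈ (alphaBetaInfty a).carrier ↔ ∃ m n, nf μ.2 = NormalForm.block m n := by
  constructor
  · rintro ⟨m, n, rfl⟩
    exact ⟨m, n, rfl⟩
  · rintro ⟨m, n, h⟩
    exact ⟨m, n, out_ext h⟩

/-- An element containing a `γ` has a fixed initial block in all its extensions, so it has no common
extension with an `α^m β^n` whose exponents exceed its degree. -/
theorem isMax_alphaBetaInfty (a : Vertex k) (y : DirHered a)
    (h : (alphaBetaInfty a).carrier ⊆ y.carrier) : y = alphaBetaInfty a := by
  refine DirHered.ext (Set.Subset.antisymm (fun μ hμ => ?_) h)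
  rw [mem_alphaBetaInfty]
  have hb : (⟨_, alphaBeta a (numA μ.2 + 1) (numO μ.2 + 1)⟩ : Out a) ∈ y.carrier :=
    h ⟨_, _, rfl⟩
  obtain ⟨l, -, h1, h2⟩ := y.directed μ hμ _ hb
  obtain ⟨z, hz⟩ := isPrefix_iff.1 h1
  obtain ⟨z', hz'⟩ := isPrefix_iff.1 h2
  rw [← hz', nf_alphaBeta, numA, numO] at hz
  rcases hμ' : nf μ.2 with ⟨m, n⟩ | ⟨m, n, j, t⟩
  · exact ⟨m, n, rfl⟩
  · exfalso
    rw [hμ'] at hz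
    cases z' with
    | block _ _ => simp [NormalForm.mul] at hz
    | cons p q j' t' =>
      simp only [NormalForm.mul, NormalForm.cons.injEq, NormalForm.numA, NormalForm.numO] at hz
      omega

theorem act_mono {a b : Vertex k} (μ : a ⟶ b) {x y : DirHered b} :
    (act μ x).carrier ⊆ (act μ y).carrier ↔ x.carrier ⊆ y.carrier := by
  constructor
  · intro h ν hν
    exact (shift_mem_act μ y ν).1 (h ((shift_mem_act μ x ν).2 hν))
  · rintro h l ⟨ν, hν, hl⟩
    exact ⟨ν, h hν, hl⟩

theorem isMax_act {a b : Vertex k} (μ : a ⟶ b) {x : DirHered b}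
    (hx : ∀ y : DirHered b, x.carrier ⊆ y.carrier → y = x) (y : DirHered a)
    (h : (act μ x).carrier ⊆ y.carrier) : y = act μ x := by
  obtain ⟨z, rfl⟩ := exists_act μ y (h (mem_act_of_isPrefix μ x))
  rw [hx z ((act_mono μ).1 h)]

theorem isInfinite_alphaBetaInfty (a : Vertex k) : IsInfinite (alphaBetaInfty a) := fun n =>
  ⟨⟨_, alphaBeta a n 0⟩, ⟨n, 0, rfl⟩, rfl⟩

/-- If the lengths are bounded, directedness makes a longest element `μ` the greatest one, and `x`
is contained in the infinite set `μα^∞β^∞`. -/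
theorem isInfinite_of_isMax {a : Vertex k} {x : DirHered a}
    (hx : ∀ y : DirHered a, x.carrier ⊆ y.carrier → y = x) : IsInfinite x := by
  by_contra h
  have hb : ∃ N, ∀ μ ∈ x.carrier, numA μ.2 + numO μ.2 ≤ N := by
    by_contra! h'
    exact h (isInfinite_of_forall_le fun n => by
      obtain ⟨μ, hμ, h1⟩ := h' n
      exact ⟨μ, hμ, h1.le⟩)
  obtain ⟨N, hN⟩ := hb
  have hfin : x.carrier.Finite := (finite_out a N).subset hN
  obtain ⟨μ, hμ, hmax⟩ := hfin.exists_maximalFor (fun μ => numA μ.2 + numO μ.2) _ x.nonempty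
  have hsub : x.carrier ⊆ (act μ.2 (alphaBetaInfty μ.1)).carrier := by
    intro ν hν
    obtain ⟨l, hl, ⟨f, hf⟩, h2⟩ := x.directed μ hμ ν hν
    have hle := hmax hl (by
      simp only
      rw [← hf, numA_comp, numO_comp]; omega)
    have hlμ : l = μ := by
      refine out_ext ?_
      simp only at hle
      rw [← hf, nf_comp, NormalForm.eq_one_of_length (nf f), NormalForm.mul_one]
      rw [← hf, numA_comp, numO_comp] at hle
      rw [← NormalForm.numA_add_numO]
      change numA f + numO f = 0
      omega
    rw [hlμ] at h2
    exact ⟨⟨_, 𝟙 _⟩, (alphaBetaInfty μ.1).id_mem, by simpa [shift] using h2⟩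
  have e := hx _ hsub
  have h1 := (isInfinite_act μ.2 _).2 (isInfinite_alphaBetaInfty μ.1) (N + 1)
  rw [e] at h1
  obtain ⟨ν, hν, h1⟩ := h1
  have := hN ν hν
  omega

theorem act_alphaBetaInfty_mem_boundary {a b : Vertex k} (μ : a ⟶ b) :
    act μ (alphaBetaInfty b) ∈ boundary a :=
  subset_closure (isMax_act μ (isMax_alphaBetaInfty b))

/-- Neighbourhoods of an infinite set contain cylinders. -/
theorem exists_cylinder_subset (hk : ∀ N : ℕ, ∃ i : ℕ, N ≤ i ∧ 0 < k i) {a : Vertex k}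
    {x : DirHered a} (hx : IsInfinite x) {U : Set (DirHered a)} (hU : IsOpen U) (hxU : x ∈ U) :
    ∃ l : Out a, cylinder l ⊆ U := by
  obtain ⟨l, hl, F, hF, h⟩ := exists_basic hU hxU
  let M := (numA l.2 + numO l.2) + F.sup fun μ => numA μ.2 + numO μ.2
  have hFM : ∀ μ ∈ F, numA μ.2 + numO μ.2 ≤ M := fun μ hμ =>
    (Finset.le_sup (f := fun μ : Out a => numA μ.2 + numO μ.2) hμ).trans (Nat.le_add_left _ _)
  -- The level of the edge `γ` is chosen so that the prefix `w'` of `x` ending there is at least as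
  -- long as `l` and as every element of `F`.
  obtain ⟨i, hi, hki⟩ := hk (a.level + M)
  obtain ⟨w, hw, hwl⟩ := hx (i - a.level)
  obtain ⟨e, s, t, h1, h2, h3, h4⟩ := exists_join_mem x hl hw
  have h5 : i - a.level ≤ numA (l.2 ≫ s) + numO (l.2 ≫ s) := by omega
  have key : ∃ w' ∈ x.carrier, IsPrefix l w' ∧ numA w'.2 + numO w'.2 = i - a.level := by
    obtain ⟨s', hs', hs''⟩ := exists_prefix (⟨e, s⟩ : Out l.1)
      (i - a.level - (numA l.2 + numO l.2)) (by
        rw [numA_comp, numO_comp] at h5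
        simp only
        omega)
    refine ⟨⟨_, l.2 ≫ s'.2⟩, x.hereditary _ h2 _ (IsPrefix.shift l.2 hs'), ⟨s'.2, rfl⟩, ?_⟩
    rw [numA_comp, numO_comp]
    have : numA l.2 + numO l.2 ≤ M := Nat.le_add_right _ _
    omega
  obtain ⟨w', hw', hlw', hlen⟩ := key
  have hlev := level_eq w'.2
  have hki' : 0 < k w'.1.level := by
    have : w'.1.level = i := by omega
    rwa [this]
  -- A set containing `w'γ` avoids `F`: an element of `F` in it would be a prefix of `w'`, and so
  -- would belong to `x`.
  refine ⟨⟨_, w'.2 ≫ gammaEdge w'.1 hki'⟩, fun y hy => ?_⟩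
  refine h y (y.hereditary _ (y.hereditary _ hy _ ⟨gammaEdge w'.1 hki', rfl⟩) _ hlw') ?_
  intro μ hμ hμy
  obtain ⟨n, -, ⟨f, hf⟩, ⟨g, hg⟩⟩ := y.directed μ hμy _ hy
  refine hF μ hμ (x.hereditary _ hw' _ (isPrefix_of_gammaEdge w'.2 hki' μ f g
    (hf.trans hg.symm) ?_))
  have := hFM μ hμ
  omega

/-- The boundary consists of the infinite sets. -/
theorem mem_boundary_iff (hk : ∀ N : ℕ, ∃ i : ℕ, N ≤ i ∧ 0 < k i) {a : Vertex k}
    {x : DirHered a} : x ∈ boundary a ↔ IsInfinite x := by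
  constructor
  · intro hx
    exact closure_minimal (fun y hy => isInfinite_of_isMax hy) (isClosed_isInfinite a) hx
  · intro hx
    rw [boundary, mem_closure_iff]
    intro U hU hxU
    obtain ⟨l, hl⟩ := exists_cylinder_subset hk hx hU hxU
    exact ⟨act l.2 (alphaBetaInfty l.1), hl (mem_act_of_isPrefix l.2 _),
      isMax_act l.2 (isMax_alphaBetaInfty l.1)⟩

end Vertex

/-! ### Reductions of ample groupoids and cocycles. -/

namespace ArrowGroupoid

variable {X : Type u} {G : Type v} [TopologicalSpace X] [TopologicalSpace G] {Γ : ArrowGroupoid X G}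

/-- The reduction of an ample groupoid to a closed invariant set is ample. -/
theorem IsAmple.reduction [T2Space X] (hΓ : Γ.IsAmple) {Y : Set X} (hY : IsClosed Y)
    (hinv : ∀ γ, Γ.rng γ ∈ Y ↔ Γ.src γ ∈ Y) : (Γ.reduction Y).IsAmple where
  continuous_rng := (hΓ.continuous_rng.comp continuous_subtype_val).subtype_mk _
  continuous_src := (hΓ.continuous_src.comp continuous_subtype_val).subtype_mk _
  continuous_one := (hΓ.continuous_one.comp continuous_subtype_val).subtype_mk _
  continuous_inv := (hΓ.continuous_inv.comp continuous_subtype_val).subtype_mk _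
  continuous_mul := by
    refine Continuous.subtype_mk (hΓ.continuous_mul.comp (Continuous.subtype_mk
      (f := fun p : {p : {γ : G // Γ.rng γ ∈ Y ∧ Γ.src γ ∈ Y} × {γ : G // Γ.rng γ ∈ Y ∧ Γ.src γ ∈ Y}
        // (Γ.reduction Y).src p.1 = (Γ.reduction Y).rng p.2} => ((p.1.1.1, p.1.2.1) : G × G)) ?_
        fun p => congrArg Subtype.val p.2)) _
    exact (continuous_subtype_val.comp (continuous_fst.comp continuous_subtype_val)).prodMk
      (continuous_subtype_val.comp (continuous_snd.comp continuous_subtype_val))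
  isOpenMap_rng := by
    rintro _ ⟨W, hW, rfl⟩
    refine ⟨Γ.rng '' W, hΓ.isOpenMap_rng _ hW, ?_⟩
    ext ⟨x, hx⟩
    constructor
    · rintro ⟨γ, hγ, e⟩
      have h1 : Γ.rng γ ∈ Y := by rw [e]; exact hx
      exact ⟨⟨γ, h1, (hinv γ).1 h1⟩, hγ, Subtype.ext e⟩
    · rintro ⟨γ, hγ, e⟩
      exact ⟨γ.1, hγ, congrArg Subtype.val e⟩
  isOpen_units := by
    refine ⟨Set.range Γ.one, hΓ.isOpen_units, ?_⟩
    ext ⟨γ, h1, h2⟩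
    constructor
    · rintro ⟨x, e⟩
      simp only at e
      subst e
      rw [Γ.rng_one] at h1
      exact ⟨⟨x, h1⟩, rfl⟩
    · rintro ⟨x, e⟩
      exact ⟨x.1, congrArg Subtype.val e⟩
  exists_bisection := by
    rintro γ _ ⟨W, hW, rfl⟩ hγ
    obtain ⟨V, hVW, hγV, hVc, hVo, hVr, hVs⟩ := hΓ.exists_bisection γ.1 W hW hγ
    have hcl : IsClosed {γ : G | Γ.rng γ ∈ Y ∧ Γ.src γ ∈ Y} :=
      (hY.preimage hΓ.continuous_rng).inter (hY.preimage hΓ.continuous_src)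
    refine ⟨Subtype.val ⁻¹' V, fun δ hδ => hVW hδ, hγV,
      hcl.isClosedEmbedding_subtypeVal.isCompact_preimage hVc,
      hVo.preimage continuous_subtype_val, ?_, ?_⟩
    · exact fun a ha b hb e => Subtype.ext (hVr ha hb (congrArg Subtype.val e))
    · exact fun a ha b hb e => Subtype.ext (hVs ha hb (congrArg Subtype.val e))

omit [TopologicalSpace X] in
theorem IsCocycle.reduction {c : G → ℤ} (hc : Γ.IsCocycle c) (Y : Set X) :
    (Γ.reduction Y).IsCocycle fun γ => c γ.1 where
  map_mul _ _ _ := hc.map_mul _ _ _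
  continuous := hc.continuous.comp continuous_subtype_val

end ArrowGroupoid

/-! ### The groupoid of `Λ` is Hausdorff and ample; its cocycle. -/

namespace Vertex

open PathCat PathCat.DirHered

variable {k : ℕ → ℕ} {a : Vertex k}

theorem exists_mk (γ : Arrow a) : ∃ (b : Vertex k) (μ ν : a ⟶ b) (x : DirHered b),
    γ = Arrow.mk μ ν x := by
  obtain ⟨⟨b, μ, ν, x⟩, rfl⟩ := Quot.exists_rep γ
  exact ⟨b, μ, ν, x, rfl⟩

theorem isOpenMap_mk {b : Vertex k} (μ ν : a ⟶ b) : IsOpenMap (Arrow.mk μ ν) := fun E hE =>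
  TopologicalSpace.isOpen_generateFrom_of_mem ⟨b, μ, ν, E, hE, rfl⟩

/-- Two triples representing one arrow agree after a common refinement, which also identifies the
arrows nearby. So the maps `Arrow.mk μ ν` are open charts, and continuity can be tested on them. -/
theorem continuous_mk {b : Vertex k} (μ ν : a ⟶ b) : Continuous (Arrow.mk μ ν) := by
  refine continuous_generateFrom_iff.2 ?_
  rintro _ ⟨c, μ', ν', E, hE, rfl⟩
  rw [isOpen_iff_forall_mem_open]
  rintro x ⟨y, hy, e⟩
  obtain ⟨d, δ, ε, z, rfl, rfl, h1, h2⟩ := Arrow.mk_eq_mk.1 e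
  refine ⟨act ε '' (act δ ⁻¹' E), ?_, isOpenMap_act ε _ (hE.preimage (continuous_act δ)),
    ⟨z, hy, rfl⟩⟩
  rintro _ ⟨w, hw, rfl⟩
  exact ⟨act δ w, hw, by rw [Arrow.mk_act, Arrow.mk_act, h1, h2]⟩

theorem isOpen_arrow_iff {U : Set (Arrow a)} :
    IsOpen U ↔ ∀ (b : Vertex k) (μ ν : a ⟶ b), IsOpen (Arrow.mk μ ν ⁻¹' U) := by
  constructor
  · exact fun h b μ ν => h.preimage (continuous_mk μ ν)
  · intro h
    rw [isOpen_iff_forall_mem_open]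
    intro γ hγ
    obtain ⟨b, μ, ν, x, rfl⟩ := exists_mk γ
    exact ⟨Arrow.mk μ ν '' (Arrow.mk μ ν ⁻¹' U), Set.image_preimage_subset _ _,
      isOpenMap_mk μ ν _ (h b μ ν), ⟨x, hγ, rfl⟩⟩

theorem continuous_arrow {Z : Type*} [TopologicalSpace Z] {f : Arrow a → Z}
    (h : ∀ (b : Vertex k) (μ ν : a ⟶ b), Continuous (f ∘ Arrow.mk μ ν)) : Continuous f :=
  ⟨fun _ hU => isOpen_arrow_iff.2 fun b μ ν => hU.preimage (h b μ ν)⟩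

theorem continuous_rng : Continuous (Arrow.rng (a := a)) :=
  continuous_arrow fun _ μ _ => continuous_act μ

theorem continuous_src : Continuous (Arrow.src (a := a)) :=
  continuous_arrow fun _ _ ν => continuous_act ν

/-- `[μ, ν, x]` is sent to the difference of the numbers of edges `α` in `μ` and `ν`. -/
def cocycle : Arrow a → ℤ :=
  Quot.lift (fun t => (numA t.left : ℤ) - numA t.right) (by
    rintro _ _ ⟨μ, ν, η, x⟩
    simp only [numA_comp]
    push_cast
    ring)

theorem cocycle_mk {b : Vertex k} (μ ν : a ⟶ b) (x : DirHered b) :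
    cocycle (Arrow.mk μ ν x) = (numA μ : ℤ) - numA ν := rfl

theorem isCocycle : (groupoid a).IsCocycle cocycle where
  map_mul p q h := by
    obtain ⟨c, hc⟩ := Arrow.exists_isMul p q h
    have e : (groupoid a).mul p q h = c := Arrow.mul_eq h hc
    rw [e]
    obtain ⟨b, μ, ν, η, x, rfl, rfl, rfl⟩ := hc
    simp only [cocycle_mk]
    ring
  continuous := continuous_arrow fun _ μ ν => continuous_const (y := (numA μ : ℤ) - numA ν)

/-- Equal ranges allow both arrows to be written with the same left element and the same point.
Their right elements then have a common extension and equal degree. This gives both the Hausdorff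
property and the triviality of isotropy in the kernel of `c`. -/
theorem eq_of_rng_src_cocycle {p q : Arrow a} (h1 : Arrow.rng p = Arrow.rng q)
    (h2 : Arrow.src p = Arrow.src q) (h3 : cocycle p = cocycle q) : p = q := by
  obtain ⟨b, μ, ν, x, rfl⟩ := exists_mk p
  obtain ⟨b', μ', ν', y, rfl⟩ := exists_mk q
  obtain ⟨d, δ, ε, z, rfl, rfl, e⟩ := exists_common μ μ' x y h1
  rw [Arrow.mk_act, Arrow.mk_act] at h2 h3 ⊢
  rw [cocycle_mk, cocycle_mk, e] at h3
  obtain ⟨d', δ', ε', z', -, -, e'⟩ := exists_common (ν ≫ δ) (ν' ≫ ε) z z h2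
  rw [e, hom_eq_of_degree e' (by omega)]

instance : T2Space (Arrow a) :=
  T2Space.of_injective_continuous (f := fun p : Arrow a => (Arrow.rng p, Arrow.src p, cocycle p))
    (fun _ _ h => eq_of_rng_src_cocycle (congrArg Prod.fst h)
      (congrArg (fun t => t.2.1) h) (congrArg (fun t => t.2.2) h))
    (continuous_rng.prodMk (continuous_src.prodMk isCocycle.continuous))

theorem isAmple (a : Vertex k) : (groupoid a).IsAmple where
  continuous_rng := continuous_rng
  continuous_src := continuous_src
  continuous_one := continuous_mk _ _
  continuous_inv := continuous_arrow fun _ μ ν => continuous_mk ν μ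
  continuous_mul := by
    refine ⟨fun W hW => ?_⟩
    rw [isOpen_iff_forall_mem_open]
    rintro ⟨⟨p, q⟩, h⟩ hp
    obtain ⟨c, hc⟩ := Arrow.exists_isMul p q h
    have e : (groupoid a).mul p q h = c := Arrow.mul_eq h hc
    change (groupoid a).mul p q h ∈ W at hp
    rw [e] at hp
    obtain ⟨b, μ, ν, η, x, rfl, rfl, rfl⟩ := hc
    have hF := hW.preimage (continuous_mk μ η)
    refine ⟨Subtype.val ⁻¹' ((Arrow.mk μ ν '' (Arrow.mk μ η ⁻¹' W)) ×ˢ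
      (Arrow.mk ν η '' (Arrow.mk μ η ⁻¹' W))), ?_,
      ((isOpenMap_mk μ ν _ hF).prod (isOpenMap_mk ν η _ hF)).preimage continuous_subtype_val,
      ⟨⟨x, hp, rfl⟩, ⟨x, hp, rfl⟩⟩⟩
    rintro ⟨⟨_, _⟩, h'⟩ ⟨⟨y, hy, rfl⟩, ⟨z, hz, rfl⟩⟩
    obtain rfl : y = z := act_injective ν h'
    have e' : (groupoid a).mul (Arrow.mk μ ν y) (Arrow.mk ν η y) h' = Arrow.mk μ η y :=
      Arrow.mul_mk μ ν η y h'
    change (groupoid a).mul _ _ _ ∈ W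
    rw [e']
    exact hy
  isOpenMap_rng := by
    intro U hU
    rw [isOpen_iff_forall_mem_open]
    rintro _ ⟨γ, hγ, rfl⟩
    obtain ⟨b, μ, ν, x, rfl⟩ := exists_mk γ
    refine ⟨act μ '' (Arrow.mk μ ν ⁻¹' U), ?_, isOpenMap_act μ _ (hU.preimage (continuous_mk μ ν)),
      ⟨x, hγ, rfl⟩⟩
    rintro _ ⟨y, hy, rfl⟩
    exact ⟨_, hy, rfl⟩
  isOpen_units := by
    have := isOpenMap_mk (𝟙 a) (𝟙 a) _ isOpen_univ
    rwa [Set.image_univ] at this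
  exists_bisection := by
    intro γ W hW hγ
    obtain ⟨b, μ, ν, x, rfl⟩ := exists_mk γ
    obtain ⟨l, hl, F, hF, h⟩ := exists_basic (hW.preimage (continuous_mk μ ν)) hγ
    have hE : IsClopen (cylinder l \ ⋃ μ ∈ F, cylinder μ) :=
      (isClopen_cylinder l).diff (F.finite_toSet.isClopen_biUnion fun μ _ => isClopen_cylinder μ)
    refine ⟨Arrow.mk μ ν '' (cylinder l \ ⋃ μ ∈ F, cylinder μ), ?_, ⟨x, ⟨hl, ?_⟩, rfl⟩,
      hE.isClosed.isCompact.image (continuous_mk μ ν), isOpenMap_mk μ ν _ hE.isOpen, ?_, ?_⟩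
    · rintro _ ⟨y, ⟨hy, hyF⟩, rfl⟩
      simp only [Set.mem_iUnion, not_exists] at hyF
      exact h y hy hyF
    · simp only [Set.mem_iUnion, not_exists]
      exact hF
    · rintro _ ⟨y, -, rfl⟩ _ ⟨z, -, rfl⟩ e
      exact congrArg (Arrow.mk μ ν) (act_injective μ e)
    · rintro _ ⟨y, -, rfl⟩ _ ⟨z, -, rfl⟩ e
      exact congrArg (Arrow.mk μ ν) (act_injective ν e)

/-! ## Compact subgroupoids of the kernel of the cocycle -/

/-- The arrows `[μ, ν, x]` for which `μ` and `ν` have the same degree, bounded by `N`. -/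
def kerSub (a : Vertex k) (N : ℕ) : Set (Arrow a) :=
  {γ | ∃ (b : Vertex k) (μ ν : a ⟶ b) (x : DirHered b), γ = Arrow.mk μ ν x ∧ numA μ = numA ν ∧
    numA μ ≤ N ∧ numO μ ≤ N}

theorem kerSub_mono {N M : ℕ} (h : N ≤ M) : kerSub a N ⊆ kerSub a M := by
  rintro γ ⟨b, μ, ν, x, e, h1, h2, h3⟩
  exact ⟨b, μ, ν, x, e, h1, h2.trans h, h3.trans h⟩

theorem isOpen_kerSub (N : ℕ) : IsOpen (kerSub a N) := by
  rw [isOpen_iff_forall_mem_open]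
  rintro γ ⟨b, μ, ν, x, rfl, h1, h2, h3⟩
  refine ⟨Arrow.mk μ ν '' Set.univ, ?_, isOpenMap_mk μ ν _ isOpen_univ, ⟨x, trivial, rfl⟩⟩
  rintro _ ⟨y, -, rfl⟩
  exact ⟨b, μ, ν, y, rfl, h1, h2, h3⟩

theorem isCompact_kerSub (N : ℕ) : IsCompact (kerSub a N) := by
  let S : Set (Σ b : Vertex k, (a ⟶ b) × (a ⟶ b)) :=
    {p | numA p.2.1 = numA p.2.2 ∧ numA p.2.1 ≤ N ∧ numO p.2.1 ≤ N}
  have hS : S.Finite := by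
    let φ : (Σ b : Vertex k, (a ⟶ b) × (a ⟶ b)) → Out a × Out a :=
      fun p => (⟨p.1, p.2.1⟩, ⟨p.1, p.2.2⟩)
    have hφ : Function.Injective φ := by
      rintro ⟨b, μ, ν⟩ ⟨c, μ', ν'⟩ e
      simp only [φ, Prod.mk.injEq, Sigma.mk.injEq] at e
      obtain ⟨⟨rfl, h1⟩, -, h2⟩ := e
      rw [eq_of_heq h1, eq_of_heq h2]
    refine Set.Finite.of_finite_image (f := φ) ?_ hφ.injOn
    refine ((finite_out a (N + N)).prod (finite_out a (N + N))).subset ?_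
    rintro _ ⟨⟨b, μ, ν⟩, ⟨h1, h2, h3⟩, rfl⟩
    simp only at h1 h2 h3
    have l1 := level_eq μ
    have l2 := level_eq ν
    refine ⟨?_, ?_⟩
    · change numA μ + numO μ ≤ N + N
      omega
    · change numA ν + numO ν ≤ N + N
      omega
  have : kerSub a N = ⋃ p ∈ S, Arrow.mk p.2.1 p.2.2 '' Set.univ := by
    ext γ
    simp only [Set.mem_iUnion]
    constructor
    · rintro ⟨b, μ, ν, x, rfl, h⟩
      exact ⟨⟨b, μ, ν⟩, h, x, trivial, rfl⟩
    · rintro ⟨⟨b, μ, ν⟩, h, x, -, rfl⟩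
      exact ⟨b, μ, ν, x, rfl, h⟩
  rw [this]
  exact hS.isCompact_biUnion fun p _ => isCompact_univ.image (continuous_mk _ _)

theorem inv_mem_kerSub {N : ℕ} {γ : Arrow a} (h : γ ∈ kerSub a N) : γ.inv ∈ kerSub a N := by
  obtain ⟨b, μ, ν, x, rfl, h1, h2, h3⟩ := h
  have l1 := level_eq μ
  have l2 := level_eq ν
  exact ⟨b, ν, μ, x, rfl, h1.symm, by omega, by omega⟩

/-- The two middle elements are refined to their join, whose degree is the coordinatewise maximum.
This is why `kerSub` bounds the two coordinates separately: a bound on length would not survive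
products. -/
theorem mul_mem_kerSub {N : ℕ} {p q : Arrow a} (hp : p ∈ kerSub a N) (hq : q ∈ kerSub a N)
    (h : (groupoid a).src p = (groupoid a).rng q) : (groupoid a).mul p q h ∈ kerSub a N := by
  obtain ⟨b, μ, ν, x, rfl, h1, h2, h3⟩ := hp
  obtain ⟨c, ν', η, y, rfl, h4, h5, h6⟩ := hq
  change act ν x = act ν' y at h
  have hν : (⟨b, ν⟩ : Out a) ∈ (act ν x).carrier := mem_act_of_isPrefix ν x
  have hν' : (⟨c, ν'⟩ : Out a) ∈ (act ν x).carrier := by rw [h]; exact mem_act_of_isPrefix ν' y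
  obtain ⟨e, s, t, hst, hm, hA, hO⟩ := exists_join_mem (act ν x) hν hν'
  simp only at s t hst hm hA hO
  obtain ⟨z, rfl⟩ := exists_act s x ((shift_mem_act ν x ⟨e, s⟩).1 hm)
  have hy : y = act t z := by
    apply act_injective ν'
    rw [← h, ← act_comp, ← act_comp, hst]
  subst hy
  have hmul : (groupoid a).mul (Arrow.mk μ ν (act s z)) (Arrow.mk ν' η (act t z)) h =
      Arrow.mk (μ ≫ s) (η ≫ t) z :=
    Arrow.mul_eq (p := Arrow.mk μ ν (act s z)) (q := Arrow.mk ν' η (act t z)) h ⟨e, μ ≫ s, ν ≫ s, η ≫ t, z, Arrow.mk_act _ _ _ _, by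
      rw [Arrow.mk_act, hst], rfl⟩
  have l1 := level_eq μ
  have l2 := level_eq ν
  have hst' := congrArg numA hst
  simp only [numA_comp, numO_comp] at hA hO hst'
  refine ⟨e, μ ≫ s, η ≫ t, z, hmul, ?_, ?_, ?_⟩ <;> simp only [numA_comp, numO_comp] <;> omega

theorem exists_mem_kerSub {γ : Arrow a} (h : cocycle γ = 0) : ∃ N, γ ∈ kerSub a N := by
  obtain ⟨b, μ, ν, x, rfl⟩ := exists_mk γ
  rw [cocycle_mk] at h
  exact ⟨numA μ + numO μ, b, μ, ν, x, rfl, by omega, by omega, by omega⟩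

theorem rng_mem_boundary_iff (hk : ∀ N : ℕ, ∃ i : ℕ, N ≤ i ∧ 0 < k i) (γ : Arrow a) :
    (groupoid a).rng γ ∈ boundary a ↔ (groupoid a).src γ ∈ boundary a := by
  obtain ⟨b, μ, ν, x, rfl⟩ := exists_mk γ
  rw [mem_boundary_iff hk, mem_boundary_iff hk]
  exact (isInfinite_act μ x).trans (isInfinite_act ν x).symm

theorem isAmple_boundaryGroupoid (hk : ∀ N : ℕ, ∃ i : ℕ, N ≤ i ∧ 0 < k i) (a : Vertex k) :
    (boundaryGroupoid a).IsAmple :=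
  (isAmple a).reduction isClosed_closure (rng_mem_boundary_iff hk)

/-- The increasing open sets `kerSub a N` exhaust the kernel of `c`, so one of them contains the
compact support of `f`. -/
theorem norm_map_le_regRep (hk : ∀ N : ℕ, ∃ i : ℕ, N ≤ i ∧ 0 < k i)
    (f : C_c({γ : Arrow a // (groupoid a).rng γ ∈ boundary a ∧ (groupoid a).src γ ∈ boundary a}, ℂ))
    (hf : ∀ γ, cocycle γ.1 ≠ 0 → f γ = 0) (π : (boundaryGroupoid a).Rep) :
    ‖π.map f‖ ≤
      ‖(ArrowGroupoid.regRep (boundaryGroupoid_locallyInjective a)).map f‖ := by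
  have hclosed : IsClosed {γ : Arrow a |
      (groupoid a).rng γ ∈ boundary a ∧ (groupoid a).src γ ∈ boundary a} :=
    (isClosed_closure.preimage continuous_rng).inter (isClosed_closure.preimage continuous_src)
  have hz : tsupport f ⊆ (fun γ => cocycle γ.1) ⁻¹' {0} := by
    refine closure_minimal (fun γ hγ => ?_)
      ((isClosed_discrete {0}).preimage (isCocycle.continuous.comp continuous_subtype_val))
    by_contra h0
    exact hγ (hf γ h0)
  obtain ⟨N, hN⟩ := f.hasCompactSupport.isCompact.elim_directed_cover
    (fun N => Subtype.val ⁻¹' kerSub a N) (fun N => (isOpen_kerSub N).preimage continuous_subtype_val)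
    (fun γ hγ => Set.mem_iUnion.2 (exists_mem_kerSub (hz hγ)))
    (directed_of_isDirected_le fun _ _ h => Set.preimage_mono (kerSub_mono h))
  refine (isAmple_boundaryGroupoid hk a).norm_map_le_regRep _
    (hclosed.isClosedEmbedding_subtypeVal.isCompact_preimage (isCompact_kerSub N))
    (fun p hp q hq e => mul_mem_kerSub hp hq (congrArg Subtype.val e)) (fun p hp => inv_mem_kerSub hp) f
    (fun γ hγ => ?_) π
  by_contra h0
  exact hγ (hN (subset_tsupport _ h0))

end Vertex

namespace Vertex

open PathCat PathCat.DirHered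

variable {k : ℕ → ℕ} {a b c : Vertex k}

/-! ## Isotropy -/

theorem act_alphaBetaInfty_of_nf {s : a ⟶ b} {m n : ℕ} (hs : nf s = NormalForm.block m n) :
    act s (alphaBetaInfty b) = alphaBetaInfty a := by
  refine isMax_alphaBetaInfty a _ fun μ hμ => ?_
  obtain ⟨p, q, h⟩ := mem_alphaBetaInfty.1 hμ
  refine ⟨⟨_, alphaBeta b p q⟩, ⟨p, q, rfl⟩, isPrefix_iff.2 ⟨NormalForm.block m n, ?_⟩⟩
  rw [h, shift, nf_comp, hs, nf_alphaBeta]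
  simp only [NormalForm.mul, NormalForm.block.injEq]
  omega

theorem exists_isotropy (μ : a ⟶ b) : ∃ γ : Arrow a, Arrow.rng γ = act μ (alphaBetaInfty b) ∧
    Arrow.src γ = act μ (alphaBetaInfty b) ∧ cocycle γ = 1 := by
  -- This is `[μα, μβ, α^∞β^∞]`; both `α` and `β` carry `α^∞β^∞` to `α^∞β^∞`.
  refine ⟨Arrow.mk (μ ≫ alphaBeta b 1 0) (μ ≫ alphaBeta b 0 1) (alphaBetaInfty _), ?_, ?_, ?_⟩
  · change act (μ ≫ alphaBeta b 1 0) _ = _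
    rw [act_comp, act_alphaBetaInfty_of_nf (nf_alphaBeta b 1 0)]
  · change act (μ ≫ alphaBeta b 0 1) _ = _
    rw [act_comp, act_alphaBetaInfty_of_nf (nf_alphaBeta b 0 1)]
  · have h1 : numA (alphaBeta b 1 0) = 1 := rfl
    have h0 : numA (alphaBeta b 0 1) = 0 := rfl
    rw [cocycle_mk, numA_comp, numA_comp, h1, h0]
    push_cast
    ring

/-- If `α^d w = s w` where `s` consists of `d` edges `β` and `γ`, then `s = β^d`, and `w` is again
of this form. -/
theorem exists_eq_act_of_act_eq_act {s t : a ⟶ b} {w : DirHered b} {d : ℕ} (hd : 0 < d)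
    (h : act s w = act t w) (hsA : numA s = 0) (hsO : numO s = d) (htA : numA t = d)
    (htO : numO t = 0) :
    nf s = NormalForm.block 0 d ∧ nf t = NormalForm.block d 0 ∧
      ∃ (c : Vertex k) (s' t' : b ⟶ c) (z : DirHered c), w = act s' z ∧ act s' z = act t' z ∧
        numA s' = 0 ∧ numO s' = d ∧ numA t' = d ∧ numO t' = 0 := by
  have ht : nf t = NormalForm.block d 0 := by
    rcases e : nf t with ⟨m, n⟩ | ⟨m, n, j, r⟩ <;>
      simp only [numA, numO, e, NormalForm.numA, NormalForm.numO] at htA htO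
    · rw [htA, htO]
    · omega
  have hs1 : (⟨b, s⟩ : Out a) ∈ (act s w).carrier := mem_act_of_isPrefix s w
  have ht1 : (⟨b, t⟩ : Out a) ∈ (act s w).carrier := by rw [h]; exact mem_act_of_isPrefix t w
  obtain ⟨c, p, q, hpq, hm, hA, hO⟩ := exists_join_mem (act s w) hs1 ht1
  simp only at p q hpq hm hA hO
  obtain ⟨z, rfl⟩ := exists_act p w ((shift_mem_act s w ⟨c, p⟩).1 hm)
  have hA' := congrArg numA hpq
  have hO' := congrArg numO hpq
  simp only [numA_comp, numO_comp] at hA hO hA' hO'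
  -- The join `sp = tq` has degree `(d, d)`. Its complements `q` of degree `(0, d)` and `p` of
  -- degree `(d, 0)` repeat the situation one stage further: cancelling `t` gives `w = qz = pz`.
  refine ⟨?_, ht, c, q, p, z, ?_, ?_, by omega, by omega, by omega, by omega⟩
  · have e1 := congrArg nf hpq
    rw [nf_comp, nf_comp, ht] at e1
    rcases e : nf s with ⟨m, n⟩ | ⟨m, n, j, r⟩ <;>
      simp only [numA, numO, e, NormalForm.numA, NormalForm.numO] at hsA hsO
    · rw [hsA, hsO]
    · rw [e] at e1
      -- If `s` contained a `γ`, the initial block of `sp` would have no `α`, whereas that of `α^d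
      -- q` has at least `d`.
      rcases e2 : nf q with ⟨m', n'⟩ | ⟨m', n', j', r'⟩ <;> rw [e2] at e1 <;>
        simp only [NormalForm.mul, NormalForm.cons.injEq, reduceCtorEq] at e1
      omega
  · apply act_injective t
    rw [← h, ← act_comp, ← act_comp, hpq]
  · apply act_injective t
    rw [← act_comp, ← hpq, act_comp, h]

/-- Each two stages split off a factor `α^d β^d` from `tw` and leave a set of the same form. -/
theorem exists_block_mem {s t : a ⟶ b} {w : DirHered b} {d : ℕ} (hd : 0 < d)
    (h : act s w = act t w) (hsA : numA s = 0) (hsO : numO s = d) (htA : numA t = d)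
    (htO : numO t = 0) (N : ℕ) :
    ∃ ν ∈ (act t w).carrier, ∃ m n, nf ν.2 = NormalForm.block m n ∧ N ≤ m ∧ N ≤ n := by
  induction N using Nat.strong_induction_on generalizing a b with
  | _ N ih =>
  rcases Nat.eq_zero_or_pos N with rfl | hN
  · exact ⟨⟨a, 𝟙 a⟩, id_mem _, 0, 0, nf_id a, le_rfl, le_rfl⟩
  obtain ⟨-, ht, c, s', t', z, rfl, h', hA1, hO1, hA2, hO2⟩ :=
    exists_eq_act_of_act_eq_act hd h hsA hsO htA htO
  obtain ⟨hs', ht', c', s'', t'', z', rfl, h'', hA3, hO3, hA4, hO4⟩ :=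
    exists_eq_act_of_act_eq_act hd h' hA1 hO1 hA2 hO2
  obtain ⟨ν, hν, m, n, e, hm, hn⟩ := ih (N - 1) (by omega) h'' hA3 hO3 hA4 hO4
  rw [← h''] at hν
  refine ⟨shift t (shift s' ν), (shift_mem_act _ _ _).2 ((shift_mem_act _ _ _).2 hν), d + m, d + n,
    ?_, by omega, by omega⟩
  simp only [shift, nf_comp, ht, hs', e, NormalForm.mul, Nat.zero_add]

theorem eq_alphaBetaInfty_of_act_eq_act {s t : a ⟶ b} {w : DirHered b} {d : ℕ} (hd : 0 < d)
    (h : act s w = act t w) (hsA : numA s = 0) (hsO : numO s = d) (htA : numA t = d)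
    (htO : numO t = 0) : act t w = alphaBetaInfty a := by
  refine isMax_alphaBetaInfty a _ fun μ hμ => ?_
  obtain ⟨p, q, e⟩ := mem_alphaBetaInfty.1 hμ
  obtain ⟨ν, hν, m, n, e', hm, hn⟩ := exists_block_mem hd h hsA hsO htA htO (p + q)
  refine hereditary _ ν hν μ (isPrefix_iff.2 ⟨NormalForm.block (m - p) (n - q), ?_⟩)
  rw [e, e']
  simp only [NormalForm.mul, NormalForm.block.injEq]
  omega

/-- Let `μs = νt` be the join and `x = sz`. Cancelling `ν` gives `sz = tz`. Since `μ` and `ν` have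
equal length, `s` and `t` have degrees `(0, d)` and `(d, 0)`, where `d` is the difference of the
numbers of edges `α`. -/
theorem exists_eq_act_alphaBetaInfty_of_lt {μ ν : a ⟶ b} {x : DirHered b}
    (h : act μ x = act ν x) (hlt : numA ν < numA μ) :
    ∃ (v : Vertex k) (η : a ⟶ v), act μ x = act η (alphaBetaInfty v) := by
  have hμ : (⟨b, μ⟩ : Out a) ∈ (act μ x).carrier := mem_act_of_isPrefix μ x
  have hν : (⟨b, ν⟩ : Out a) ∈ (act μ x).carrier := by rw [h]; exact mem_act_of_isPrefix ν x
  obtain ⟨c, s, t, hst, hm, hA, hO⟩ := exists_join_mem (act μ x) hμ hν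
  simp only at s t hst hm hA hO
  obtain ⟨z, rfl⟩ := exists_act s x ((shift_mem_act μ x ⟨c, s⟩).1 hm)
  have l1 := level_eq μ
  have l2 := level_eq ν
  have hA' := congrArg numA hst
  have hO' := congrArg numO hst
  simp only [numA_comp, numO_comp] at hA hO hA' hO'
  have e : act s z = act t z := by
    apply act_injective ν
    rw [← h, ← act_comp, ← act_comp, hst]
  refine ⟨b, μ, congrArg (act μ) ?_⟩
  rw [e]
  exact eq_alphaBetaInfty_of_act_eq_act (d := numA μ - numA ν) (by omega) e (by omega) (by omega)
    (by omega) (by omega)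

theorem exists_eq_act_alphaBetaInfty {γ : Arrow a} (h : Arrow.rng γ = Arrow.src γ)
    (h0 : cocycle γ ≠ 0) :
    ∃ (v : Vertex k) (η : a ⟶ v), Arrow.rng γ = act η (alphaBetaInfty v) := by
  obtain ⟨b, μ, ν, x, rfl⟩ := exists_mk γ
  rw [cocycle_mk] at h0
  rcases lt_trichotomy (numA ν) (numA μ) with hlt | heq | hlt
  · exact exists_eq_act_alphaBetaInfty_of_lt h hlt
  · omega
  · rw [h]
    exact exists_eq_act_alphaBetaInfty_of_lt h.symm hlt

theorem not_hasTrivialIsotropy_iff (x : boundary a) :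
    ¬ (boundaryGroupoid a).HasTrivialIsotropy x ↔
      ∃ (v : Vertex k) (μ : a ⟶ v), x.1 = act μ (alphaBetaInfty v) := by
  constructor
  · intro h
    simp only [ArrowGroupoid.HasTrivialIsotropy, not_forall] at h
    obtain ⟨γ, hr, hs, hne⟩ := h
    have hr' : Arrow.rng γ.1 = x.1 := congrArg Subtype.val hr
    have hs' : Arrow.src γ.1 = x.1 := congrArg Subtype.val hs
    rw [← hr']
    refine exists_eq_act_alphaBetaInfty (hr'.trans hs'.symm) fun h0 => hne (Subtype.ext ?_)
    refine eq_of_rng_src_cocycle (hr'.trans ((groupoid a).rng_one x.1).symm)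
      (hs'.trans ((groupoid a).src_one x.1).symm) (h0.trans ?_)
    exact (isCocycle.map_one x.1).symm
  · rintro ⟨v, μ, hx⟩ h
    obtain ⟨γ, hr, hs, hc⟩ := exists_isotropy μ
    have e := h ⟨γ, by change Arrow.rng γ ∈ _; rw [hr, ← hx]; exact x.2,
      by change Arrow.src γ ∈ _; rw [hs, ← hx]; exact x.2⟩
      (Subtype.ext (hr.trans hx.symm)) (Subtype.ext (hs.trans hx.symm))
    have e' : γ = (groupoid a).one x.1 := congrArg Subtype.val e
    rw [e', isCocycle.map_one] at hc
    omega

theorem not_isPrincipal (a : Vertex k) : ¬ (boundaryGroupoid a).IsPrincipal := fun h =>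
  (not_hasTrivialIsotropy_iff ⟨_, act_alphaBetaInfty_mem_boundary (𝟙 a)⟩).2 ⟨a, 𝟙 a, rfl⟩ (h _)

/-! ## Density -/

/-- The directed hereditary set `β^∞`. -/
def betaInfty (a : Vertex k) : DirHered a where
  carrier := {μ | ∃ n, nf μ.2 = NormalForm.block 0 n}
  nonempty := ⟨⟨a, 𝟙 a⟩, 0, rfl⟩
  directed := by
    rintro μ ⟨m, hm⟩ ν ⟨n, hn⟩
    refine ⟨⟨_, alphaBeta a 0 (m + n)⟩, ⟨m + n, rfl⟩, isPrefix_iff.2 ⟨NormalForm.block 0 n, ?_⟩,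
      isPrefix_iff.2 ⟨NormalForm.block 0 m, ?_⟩⟩
    · rw [hm, nf_alphaBeta]
      rfl
    · rw [hn, nf_alphaBeta, Nat.add_comm]
      rfl
  hereditary := by
    rintro μ ⟨n, hn⟩ ν h
    obtain ⟨z, hz⟩ := isPrefix_iff.1 h
    rw [hn] at hz
    rcases e : nf ν.2 with ⟨p, q⟩ | ⟨p, q, j, r⟩ <;> rw [e] at hz
    · rcases z with ⟨p', q'⟩ | ⟨p', q', j', r'⟩ <;>
        simp only [NormalForm.mul, NormalForm.block.injEq, reduceCtorEq] at hz
      exact ⟨q, by rw [e, show p = 0 by omega]⟩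
    · simp [NormalForm.mul] at hz

theorem isInfinite_betaInfty (a : Vertex k) : IsInfinite (betaInfty a) := fun n =>
  ⟨⟨_, alphaBeta a 0 n⟩, ⟨n, rfl⟩, Nat.zero_add n⟩

theorem numA_le_of_mem_act_betaInfty (l : a ⟶ b) {μ : Out a}
    (h : μ ∈ (act l (betaInfty b)).carrier) : numA μ.2 ≤ numA l := by
  obtain ⟨ν, ⟨n, hn⟩, ⟨ζ, hζ⟩⟩ := h
  have h1 := congrArg numA hζ
  have h2 : numA ν.2 = 0 := by rw [numA, hn]; rfl
  change numA (μ.2 ≫ ζ) = numA (l ≫ ν.2) at h1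
  rw [numA_comp, numA_comp] at h1
  omega

theorem exists_cylinder_inter_boundary_subset (hk : ∀ N : ℕ, ∃ i : ℕ, N ≤ i ∧ 0 < k i)
    {U : Set (boundary a)} (hU : IsOpen U) (hne : U.Nonempty) :
    ∃ l : Out a, ∀ x : boundary a, x.1 ∈ cylinder l → x ∈ U := by
  obtain ⟨W, hW, rfl⟩ := hU
  obtain ⟨x, hx⟩ := hne
  obtain ⟨l, hl⟩ := exists_cylinder_subset hk ((mem_boundary_iff hk).1 x.2) hW hx
  exact ⟨l, fun y hy => hl hy⟩

/-- Every nonempty open set contains a point `lβ^∞`. It is infinite, hence in the boundary, and its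
boundedly many edges `α` exclude the form `μα^∞β^∞`. -/
theorem isTopologicallyFree (hk : ∀ N : ℕ, ∃ i : ℕ, N ≤ i ∧ 0 < k i) (a : Vertex k) :
    (boundaryGroupoid a).IsTopologicallyFree := by
  refine dense_iff_inter_open.2 fun U hU hne => ?_
  obtain ⟨l, hl⟩ := exists_cylinder_inter_boundary_subset hk hU hne
  refine ⟨⟨act l.2 (betaInfty l.1), (mem_boundary_iff hk).2
    ((isInfinite_act l.2 _).2 (isInfinite_betaInfty l.1))⟩, hl _ (mem_act_of_isPrefix l.2 _), ?_⟩
  by_contra h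
  obtain ⟨v, μ, e⟩ := (not_hasTrivialIsotropy_iff _).1 h
  simp only at e
  have hm : shift μ ⟨_, alphaBeta v (numA l.2 + 1) 0⟩ ∈ (act l.2 (betaInfty l.1)).carrier := by
    rw [e]
    exact (shift_mem_act _ _ _).2 ⟨_, _, rfl⟩
  have h1 := numA_le_of_mem_act_betaInfty l.2 hm
  have h2 : numA (alphaBeta v (numA l.2 + 1) 0) = numA l.2 + 1 := rfl
  simp only [shift, numA_comp] at h1
  omega

theorem isMinimal (hk : ∀ N : ℕ, ∃ i : ℕ, N ≤ i ∧ 0 < k i) (a : Vertex k) :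
    (boundaryGroupoid a).IsMinimal := by
  intro x
  refine dense_iff_inter_open.2 fun U hU hne => ?_
  obtain ⟨⟨b, l⟩, hl⟩ := exists_cylinder_inter_boundary_subset hk hU hne
  have hx := (mem_boundary_iff hk).1 x.2
  -- The prefix `ν` of `x` has the length of `l`, hence the same source. If `x = νz`, the arrow `[l,
  -- ν, z]` moves `x` into the cylinder of `l`.
  obtain ⟨⟨c, ν⟩, hν, hlen⟩ := hx (numA l + numO l)
  have h1 := level_eq l
  have h2 := level_eq ν
  obtain rfl : b = c := Vertex.ext (by simp only at hlen; omega)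
  obtain ⟨z, hz⟩ := exists_act ν x.1 hν
  rw [hz] at hx
  have hy : act l z ∈ boundary a :=
    (mem_boundary_iff hk).2 ((isInfinite_act l z).2 ((isInfinite_act ν z).1 hx))
  exact ⟨⟨act l z, hy⟩, hl _ (mem_act_of_isPrefix l z),
    ⟨Arrow.mk l ν z, hy, by change act ν z ∈ _; rw [← hz]; exact x.2⟩, Subtype.ext hz.symm, rfl⟩

theorem isSimpleCStar_fullCStar (hk : ∀ N : ℕ, ∃ i : ℕ, N ≤ i ∧ 0 < k i) (a : Vertex k) :
    IsSimpleCStar (ArrowGroupoid.fullCStar (boundaryGroupoid_locallyInjective a)) := by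
  have : CompactSpace (boundary a) := isCompact_iff_compactSpace.1 isClosed_closure.isCompact
  have : Nonempty (boundary a) := ⟨⟨_, act_alphaBetaInfty_mem_boundary (𝟙 a)⟩⟩
  exact (isAmple_boundaryGroupoid hk a).isSimpleCStar (boundaryGroupoid_locallyInjective a)
    (isCocycle.reduction _) (norm_map_le_regRep hk) (isTopologicallyFree hk a) (isMinimal hk a)

end Vertex

theorem mainTheorem10 (k : ℕ → ℕ) (hk : ∀ N : ℕ, ∃ i : ℕ, N ≤ i ∧ 0 < k i) :
    (groupoidG k).IsMinimal ∧
    (groupoidG k).IsTopologicallyFree ∧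
    ¬ (groupoidG k).IsPrincipal ∧
    (∀ x : PathCat.DirHered.boundary (baseVertex k),
      ¬ (groupoidG k).HasTrivialIsotropy x ↔
        ∃ (v : Vertex k) (μ : baseVertex k ⟶ v),
          x.1 = PathCat.DirHered.act μ (Vertex.alphaBetaInfty v)) ∧
    IsSimpleCStar (cstarG k) :=
  ⟨Vertex.isMinimal hk _, Vertex.isTopologicallyFree hk _, Vertex.not_isPrincipal _,
    Vertex.not_hasTrivialIsotropy_iff, Vertex.isSimpleCStar_fullCStar hk _⟩
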